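/- Let $0=n_0<n_1<\cdots<n_r<n_{r+1}=n$ be integers and let $\lambda=(\lambda_1\ge\cdots\ge\lambda_n)$ be real numbers with $\lambda_1=\cdots=\lambda_{n_1}>\lambda_{n_1+1}=\cdots=\lambda_{n_2}>\cdots>\lambda_{n_r+1}=\cdots=\lambda_{n}$. Let $\mathcal O_\lambda$ be the set of all $U\,\mathrm{diag}(\lambda)\,U^*$ with $U\in U(n)$, equipped with the Kirillov–Kostant–Souriau symplectic form $\omega_h([X,h],[Y,h])=\mathrm{tr}(ih[X,Y])$ for $h\in\mathcal O_\lambda$ and skew-Hermitian $X,Y$. Put $\mathcal I=\{(i,j): i,j\ge 1,\ i+j\le n+1\}$ and let $\Phi_\lambda=(\Phi_\lambda^{i,j})_{(i,j)\in\mathcal I}:\mathcal O_\lambda\to\mathbb R^{\mathcal I}$ be the Gelfand–Cetlin system: $\Phi_\lambda^{i,j}(x)$ is the $i$-th largest eigenvalue of the leading principal $(i+j-1)\times(i+j-1)$ submatrix of $x$. Its image is the Gelfand–Cetlin polytope $\Delta_\lambda$, consisting of all $(u_{i,j})$ with $u_{i,n+1-i}=\lambda_i$ for $1\le i\le n$ and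 $u_{i,j+1}\ge u_{i,j}\ge u_{i+1,j}$ for $i,j\geq 1$, $i+j\le n$. The ladder diagram $\Gamma_\lambda$ is the subgraph of the unit square grid on $\mathbb Z^2$ induced on the vertex set $\bigcup_{j=0}^r\big([n_j,n_{j+1}]\times[0,n-n_{j+1}]\big)\cap\mathbb Z^2$. Its top vertices are the vertices $(a,b)$ with $a+b=n$. A positive path is a shortest path in $\Gamma_\lambda$ from $(0,0)$ to a top vertex, and a face $\gamma$ of $\Gamma_\lambda$ is a subgraph that contains all top vertices and is a union of positive paths. Let $\square^{(a,b)}$ denote the closed unit box with top-right vertex $(a,b)$, and place the coordinate $u_{i,j}$ in $\square^{(i,j)}$. The face $f_\gamma$ of $\Delta_\lambda$ corresponding to $\gamma$ consists of the $u\in\Delta_\lambda$ such that the coordinates of any two adjacent boxes whose common side is not an edge of $\gamma$ are equal. For $k\ge 1$ and $(p,q)\in\mathbb Z^2$, the $L$-shaped block $L_k(p,q)$ is the union of the boxes $\square^{(p,q+i)}$ and $\square^{(p+i,q)}$, $0\le i\le k-1$. It is rigid in $\gamma$ if no edge of $\gamma$ runs through its interior, and its rightmost edge (the right side of $\square^{(p+k-1,q)}$)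 and its top edge (the top side of $\square^{(p,q+k-1)}$) are edges of $\gamma$. Then for every face $\gamma$ of $\Gamma_\lambda$ the following are equivalent: 1. for some point $u$ in the relative interior of $f_\gamma$, the fiber $\Phi_\lambda^{-1}(u)$ is a Lagrangian submanifold of $(\mathcal O_\lambda,\omega)$; 2. for every point $u$ in the relative interior of $f_\gamma$, the fiber $\Phi_\lambda^{-1}(u)$ is a Lagrangian submanifold of $(\mathcal O_\lambda,\omega)$; 3. the $L$-shaped blocks that are rigid in $\gamma$ cover the whole of $\Gamma_\lambda$, i.e. every unit box of $\Gamma_\lambda$ (unit box whose four vertices lie in $\Gamma_\lambda$) is contained in one of them. -/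

import Mathlib

open scoped Matrix ContDiff Topology

-- The entrywise sup norm; matrices form a finite-dimensional space, so the norm does not matter.
attribute [local instance] Matrix.normedAddCommGroup Matrix.normedSpace

noncomputable section

namespace GelfandCetlin

/-! ### Eigenvalue patterns and co-adjoint orbits -/

/-- `lam` is a non-increasing sequence of `n` real numbers which is constant exactly on the blocks
cut out by `0 = N 0 < N 1 < ⋯ < N r < N (r + 1) = n`; with the (zero-based) indexing by `Fin n`,
the `j`-th block consists of the indices `i` with `N j ≤ i < N (j + 1)`. -/
structure IsEigenvaluePattern {n : ℕ} (r : ℕ) (N : ℕ → ℕ) (lam : Fin n → ℝ) : Prop where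
  zero : N 0 = 0
  last : N (r + 1) = n
  lt : ∀ j ≤ r, N j < N (j + 1)
  eq_of_block : ∀ j ≤ r, ∀ i i' : Fin n, N j ≤ i → (i : ℕ) < N (j + 1) →
    N j ≤ i' → (i' : ℕ) < N (j + 1) → lam i = lam i'
  lt_of_block : ∀ j, 1 ≤ j → j ≤ r → ∀ i i' : Fin n, (i : ℕ) < N j → N j ≤ i' → lam i' < lam i

/-- The orbit of `diag (lam)` under conjugation by the unitary group `U(n)`. -/
def orbit {n : ℕ} (lam : Fin n → ℝ) : Set (Matrix (Fin n) (Fin n) ℂ) :=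
  {x | ∃ U ∈ Matrix.unitaryGroup (Fin n) ℂ,
    x = U * Matrix.diagonal (fun i => (lam i : ℂ)) * Uᴴ}

theorem isHermitian_of_mem_orbit {n : ℕ} {lam : Fin n → ℝ} {x : Matrix (Fin n) (Fin n) ℂ}
    (hx : x ∈ orbit lam) : x.IsHermitian := by
  obtain ⟨U, -, rfl⟩ := hx
  refine Matrix.isHermitian_mul_mul_conjTranspose U ?_
  refine Matrix.isHermitian_diagonal_of_self_adjoint _ ?_
  ext i
  simp

/-! ### The Kirillov-Kostant-Souriau form -/

/-- The Lie algebra `𝔲(n)` of skew-Hermitian matrices. -/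
abbrev SkewHerm (n : ℕ) : Submodule ℝ (Matrix (Fin n) (Fin n) ℂ) :=
  skewAdjoint.submodule ℝ (Matrix (Fin n) (Fin n) ℂ)

/-- The infinitesimal conjugation action `X ↦ [X, h]` of `𝔲(n)` at `h`. -/
def infAction {n : ℕ} (h : Matrix (Fin n) (Fin n) ℂ) :
    SkewHerm n →ₗ[ℝ] Matrix (Fin n) (Fin n) ℂ where
  toFun X := ⁅(X : Matrix (Fin n) (Fin n) ℂ), h⁆
  map_add' X Y := by simp only [Submodule.coe_add, Ring.lie_def]; noncomm_ring
  map_smul' c X := by simp [Ring.lie_def, smul_sub]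

/-- The tangent space `T_h 𝒪 = {[X, h] | X ∈ 𝔲(n)}` of the orbit through `h`. -/
def orbitTangent {n : ℕ} (h : Matrix (Fin n) (Fin n) ℂ) :
    Submodule ℝ (Matrix (Fin n) (Fin n) ℂ) :=
  LinearMap.range (infAction h)

/-- The form `(X, Y) ↦ tr (i h [X, Y])` on `𝔲(n)`, which is real-valued for Hermitian `h`. -/
def preForm {n : ℕ} (h : Matrix (Fin n) (Fin n) ℂ) (X Y : SkewHerm n) : ℝ :=
  (Matrix.trace (Complex.I • (h *
    ⁅(X : Matrix (Fin n) (Fin n) ℂ), (Y : Matrix (Fin n) (Fin n) ℂ)⁆))).re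

/-- The KKS form on `T_h 𝒪`: `ω_h ([X, h], [Y, h]) = tr (i h [X, Y])`; see `kksForm_apply`. -/
def kksForm {n : ℕ} (h : Matrix (Fin n) (Fin n) ℂ) (v w : orbitTangent h) : ℝ :=
  preForm h v.2.choose w.2.choose

theorem trace_mul_lie {n : ℕ} (h X Y : Matrix (Fin n) (Fin n) ℂ) :
    Matrix.trace (h * ⁅X, Y⁆) = - Matrix.trace (Y * ⁅X, h⁆) := by
  simp only [Ring.lie_def, mul_sub, Matrix.trace_sub]
  rw [← mul_assoc, Matrix.trace_mul_comm (h * X) Y, ← mul_assoc h Y X,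
    Matrix.trace_mul_comm (h * Y) X, ← mul_assoc X h Y, Matrix.trace_mul_comm (X * h) Y]
  ring

theorem trace_lie_swap {n : ℕ} (h X Y : Matrix (Fin n) (Fin n) ℂ) :
    Matrix.trace (h * ⁅X, Y⁆) = - Matrix.trace (h * ⁅Y, X⁆) := by
  rw [← Matrix.trace_neg, ← mul_neg, Ring.lie_def, Ring.lie_def, neg_sub]

theorem preForm_congr {n : ℕ} (h : Matrix (Fin n) (Fin n) ℂ) {X X' Y Y' : SkewHerm n}
    (hX : infAction h X = infAction h X') (hY : infAction h Y = infAction h Y') :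
    preForm h X Y = preForm h X' Y' := by
  have hX' : ⁅(X : Matrix (Fin n) (Fin n) ℂ), h⁆ = ⁅(X' : Matrix (Fin n) (Fin n) ℂ), h⁆ := hX
  have hY' : ⁅(Y : Matrix (Fin n) (Fin n) ℂ), h⁆ = ⁅(Y' : Matrix (Fin n) (Fin n) ℂ), h⁆ := hY
  have key : Matrix.trace (h * ⁅(X : Matrix (Fin n) (Fin n) ℂ), (Y : Matrix (Fin n) (Fin n) ℂ)⁆)
      = Matrix.trace (h * ⁅(X' : Matrix (Fin n) (Fin n) ℂ), (Y' : Matrix (Fin n) (Fin n) ℂ)⁆) := by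
    rw [trace_mul_lie, hX', ← trace_mul_lie,
      trace_lie_swap h X' Y, trace_lie_swap h X' Y', trace_mul_lie, hY', ← trace_mul_lie]
  unfold preForm
  rw [Matrix.trace_smul, Matrix.trace_smul, key]

/-- The defining formula of the KKS form; in particular the form is well defined. -/
theorem kksForm_apply {n : ℕ} (h : Matrix (Fin n) (Fin n) ℂ) (X Y : SkewHerm n) :
    kksForm h ⟨infAction h X, X, rfl⟩ ⟨infAction h Y, Y, rfl⟩ =
      (Matrix.trace (Complex.I • (h *
        ⁅(X : Matrix (Fin n) (Fin n) ℂ), (Y : Matrix (Fin n) (Fin n) ℂ)⁆))).re :=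
  preForm_congr h (Exists.choose_spec (p := fun Z => infAction h Z = infAction h X) ⟨X, rfl⟩)
    (Exists.choose_spec (p := fun Z => infAction h Z = infAction h Y) ⟨Y, rfl⟩)

/-! ### Lagrangian submanifolds of the orbit -/

/-- `S` is an embedded smooth submanifold of the normed space `E`: around each of its points a
diffeomorphism between open subsets of `E` carries `S` to a linear subspace. -/
def IsSmoothSubmanifold {E : Type*} [NormedAddCommGroup E] [NormedSpace ℝ E] (S : Set E) : Prop :=
  ∀ x ∈ S, ∃ (φ : OpenPartialHomeomorph E E) (W : Submodule ℝ E), x ∈ φ.source ∧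
    ContDiffOn ℝ ∞ φ φ.source ∧ ContDiffOn ℝ ∞ φ.symm φ.target ∧
    φ '' (S ∩ φ.source) = (W : Set E) ∩ φ.target

/-- The velocities at `x` of smooth curves in `S`; for a submanifold `S` this is `T_x S`. -/
def tangentVectors {E : Type*} [NormedAddCommGroup E] [NormedSpace ℝ E] (S : Set E) (x : E) :
    Set E :=
  {v | ∃ c : ℝ → E, ContDiffAt ℝ ∞ c 0 ∧ c 0 = x ∧ (∀ᶠ t in 𝓝 (0 : ℝ), c t ∈ S) ∧
    HasDerivAt c v 0}

/-- `S` is a Lagrangian submanifold of the orbit of `lam` with its KKS form: an embedded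
submanifold (of the ambient matrix space, equivalently of the orbit, itself embedded) contained in
the orbit, each of whose tangent spaces equals its own symplectic orthogonal complement. -/
structure IsLagrangian {n : ℕ} (lam : Fin n → ℝ) (S : Set (Matrix (Fin n) (Fin n) ℂ)) : Prop where
  subset : S ⊆ orbit lam
  submanifold : IsSmoothSubmanifold S
  tangent_eq : ∀ x ∈ S, ∀ v : orbitTangent x,
    (v : Matrix (Fin n) (Fin n) ℂ) ∈ tangentVectors S x ↔
      ∀ w : orbitTangent x, (w : Matrix (Fin n) (Fin n) ℂ) ∈ tangentVectors S x →
        kksForm x v w = 0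

/-! ### The Gelfand-Cetlin system and its polytope -/

/-- The index set `{(i, j) | i, j ≥ 1, i + j ≤ n + 1}`. -/
abbrev GCIndex (n : ℕ) : Type := {p : ℕ × ℕ // 1 ≤ p.1 ∧ 1 ≤ p.2 ∧ p.1 + p.2 ≤ n + 1}

/-- The `k × k` leading principal submatrix of `x`. -/
def leading {n : ℕ} (x : Matrix (Fin n) (Fin n) ℂ) (k : ℕ) (hk : k ≤ n) :
    Matrix (Fin k) (Fin k) ℂ :=
  x.submatrix (Fin.castLE hk) (Fin.castLE hk)

theorem isHermitian_leading {n : ℕ} {x : Matrix (Fin n) (Fin n) ℂ} (hx : x.IsHermitian)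
    (k : ℕ) (hk : k ≤ n) : (leading x k hk).IsHermitian :=
  hx.submatrix _

/-- The Gelfand-Cetlin system: the `(i, j)` component of `gcMap lam x` is the `i`-th largest
eigenvalue of the leading principal submatrix of `x` of size `i + j - 1`
(`Matrix.IsHermitian.eigenvalues₀` lists the eigenvalues in decreasing order, starting from
index `0`). -/
def gcMap {n : ℕ} (lam : Fin n → ℝ) (x : orbit lam) : GCIndex n → ℝ := fun p =>
  (isHermitian_leading (isHermitian_of_mem_orbit x.2) (p.1.1 + p.1.2 - 1)
    (by have := p.2; omega)).eigenvalues₀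
    ⟨p.1.1 - 1, by rw [Fintype.card_fin]; have := p.2; omega⟩

/-- The fiber of the Gelfand-Cetlin system over `u`, as a set of matrices. -/
def gcFiber {n : ℕ} (lam : Fin n → ℝ) (u : GCIndex n → ℝ) : Set (Matrix (Fin n) (Fin n) ℂ) :=
  Subtype.val '' (gcMap lam ⁻¹' {u})

/-- The Gelfand-Cetlin polytope: `u_{i, n+1-i} = λ_i` and `u_{i, j+1} ≥ u_{i, j} ≥ u_{i+1, j}`. -/
def gcPolytope {n : ℕ} (lam : Fin n → ℝ) : Set (GCIndex n → ℝ) :=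
  {u | (∀ i : Fin n, u ⟨(i + 1, n - i), by have := i.2; dsimp only; omega⟩ = lam i) ∧
    ∀ (i j : ℕ) (hi : 1 ≤ i) (hj : 1 ≤ j) (hij : i + j ≤ n),
      u ⟨(i, j), hi, hj, by dsimp only; omega⟩ ≤
        u ⟨(i, j + 1), hi, by dsimp only; omega, by dsimp only; omega⟩ ∧
      u ⟨(i + 1, j), by dsimp only; omega, hj, by dsimp only; omega⟩ ≤
        u ⟨(i, j), hi, hj, by dsimp only; omega⟩}

/-! ### The ladder diagram and its faces -/

/-- The vertex set `⋃_{j=0}^r [n_j, n_{j+1}] × [0, n - n_{j+1}]` of the ladder diagram. -/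
def ladderVerts (n r : ℕ) (N : ℕ → ℕ) : Set (ℤ × ℤ) :=
  {v | ∃ j ≤ r, (N j : ℤ) ≤ v.1 ∧ v.1 ≤ N (j + 1) ∧ 0 ≤ v.2 ∧ v.2 ≤ (n : ℤ) - N (j + 1)}

/-- The ladder diagram: the subgraph of the square grid on `ℤ²` induced on `ladderVerts`
(points outside `ladderVerts` are present as isolated points of the type only). -/
def ladderDiagram (n r : ℕ) (N : ℕ → ℕ) : SimpleGraph (ℤ × ℤ) where
  Adj v w := v ∈ ladderVerts n r N ∧ w ∈ ladderVerts n r N ∧ |v.1 - w.1| + |v.2 - w.2| = 1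
  symm := ⟨fun v w h => ⟨h.2.1, h.1, by rw [abs_sub_comm w.1, abs_sub_comm w.2]; exact h.2.2⟩⟩
  loopless := ⟨fun v h => by simp at h⟩

/-- The top vertices `(a, b)`, `a + b = n`, of the ladder diagram. -/
def topVerts (n r : ℕ) (N : ℕ → ℕ) : Set (ℤ × ℤ) :=
  {v | v ∈ ladderVerts n r N ∧ v.1 + v.2 = n}

/-- `δ` is the subgraph traced by a positive path: a shortest path from the origin to some top
vertex. -/
def IsPositivePath (n r : ℕ) (N : ℕ → ℕ) (δ : (ladderDiagram n r N).Subgraph) : Prop :=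
  ∃ v ∈ topVerts n r N, ∃ p : (ladderDiagram n r N).Walk (0, 0) v,
    p.length = (ladderDiagram n r N).dist (0, 0) v ∧ δ = p.toSubgraph

/-- A face of the ladder diagram: a subgraph containing all top vertices which is a union of
positive paths. -/
structure IsLadderFace (n r : ℕ) (N : ℕ → ℕ) (γ : (ladderDiagram n r N).Subgraph) : Prop where
  topVerts_subset : topVerts n r N ⊆ γ.verts
  eq_sSup : ∃ P : Set (ladderDiagram n r N).Subgraph,
    (∀ δ ∈ P, IsPositivePath n r N δ) ∧ γ = sSup P

/-- The face `f_γ` of the Gelfand-Cetlin polytope that corresponds to `γ`. The coordinate `u_{i, j}`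
sits in the unit box with top-right corner `(i, j)`, and the coordinates of two adjacent boxes are
equated unless the common side of the boxes is an edge of `γ`. -/
def gcFace {n r : ℕ} {N : ℕ → ℕ} (lam : Fin n → ℝ) (γ : (ladderDiagram n r N).Subgraph) :
    Set (GCIndex n → ℝ) :=
  {u | u ∈ gcPolytope lam ∧
    ∀ (i j : ℕ) (hi : 1 ≤ i) (hj : 1 ≤ j) (hij : i + j ≤ n),
      (¬ γ.Adj ((i : ℤ) - 1, (j : ℤ)) ((i : ℤ), (j : ℤ)) →
        u ⟨(i, j), hi, hj, by dsimp only; omega⟩ =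
          u ⟨(i, j + 1), hi, by dsimp only; omega, by dsimp only; omega⟩) ∧
      (¬ γ.Adj ((i : ℤ), (j : ℤ) - 1) ((i : ℤ), (j : ℤ)) →
        u ⟨(i, j), hi, hj, by dsimp only; omega⟩ =
          u ⟨(i + 1, j), by dsimp only; omega, hj, by dsimp only; omega⟩)}

/-! ### L-shaped blocks -/

/-- The unit boxes of the ladder diagram, i.e. those with all four corners in `ladderVerts`.
A box is recorded by its top-right corner. -/
def ladderBoxes (n r : ℕ) (N : ℕ → ℕ) : Set (ℤ × ℤ) :=
  {c | (c.1, c.2) ∈ ladderVerts n r N ∧ (c.1 - 1, c.2) ∈ ladderVerts n r N ∧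
    (c.1, c.2 - 1) ∈ ladderVerts n r N ∧ (c.1 - 1, c.2 - 1) ∈ ladderVerts n r N}

/-- The boxes (recorded by their top-right corners) that make up the block `L_k(p, q)`. -/
def LBlock (k : ℕ) (p q : ℤ) : Set (ℤ × ℤ) :=
  {c | (c.1 = p ∧ q ≤ c.2 ∧ c.2 ≤ q + k - 1) ∨ (c.2 = q ∧ p ≤ c.1 ∧ c.1 ≤ p + k - 1)}

/-- `L_k(p, q)` is rigid in `γ`. An edge runs through the interior of the block precisely when it
is the common side of two boxes of the block. -/
structure IsRigid {n r : ℕ} {N : ℕ → ℕ} (γ : (ladderDiagram n r N).Subgraph)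
    (k : ℕ) (p q : ℤ) : Prop where
  pos : 1 ≤ k
  no_horizontal : ∀ a b : ℤ, (a, b) ∈ LBlock k p q → (a, b + 1) ∈ LBlock k p q →
    ¬ γ.Adj (a - 1, b) (a, b)
  no_vertical : ∀ a b : ℤ, (a, b) ∈ LBlock k p q → (a + 1, b) ∈ LBlock k p q →
    ¬ γ.Adj (a, b - 1) (a, b)
  rightmost : γ.Adj (p + k - 1, q - 1) (p + k - 1, q)
  top : γ.Adj (p - 1, q + k - 1) (p, q + k - 1)

end GelfandCetlin

end

noncomputable section
namespace GelfandCetlin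
open Polynomial

/-! ### Spectral projections -/

section SpecProj

variable {ι : Type*} [Fintype ι]

/-! The fiber over `u` is a nonempty set of Hermitian matrices whose leading blocks have prescribed
characteristic polynomials (`exists_gcFiber_eq_isospectralSet`). It can be studied one bordering at
a time. If `H` has corner `Y`, last column `b` and last entry `d`, the Schur complement shows that,
for fixed spectrum of `Y`, the spectrum of `H` is equivalent to `d` together with the squared
lengths of the components of `b` in the eigenspaces of `Y` (`charpoly_border_eq_iff`). So each
column ranges over a product of spheres, some of radius zero. Hence the fiber is a smooth
submanifold. Since the unitary centraliser of `Y` acts transitively on these spheres, the tangent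
space at `x` is spanned by the commutators of `x` with the centralisers of its leading blocks
(`tangentVectors_eq_centralTangent`).

Trace identities make this space isotropic, and its symplectic complement consists of the tangent
vectors orthogonal to all these centralisers. The complement is larger than the tangent space
exactly when some eigenvalue of a leading block has the same multiplicity in the next block. Without
such a stable eigenvalue, test matrices built from powers and eigenvectors of `H` force a
complementary vector to be tangent (`last_eq_zero_and_lastCol_mem_levelSpace`). With one, an
explicit rotation lies in the complement and is not tangent (`exists_lie_of_finrank_eq`). Hence a
fiber is Lagrangian iff no multiplicity is stable (`isLagrangian_gcFiber_iff`).

The rest is combinatorics. At a relative interior point of `f_γ` the edges of `γ` are exactly the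
places where adjacent coordinates differ (`adj_top_iff`, `adj_right_iff`). This needs points of the
face separating the two sides of any given edge, obtained by counting lattice paths. In the rows of
the pattern, an interval of equal entries grows by one, keeps its length or shrinks by one in the
next row. The intervals that shrink are peaks and correspond to the rigid L-blocks. If no length is
ever kept, following an interval upwards from any box ends at a peak whose L-block contains the box;
conversely an interval that keeps its length leaves an end box uncovered
(`forall_exists_isPeak_iff`). The criterion holds at every relative interior point, and the relative
interior is nonempty, so the three conditions agree. -/

theorem dotProduct_mulVec_of_isHermitian {P : Matrix ι ι ℂ} (hP : P.IsHermitian) (v w : ι → ℂ) :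
    star v ⬝ᵥ P *ᵥ w = star (P *ᵥ v) ⬝ᵥ w := by
  rw [Matrix.star_mulVec, hP.eq, Matrix.dotProduct_mulVec]

theorem star_dotProduct_self_re (v : ι → ℂ) :
    star v ⬝ᵥ v = (((star v ⬝ᵥ v).re : ℝ) : ℂ) := by
  refine (Complex.conj_eq_iff_re.1 ?_).symm
  simp [dotProduct, mul_comm]

variable [DecidableEq ι]

/-- The Lagrange interpolant at `Y` which, if `Y` is annihilated by `∏ c ∈ S, (X - c)`, is the
projection onto the eigenspace of `c ∈ S`. -/
def specProj (S : Finset ℝ) (c : ℝ) (Y : Matrix ι ι ℂ) : Matrix ι ι ℂ :=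
  aeval Y (Lagrange.basis S id c)

theorem isHermitian_aeval {Y : Matrix ι ι ℂ} (hY : Y.IsHermitian) (f : ℝ[X]) :
    (aeval Y f).IsHermitian := by
  induction f using Polynomial.induction_on' with
  | add p q hp hq => rw [map_add]; exact hp.add hq
  | monomial k a =>
    rw [aeval_monomial, ← Algebra.smul_def, Matrix.IsHermitian, Matrix.conjTranspose_smul,
      (hY.pow k).eq, star_trivial]

theorem isHermitian_specProj {Y : Matrix ι ι ℂ} (hY : Y.IsHermitian) (S : Finset ℝ) (c : ℝ) :
    (specProj S c Y).IsHermitian :=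
  isHermitian_aeval hY _

variable {S : Finset ℝ} {Y : Matrix ι ι ℂ}

theorem sum_specProj (hS : aeval Y (Lagrange.nodal S (id : ℝ → ℝ)) = 0) :
    ∑ c ∈ S, specProj S c Y = 1 := by
  unfold specProj
  rcases S.eq_empty_or_nonempty with rfl | hne
  · simpa using hS.symm
  · rw [← map_sum, Lagrange.sum_basis Function.injective_id.injOn hne, map_one]

/-- `X - c` times the Lagrange basis polynomial at `c` is a multiple of the nodal polynomial, which
kills `Y`; and `X - c` divides `f - f(c)`. The algebra of the projections follows by choosing `f` to
be `X` or a basis polynomial. -/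
theorem aeval_mul_specProj (hS : aeval Y (Lagrange.nodal S (id : ℝ → ℝ)) = 0) {c : ℝ} (hc : c ∈ S)
    (f : ℝ[X]) : aeval Y f * specProj S c Y = f.eval c • specProj S c Y := by
  have h1 : (X - C c) * Lagrange.basis S id c =
      C (∏ j ∈ S.erase c, (c - j)⁻¹) * Lagrange.nodal S (id : ℝ → ℝ) := by
    rw [Lagrange.nodal_eq_mul_nodal_erase hc, Lagrange.basis, Lagrange.nodal]
    simp only [Lagrange.basisDivisor, Finset.prod_mul_distrib, map_prod, id]
    ring
  have h2 : aeval Y (f - C (f.eval c)) * specProj S c Y = 0 := by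
    obtain ⟨g, hg⟩ := X_sub_C_dvd_sub_C_eval (a := c) (p := f)
    rw [hg, specProj, ← map_mul, mul_assoc, mul_left_comm, h1, map_mul, map_mul, hS]
    simp
  rw [map_sub, aeval_C, sub_mul, sub_eq_zero, ← Algebra.smul_def] at h2
  exact h2

theorem mul_specProj (hS : aeval Y (Lagrange.nodal S (id : ℝ → ℝ)) = 0) {c : ℝ} (hc : c ∈ S) :
    Y * specProj S c Y = c • specProj S c Y := by
  simpa using aeval_mul_specProj hS hc X

theorem specProj_mul_self (hS : aeval Y (Lagrange.nodal S (id : ℝ → ℝ)) = 0) {c : ℝ}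
    (hc : c ∈ S) : specProj S c Y * specProj S c Y = specProj S c Y := by
  have h := aeval_mul_specProj hS hc (Lagrange.basis S id c)
  have h1 := Lagrange.eval_basis_self (v := (id : ℝ → ℝ)) (s := S) Function.injective_id.injOn hc
  simp only [id] at h1
  rwa [h1, one_smul] at h

theorem specProj_mul_of_ne (hS : aeval Y (Lagrange.nodal S (id : ℝ → ℝ)) = 0) {c c' : ℝ}
    (hc : c ∈ S) (hne : c ≠ c') : specProj S c' Y * specProj S c Y = 0 := by
  have h := aeval_mul_specProj hS hc (Lagrange.basis S id c')
  have h1 := Lagrange.eval_basis_of_ne (v := (id : ℝ → ℝ)) hne.symm hc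
  simp only [id] at h1
  rwa [h1, zero_smul] at h

theorem mulVec_specProj_mulVec (hS : aeval Y (Lagrange.nodal S (id : ℝ → ℝ)) = 0) {c : ℝ}
    (hc : c ∈ S) (w : ι → ℂ) : Y *ᵥ (specProj S c Y *ᵥ w) = c • (specProj S c Y *ᵥ w) := by
  rw [Matrix.mulVec_mulVec, mul_specProj hS hc, Matrix.smul_mulVec]

theorem aeval_mulVec_of_eigenvector {c : ℝ} {w : ι → ℂ} (hw : Y *ᵥ w = c • w) (f : ℝ[X]) :
    aeval Y f *ᵥ w = f.eval c • w := by
  induction f using Polynomial.induction_on' with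
  | add p q hp hq => rw [map_add, Matrix.add_mulVec, hp, hq, eval_add, add_smul]
  | monomial k a =>
    have : ∀ k : ℕ, (Y ^ k) *ᵥ w = c ^ k • w := by
      intro k
      induction k with
      | zero => simp
      | succ k ih => rw [pow_succ, ← Matrix.mulVec_mulVec, hw, Matrix.mulVec_smul, ih, smul_smul,
          pow_succ']
    rw [aeval_monomial, ← Algebra.smul_def, Matrix.smul_mulVec, this, eval_monomial, smul_smul]

theorem specProj_mulVec_of_eigenvector {c : ℝ} (hc : c ∈ S) {w : ι → ℂ} (hw : Y *ᵥ w = c • w) :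
    specProj S c Y *ᵥ w = w := by
  rw [specProj, aeval_mulVec_of_eigenvector hw]
  have := Lagrange.eval_basis_self (v := (id : ℝ → ℝ)) (s := S) Function.injective_id.injOn hc
  simp only [id] at this
  rw [this, one_smul]

theorem sum_specProj_mulVec (hS : aeval Y (Lagrange.nodal S (id : ℝ → ℝ)) = 0) (w : ι → ℂ) :
    ∑ c ∈ S, specProj S c Y *ᵥ w = w := by
  rw [← Matrix.sum_mulVec, sum_specProj hS, Matrix.one_mulVec]

/-- The squared length `⟪b, P_c b⟫` of the component of `b` in the eigenspace of `c`. -/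
def specWeight (S : Finset ℝ) (c : ℝ) (Y : Matrix ι ι ℂ) (b : ι → ℂ) : ℝ :=
  (star b ⬝ᵥ specProj S c Y *ᵥ b).re

theorem specProj_dotProduct (hY : Y.IsHermitian)
    (hS : aeval Y (Lagrange.nodal S (id : ℝ → ℝ)) = 0) {c : ℝ} (hc : c ∈ S) (v w : ι → ℂ) :
    star v ⬝ᵥ specProj S c Y *ᵥ w = star (specProj S c Y *ᵥ v) ⬝ᵥ specProj S c Y *ᵥ w := by
  rw [← dotProduct_mulVec_of_isHermitian (isHermitian_specProj hY S c), Matrix.mulVec_mulVec,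
    specProj_mul_self hS hc]

theorem ofReal_specWeight (hY : Y.IsHermitian)
    (hS : aeval Y (Lagrange.nodal S (id : ℝ → ℝ)) = 0) {c : ℝ} (hc : c ∈ S) (b : ι → ℂ) :
    (specWeight S c Y b : ℂ) = star b ⬝ᵥ specProj S c Y *ᵥ b := by
  rw [specWeight, specProj_dotProduct hY hS hc, ← star_dotProduct_self_re]

open scoped ComplexOrder in
theorem specWeight_eq_zero_iff (hY : Y.IsHermitian)
    (hS : aeval Y (Lagrange.nodal S (id : ℝ → ℝ)) = 0) {c : ℝ} (hc : c ∈ S) (b : ι → ℂ) :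
    specWeight S c Y b = 0 ↔ specProj S c Y *ᵥ b = 0 := by
  rw [← Complex.ofReal_eq_zero, ofReal_specWeight hY hS hc, specProj_dotProduct hY hS hc,
    dotProduct_star_self_eq_zero]

/-- The spectral projections vary continuously, and nearby projections onto eigenspaces can be
tested against each other. -/
theorem specProj_mulVec_eq_zero_of_compression {Y' : Matrix ι ι ℂ} {c : ℝ} (hc : c ∈ S)
    (hS' : aeval Y' (Lagrange.nodal S (id : ℝ → ℝ)) = 0)
    (hdet : (1 - (specProj S c Y' - specProj S c Y)).det ≠ 0) {w : ι → ℂ}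
    (h : specProj S c Y *ᵥ (specProj S c Y' *ᵥ w) = 0) : specProj S c Y' *ᵥ w = 0 := by
  -- With `P`, `P'` the two projections, the vector `v = P' w` satisfies `P' v = v` and `P v = 0`,
  -- so `1 - (P' - P)` kills it.
  refine Matrix.eq_zero_of_mulVec_eq_zero hdet ?_
  have h1 := congrArg (· *ᵥ w) (specProj_mul_self hS' hc)
  simp only [← Matrix.mulVec_mulVec] at h1
  rw [Matrix.sub_mulVec, Matrix.sub_mulVec, h, h1, Matrix.one_mulVec, sub_zero, sub_self]

end SpecProj
end GelfandCetlin
end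

noncomputable section
namespace GelfandCetlin
open Polynomial

/-! ### Eigenspaces of Hermitian matrices -/

section Eigen

variable {ι : Type*} [Fintype ι] [DecidableEq ι]

/-- The set of eigenvalues of a Hermitian matrix. -/
def specSet {Y : Matrix ι ι ℂ} (hY : Y.IsHermitian) : Finset ℝ :=
  Finset.univ.image hY.eigenvalues

theorem aeval_eq_zero_of_eigenvalues {Y : Matrix ι ι ℂ} (hY : Y.IsHermitian) {f : ℝ[X]}
    (hf : ∀ i, f.eval (hY.eigenvalues i) = 0) : aeval Y f = 0 := by
  have h1 : aeval Y f * (hY.eigenvectorUnitary : Matrix ι ι ℂ) = 0 := by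
    ext i j
    have h2 := congrFun (aeval_mulVec_of_eigenvector (hY.mulVec_eigenvectorBasis j) f) i
    rw [hf, zero_smul] at h2
    exact h2
  have h3 := congrArg (· * star (hY.eigenvectorUnitary : Matrix ι ι ℂ)) h1
  simpa [mul_assoc] using h3

/-- One fixed set of nodes serves all matrices with the same spectrum. On them the spectral
projections are therefore given by fixed polynomials in the matrix, which makes smoothness evident.
-/
theorem aeval_nodal_specSet {Y Y' : Matrix ι ι ℂ} (hY : Y.IsHermitian) (hY' : Y'.IsHermitian)
    (h : Y'.charpoly = Y.charpoly) :
    aeval Y' (Lagrange.nodal (specSet hY) (id : ℝ → ℝ)) = 0 := by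
  refine aeval_eq_zero_of_eigenvalues hY' fun i => ?_
  rw [(hY'.eigenvalues_eq_eigenvalues_iff hY).2 h]
  exact Lagrange.eval_nodal_at_node (v := id) (Finset.mem_image_of_mem _ (Finset.mem_univ i))

/-- The eigenspace of `Y` at `c`. -/
def eigSpace (Y : Matrix ι ι ℂ) (c : ℝ) : Submodule ℂ (ι → ℂ) :=
  LinearMap.ker (Y - (c : ℂ) • 1).mulVecLin

theorem mem_eigSpace {Y : Matrix ι ι ℂ} {c : ℝ} {w : ι → ℂ} :
    w ∈ eigSpace Y c ↔ Y *ᵥ w = c • w := by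
  rw [eigSpace, LinearMap.mem_ker, Matrix.mulVecLin_apply, Matrix.sub_mulVec, Matrix.smul_mulVec,
    Matrix.one_mulVec, sub_eq_zero]
  rfl

theorem finrank_eigSpace {Y : Matrix ι ι ℂ} (hY : Y.IsHermitian) (c : ℝ) :
    Module.finrank ℂ (eigSpace Y c) = (Finset.univ.filter fun i => hY.eigenvalues i = c).card := by
  have h1 : (Y - (c : ℂ) • 1).rank =
      (Matrix.diagonal fun i => ((hY.eigenvalues i : ℂ) - c)).rank := by
    have h2 : Y - (c : ℂ) • 1 = (hY.eigenvectorUnitary : Matrix ι ι ℂ) *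
        (Matrix.diagonal fun i => ((hY.eigenvalues i : ℂ) - c)) *
        star (hY.eigenvectorUnitary : Matrix ι ι ℂ) := by
      have h3 : (Matrix.diagonal fun i => ((hY.eigenvalues i : ℂ) - c)) =
          Matrix.diagonal (RCLike.ofReal ∘ hY.eigenvalues) - (c : ℂ) • 1 := by
        ext i j; by_cases hij : i = j <;> simp [hij]
      rw [h3, mul_sub, sub_mul, mul_smul_comm, mul_one, smul_mul_assoc]
      conv_lhs => rw [hY.spectral_theorem, Unitary.conjStarAlgAut_apply]
      simp
    have h6 := hY.eigenvectorUnitary.2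
    rw [h2, Matrix.rank_mul_eq_left_of_isUnit_det, Matrix.rank_mul_eq_right_of_isUnit_det]
    · exact (Matrix.isUnit_iff_isUnit_det _).1 (IsUnit.of_mul_eq_one _ (Unitary.mem_iff.1 h6).2)
    · exact (Matrix.isUnit_iff_isUnit_det _).1 (IsUnit.of_mul_eq_one _ (Unitary.mem_iff.1 h6).1)
  rw [Matrix.rank_diagonal] at h1
  have h4 := LinearMap.finrank_range_add_finrank_ker (Y - (c : ℂ) • 1).mulVecLin
  rw [Module.finrank_fintype_fun_eq_card] at h4
  have h5 : Fintype.card {i // ((hY.eigenvalues i : ℂ) - c) ≠ 0} +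
      (Finset.univ.filter fun i => hY.eigenvalues i = c).card = Fintype.card ι := by
    rw [Fintype.card_subtype, ← Finset.card_univ (α := ι), add_comm,
      ← Finset.card_filter_add_card_filter_not (s := Finset.univ) (fun i => hY.eigenvalues i = c)]
    simp [sub_eq_zero]
  unfold Matrix.rank at h1
  unfold eigSpace
  omega

end Eigen

/-! ### Bordered Hermitian matrices -/

section Border

variable {m : ℕ}

/-- The last column of a square matrix, without its last entry. -/
def lastCol (H : Matrix (Fin (m + 1)) (Fin (m + 1)) ℂ) : Fin m → ℂ :=
  fun i => H i.castSucc (Fin.last m)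

/-- The matrix without its last row and column. -/
def corner (H : Matrix (Fin (m + 1)) (Fin (m + 1)) ℂ) : Matrix (Fin m) (Fin m) ℂ :=
  H.submatrix Fin.castSucc Fin.castSucc

theorem isHermitian_corner {H : Matrix (Fin (m + 1)) (Fin (m + 1)) ℂ} (hH : H.IsHermitian) :
    (corner H).IsHermitian :=
  hH.submatrix _

/-- Schur complement of the corner block of `T - H`. -/
theorem eval_charpoly_border {H : Matrix (Fin (m + 1)) (Fin (m + 1)) ℂ} (hH : H.IsHermitian)
    {T : ℂ} (hT : IsUnit (Matrix.scalar (Fin m) T - corner H)) :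
    H.charpoly.eval T = (corner H).charpoly.eval T * (T - H (Fin.last m) (Fin.last m) -
      star (lastCol H) ⬝ᵥ (Matrix.scalar (Fin m) T - corner H)⁻¹ *ᵥ lastCol H) := by
  rw [Matrix.eval_charpoly, Matrix.eval_charpoly]
  obtain ⟨hinv⟩ := hT.nonempty_invertible
  have h1 : (Matrix.scalar (Fin (m + 1)) T - H).submatrix finSumFinEquiv finSumFinEquiv =
      Matrix.fromBlocks (Matrix.scalar (Fin m) T - corner H)
        (Matrix.of fun i (_ : Fin 1) => -lastCol H i)
        (Matrix.of fun (_ : Fin 1) j => -star (lastCol H) j)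
        (Matrix.of fun _ _ => T - H (Fin.last m) (Fin.last m)) := by
    have e1 : ∀ i : Fin m, Fin.castAdd 1 i = i.castSucc := fun i => rfl
    have e2 : ∀ i : Fin 1, Fin.natAdd m i = Fin.last m := fun i => by ext; simp
    have e3 : ∀ i : Fin m, Fin.last m ≠ i.castSucc := fun i => (Fin.castSucc_lt_last i).ne'
    ext (i | i) (j | j)
    · simp [corner, e1, Matrix.diagonal_apply]
    · simp [lastCol, e1, e2, (e3 i).symm]
    · simp [lastCol, e1, e2, e3, -Complex.star_def, hH.apply]
    · simp [e2]
  rw [← Matrix.det_submatrix_equiv_self finSumFinEquiv, h1, Matrix.det_fromBlocks₁₁, Matrix.invOf_eq_nonsing_inv]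
  congr 1
  rw [Matrix.det_unique]
  simp [Matrix.mul_apply, dotProduct, Matrix.mulVec, Finset.sum_mul, Finset.mul_sum]
  rw [Finset.sum_comm]
  simp [mul_assoc]

theorem isUnit_scalar_sub {S : Finset ℝ} {Y : Matrix (Fin m) (Fin m) ℂ}
    (hS : aeval Y (Lagrange.nodal S (id : ℝ → ℝ)) = 0) {T : ℂ} (hT : ∀ c ∈ S, T ≠ (c : ℂ)) :
    (Matrix.scalar (Fin m) T - Y) * (∑ c ∈ S, (T - c)⁻¹ • specProj S c Y) = 1 := by
  rw [Finset.mul_sum, ← sum_specProj hS]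
  refine Finset.sum_congr rfl fun c hc => ?_
  rw [mul_smul_comm, sub_mul, mul_specProj hS hc, Matrix.scalar_apply,
    ← Matrix.smul_one_eq_diagonal, smul_mul_assoc, one_mul]
  have : (c : ℝ) • specProj S c Y = (c : ℂ) • specProj S c Y := rfl
  rw [this, ← sub_smul, smul_smul, inv_mul_cancel₀ (sub_ne_zero.2 (hT c hc)), one_smul]

theorem eval_charpoly_border_eq {H : Matrix (Fin (m + 1)) (Fin (m + 1)) ℂ} (hH : H.IsHermitian)
    {S : Finset ℝ} (hS : aeval (corner H) (Lagrange.nodal S (id : ℝ → ℝ)) = 0) {T : ℂ}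
    (hT : ∀ c ∈ S, T ≠ (c : ℂ)) :
    H.charpoly.eval T = (corner H).charpoly.eval T * (T - H (Fin.last m) (Fin.last m) -
      ∑ c ∈ S, (T - c)⁻¹ * specWeight S c (corner H) (lastCol H)) := by
  have h1 := isUnit_scalar_sub hS hT
  rw [eval_charpoly_border hH (IsUnit.of_mul_eq_one _ h1), Matrix.inv_eq_right_inv h1,
    Matrix.sum_mulVec, dotProduct_sum]
  congr 2
  refine Finset.sum_congr rfl fun c hc => ?_
  rw [Matrix.smul_mulVec, dotProduct_smul, smul_eq_mul,
    ofReal_specWeight (isHermitian_corner hH) hS hc]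

theorem trace_eq_of_charpoly_eq {ι : Type*} [Fintype ι] [DecidableEq ι] {A B : Matrix ι ι ℂ}
    (h : A.charpoly = B.charpoly) : A.trace = B.trace := by
  rcases isEmpty_or_nonempty ι with hι | hι
  · simp [Matrix.trace]
  · rw [Matrix.trace_eq_neg_charpoly_coeff, Matrix.trace_eq_neg_charpoly_coeff, h]

theorem trace_border (H : Matrix (Fin (m + 1)) (Fin (m + 1)) ℂ) :
    H.trace = (corner H).trace + H (Fin.last m) (Fin.last m) := by
  simp [Matrix.trace, Fin.sum_univ_castSucc, corner]

/-- Uniqueness of partial fractions: after clearing denominators the sum is a polynomial with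
infinitely many roots, and its value at the node `c` isolates `δ c`. -/
theorem eq_zero_of_sum_inv_sub_eq_zero {S : Finset ℝ} {δ : ℝ → ℂ}
    (h : ∀ T : ℂ, (∀ c ∈ S, T ≠ (c : ℂ)) → ∑ c ∈ S, (T - c)⁻¹ * δ c = 0) :
    ∀ c ∈ S, δ c = 0 := by
  classical
  set v : ℝ → ℂ := fun c => (c : ℂ) with hv
  have hp : ∑ c ∈ S, C (δ c) * Lagrange.nodal (S.erase c) v = 0 := by
    refine Polynomial.eq_zero_of_infinite_isRoot _ (Set.Infinite.mono (s := {T | ∀ c ∈ S, T ≠ v c})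
      ?_ ?_)
    · intro T hT
      have h1 := congrArg (fun z => (Lagrange.nodal S v).eval T * z) (h T hT)
      simp only [mul_zero, Finset.mul_sum] at h1
      rw [Set.mem_ofPred_eq, IsRoot.def, eval_finsetSum, ← h1]
      refine Finset.sum_congr rfl fun c hc => ?_
      rw [Lagrange.nodal_eq_mul_nodal_erase hc, eval_mul, eval_mul, eval_sub, eval_X, eval_C,
        eval_C]
      have : T - v c ≠ 0 := sub_ne_zero.2 (hT c hc)
      change _ = (T - v c) * _ * ((T - v c)⁻¹ * _)
      field_simp
    · have : {T | ∀ c ∈ S, T ≠ v c} = ((S.image v : Finset ℂ) : Set ℂ)ᶜ := by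
        ext T; simp [eq_comm]
      rw [this]
      exact (Finset.finite_toSet _).infinite_compl
  intro c hc
  have h2 := congrArg (eval (v c)) hp
  rw [eval_finsetSum, Finset.sum_eq_single c] at h2
  · rw [eval_mul, eval_C, eval_zero, mul_eq_zero] at h2
    refine h2.resolve_right (Lagrange.eval_nodal_not_at_node fun i hi hne => ?_)
    exact Finset.ne_of_mem_erase hi (Complex.ofReal_injective hne).symm
  · intro c' hc' hne
    rw [eval_mul, Lagrange.eval_nodal_at_node (v := v) (Finset.mem_erase.2 ⟨hne.symm, hc⟩), mul_zero]
  · exact fun h => (h hc).elim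

/-- The quotient of the two characteristic polynomials of `H` and its corner is `T - d - ∑ w_c / (T
- c)`. The trace determines `d`, and the weights `w_c` are then the partial fraction coefficients.
-/
theorem charpoly_border_eq_iff {H H' : Matrix (Fin (m + 1)) (Fin (m + 1)) ℂ}
    (hH : H.IsHermitian) (hH' : H'.IsHermitian) {S : Finset ℝ}
    (hS : aeval (corner H) (Lagrange.nodal S (id : ℝ → ℝ)) = 0)
    (hS' : aeval (corner H') (Lagrange.nodal S (id : ℝ → ℝ)) = 0)
    (hc : (corner H).charpoly = (corner H').charpoly) :
    H.charpoly = H'.charpoly ↔ H (Fin.last m) (Fin.last m) = H' (Fin.last m) (Fin.last m) ∧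
      ∀ c ∈ S, specWeight S c (corner H) (lastCol H) = specWeight S c (corner H') (lastCol H') := by
  constructor
  · intro h
    have hd : H (Fin.last m) (Fin.last m) = H' (Fin.last m) (Fin.last m) := by
      have h1 := trace_eq_of_charpoly_eq h
      rw [trace_border, trace_border, trace_eq_of_charpoly_eq hc] at h1
      exact add_left_cancel h1
    refine ⟨hd, fun c hcS => ?_⟩
    have key := eq_zero_of_sum_inv_sub_eq_zero (S := S)
      (δ := fun c => (specWeight S c (corner H) (lastCol H) : ℂ) -
        specWeight S c (corner H') (lastCol H')) (fun T hT => ?_) c hcS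
    · exact_mod_cast sub_eq_zero.1 key
    · have h1 := eval_charpoly_border_eq hH hS hT
      rw [h, eval_charpoly_border_eq hH' hS' hT, hc, hd] at h1
      have hne : (corner H').charpoly.eval T ≠ 0 := by
        rw [Matrix.eval_charpoly]
        have h2 := congrArg Matrix.det (isUnit_scalar_sub hS' hT)
        rw [Matrix.det_mul, Matrix.det_one] at h2
        exact left_ne_zero_of_mul_eq_one h2
      have h3 := mul_left_cancel₀ hne h1
      simp only [mul_sub, Finset.sum_sub_distrib]
      linear_combination h3
  · rintro ⟨hd, hw⟩
    refine Polynomial.eq_of_infinite_eval_eq _ _ (Set.Infinite.mono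
      (s := ((S.image fun c : ℝ => (c : ℂ)) : Set ℂ)ᶜ) ?_ (Finset.finite_toSet _).infinite_compl)
    intro T hT
    have hT' : ∀ c ∈ S, T ≠ (c : ℂ) := fun c hcS hne =>
      hT (by rw [hne]; exact Finset.mem_coe.2 (Finset.mem_image_of_mem _ hcS))
    rw [Set.mem_ofPred_eq, eval_charpoly_border_eq hH hS hT', eval_charpoly_border_eq hH' hS' hT',
      hc, hd, Finset.sum_congr rfl fun c hcS => by rw [hw c hcS]]

theorem border_mulVec_castSucc (H : Matrix (Fin (m + 1)) (Fin (m + 1)) ℂ) (w : Fin (m + 1) → ℂ)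
    (i : Fin m) : (H *ᵥ w) i.castSucc =
      (corner H *ᵥ fun j => w j.castSucc) i + w (Fin.last m) * lastCol H i := by
  simp [Matrix.mulVec, dotProduct, Fin.sum_univ_castSucc, corner, lastCol, mul_comm]

theorem border_mulVec_last {H : Matrix (Fin (m + 1)) (Fin (m + 1)) ℂ} (hH : H.IsHermitian)
    (w : Fin (m + 1) → ℂ) : (H *ᵥ w) (Fin.last m) =
      (star (lastCol H) ⬝ᵥ fun j => w j.castSucc) + w (Fin.last m) * H (Fin.last m) (Fin.last m) := by
  simp [Matrix.mulVec, dotProduct, Fin.sum_univ_castSucc, lastCol, mul_comm, -Complex.star_def,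
    hH.apply]

/-- Extension of vectors by zero. -/
def snocZero (m : ℕ) : (Fin m → ℂ) →ₗ[ℂ] (Fin (m + 1) → ℂ) where
  toFun w := Fin.snoc (α := fun _ => ℂ) w 0
  map_add' v w := by
    ext i; refine Fin.lastCases ?_ (fun i => ?_) i <;> simp
  map_smul' c w := by
    ext i; refine Fin.lastCases ?_ (fun i => ?_) i <;> simp

@[simp] theorem snocZero_castSucc (w : Fin m → ℂ) (i : Fin m) : snocZero m w i.castSucc = w i := by
  simp [snocZero]

@[simp] theorem snocZero_last (w : Fin m → ℂ) : snocZero m w (Fin.last m) = 0 := by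
  simp [snocZero]

theorem snocZero_injective : Function.Injective (snocZero m) := fun v w h => by
  ext i; rw [← snocZero_castSucc v, h, snocZero_castSucc]

theorem snocZero_mem_eigSpace_iff {H : Matrix (Fin (m + 1)) (Fin (m + 1)) ℂ} (hH : H.IsHermitian)
    {c : ℝ} {w : Fin m → ℂ} : snocZero m w ∈ eigSpace H c ↔
      w ∈ eigSpace (corner H) c ∧ star (lastCol H) ⬝ᵥ w = 0 := by
  rw [mem_eigSpace, mem_eigSpace]
  constructor
  · intro h
    constructor
    · ext i
      have := congrFun h i.castSucc
      rw [border_mulVec_castSucc] at this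
      simpa using this
    · have := congrFun h (Fin.last m)
      rw [border_mulVec_last hH] at this
      simpa using this
  · rintro ⟨h1, h2⟩
    ext i
    refine Fin.lastCases ?_ (fun i => ?_) i
    · rw [border_mulVec_last hH]; simpa using h2
    · rw [border_mulVec_castSucc]; simpa using congrFun h1 i

theorem eq_snocZero_of_last_eq_zero {w : Fin (m + 1) → ℂ} (h : w (Fin.last m) = 0) :
    w = snocZero m fun i => w i.castSucc := by
  ext i; refine Fin.lastCases ?_ (fun i => ?_) i <;> simp [h]

/-- An eigenvector of the bordered matrix with non-zero last entry forces the last column to be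
orthogonal to the eigenspace of the corner. -/
theorem lastCol_orthogonal_of_last_ne_zero {H : Matrix (Fin (m + 1)) (Fin (m + 1)) ℂ}
    (hH : H.IsHermitian) {c : ℝ} {w : Fin (m + 1) → ℂ} (hw : w ∈ eigSpace H c)
    (h : w (Fin.last m) ≠ 0) {e : Fin m → ℂ} (he : e ∈ eigSpace (corner H) c) :
    star (lastCol H) ⬝ᵥ e = 0 := by
  rw [mem_eigSpace] at hw he
  have h1 : corner H *ᵥ (fun j => w j.castSucc) + w (Fin.last m) • lastCol H =
      c • fun j => w j.castSucc := by
    ext i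
    have := congrFun hw i.castSucc
    rw [border_mulVec_castSucc] at this
    exact this
  -- Pairing with the eigenvector `e` cancels the corner term against the right-hand side and leaves
  -- the last entry of `w` times the inner product of `e` with the last column.
  have h2 := congrArg (fun z => star e ⬝ᵥ z) h1
  simp only [dotProduct_add, dotProduct_smul,
    dotProduct_mulVec_of_isHermitian (isHermitian_corner hH), he, star_smul, smul_dotProduct,
    star_trivial, add_eq_left, smul_eq_zero, h, false_or] at h2
  rw [Matrix.star_dotProduct, h2, star_zero]

/-- The multiplicity of `c` is the same for a bordered Hermitian matrix and its corner exactly when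
the two eigenspaces coincide. -/
theorem finrank_eigSpace_border_eq_iff {H : Matrix (Fin (m + 1)) (Fin (m + 1)) ℂ}
    (hH : H.IsHermitian) (c : ℝ) :
    Module.finrank ℂ (eigSpace H c) = Module.finrank ℂ (eigSpace (corner H) c) ↔
      (∀ e ∈ eigSpace (corner H) c, star (lastCol H) ⬝ᵥ e = 0) ∧
        ∀ w ∈ eigSpace H c, w (Fin.last m) = 0 := by
  have hmap : ∀ E : Submodule ℂ (Fin m → ℂ),
      Module.finrank ℂ (E.map (snocZero m)) = Module.finrank ℂ E := fun E =>
    (Submodule.equivMapOfInjective _ snocZero_injective E).finrank_eq.symm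
  constructor
  · intro h
    have h1 : ∀ e ∈ eigSpace (corner H) c, star (lastCol H) ⬝ᵥ e = 0 := by
      by_contra hcon
      push Not at hcon
      obtain ⟨e, he, hne⟩ := hcon
      -- If `e` is not orthogonal to the last column, no eigenvector of `H` at `c` has a non-zero
      -- last entry, so the eigenspace of `H` embeds in that of the corner and misses `e`. The
      -- dimension would drop.
      have h2 : eigSpace H c < (eigSpace (corner H) c).map (snocZero m) := by
        refine lt_of_le_of_ne (fun w hw => ?_) fun heq => ?_
        · have h3 : w (Fin.last m) = 0 := by
            by_contra h3
            exact hne (lastCol_orthogonal_of_last_ne_zero hH hw h3 he)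
          rw [eq_snocZero_of_last_eq_zero h3] at hw ⊢
          exact Submodule.mem_map_of_mem ((snocZero_mem_eigSpace_iff hH).1 hw).1
        · have h4 : snocZero m e ∈ eigSpace H c := heq ▸ Submodule.mem_map_of_mem he
          exact hne ((snocZero_mem_eigSpace_iff hH).1 h4).2
      have h5 := Submodule.finrank_lt_finrank_of_lt h2
      rw [hmap] at h5
      omega
    refine ⟨h1, fun w hw => ?_⟩
    have h2 : (eigSpace (corner H) c).map (snocZero m) ≤ eigSpace H c := by
      rintro _ ⟨e, he, rfl⟩
      exact (snocZero_mem_eigSpace_iff hH).2 ⟨he, h1 e he⟩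
    rw [← Submodule.eq_of_le_of_finrank_eq h2 (by rw [hmap, h])] at hw
    obtain ⟨e, -, rfl⟩ := hw
    exact snocZero_last e
  · rintro ⟨h1, h2⟩
    have h3 : eigSpace H c = (eigSpace (corner H) c).map (snocZero m) := by
      ext w
      constructor
      · intro hw
        have h4 := eq_snocZero_of_last_eq_zero (h2 w hw)
        rw [h4] at hw ⊢
        exact Submodule.mem_map_of_mem ((snocZero_mem_eigSpace_iff hH).1 hw).1
      · rintro ⟨e, he, rfl⟩
        exact (snocZero_mem_eigSpace_iff hH).2 ⟨he, h1 e he⟩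
    rw [h3, hmap]

end Border
end GelfandCetlin
end

noncomputable section
namespace GelfandCetlin
open Polynomial

/-! ### The inverse interlacing problem -/

section Interlacing

/-- Partial fractions of `∏ (X - ν j) / ∏ (X - μ j)`: the quotient of the division is the linear
factor, and Lagrange interpolation of the remainder at the `μ j` gives the weights. Interlacing
makes them non-negative. -/
theorem exists_interlacing_weights_of_injective {m : ℕ} (μ : Fin m → ℝ) (ν : Fin (m + 1) → ℝ)
    (hμ : Antitone μ) (h1 : ∀ i, μ i ≤ ν i.castSucc) (h2 : ∀ i, ν i.succ ≤ μ i)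
    (hinj : Function.Injective μ) :
    ∃ (β : Fin m → ℝ) (d : ℝ), (∀ i, 0 ≤ β i) ∧
      ∏ j, (X - C (ν j)) = (X - C d) * ∏ j, (X - C (μ j)) -
        ∑ i, C (β i) * ∏ j, if j = i then 1 else X - C (μ j) := by
  set R : ℝ[X] := ∏ j, (X - C (ν j)) with hR
  set Q : ℝ[X] := ∏ j, (X - C (μ j)) with hQ
  have hRm : R.Monic := monic_prod_of_monic _ _ fun j _ => monic_X_sub_C _
  have hQm : Q.Monic := monic_prod_of_monic _ _ fun j _ => monic_X_sub_C _
  have hRd : R.natDegree = m + 1 := by rw [hR, natDegree_prod_of_monic _ _ fun j _ => monic_X_sub_C _]; simp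
  have hQd : Q.natDegree = m := by rw [hQ, natDegree_prod_of_monic _ _ fun j _ => monic_X_sub_C _]; simp
  have hdeg : (R /ₘ Q).natDegree = 1 := by rw [natDegree_divByMonic _ hQm, hRd, hQd]; omega
  have hQR : Q.degree ≤ R.degree := by
    rw [degree_eq_natDegree hQm.ne_zero, degree_eq_natDegree hRm.ne_zero, hRd, hQd]
    exact_mod_cast Nat.le_succ m
  have hqm : (R /ₘ Q).Monic := by
    rw [Monic, leadingCoeff_divByMonic_of_monic hQm hQR, hRm]
  have hq := hqm.eq_X_add_C hdeg
  have hρ : (R %ₘ Q).degree < (Finset.univ : Finset (Fin m)).card := by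
    have := degree_modByMonic_lt R hQm
    rwa [degree_eq_natDegree hQm.ne_zero, hQd, ← Finset.card_fin m] at this
  have hρe : ∀ i, (R %ₘ Q).eval (μ i) = R.eval (μ i) := by
    intro i
    have hQ0 : Q.eval (μ i) = 0 := by
      rw [hQ, eval_prod]
      exact Finset.prod_eq_zero (Finset.mem_univ i) (by simp)
    have := congrArg (eval (μ i)) (modByMonic_add_div R Q)
    rwa [eval_add, eval_mul, hQ0, zero_mul, add_zero] at this
  have hb : ∀ i, Lagrange.basis Finset.univ μ i =
      C (∏ j ∈ Finset.univ.erase i, (μ i - μ j)⁻¹) * ∏ j, if j = i then 1 else X - C (μ j) := by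
    intro i
    rw [Lagrange.basis, ← Finset.mul_prod_erase _ _ (Finset.mem_univ i), if_pos rfl, one_mul,
      map_prod, ← Finset.prod_mul_distrib]
    refine Finset.prod_congr rfl fun j hj => ?_
    rw [if_neg (Finset.ne_of_mem_erase hj), Lagrange.basisDivisor]
  have hint := Lagrange.eq_interpolate hinj.injOn hρ
  rw [Lagrange.interpolate_apply] at hint
  refine ⟨fun i => -(R.eval (μ i) * ∏ j ∈ Finset.univ.erase i, (μ i - μ j)⁻¹),
    -(R /ₘ Q).coeff 0, fun i => ?_, ?_⟩
  · beta_reduce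
    -- The factors belonging to `ν i.castSucc` and `ν i.succ` have a non-positive product at `μ i`,
    -- which absorbs the minus sign. Every other factor is paired with the factor `μ i - μ j` of the
    -- same sign.
    rw [hR, eval_prod, Fin.prod_univ_succAbove _ i.castSucc, ← Finset.mul_prod_erase _ _
      (Finset.mem_univ i), Fin.succAbove_castSucc_self]
    simp only [eval_sub, eval_X, eval_C]
    rw [mul_assoc, mul_assoc, ← Finset.prod_mul_distrib, ← mul_assoc, ← neg_mul]
    refine mul_nonneg ?_ (Finset.prod_nonneg fun j hj => ?_)
    · nlinarith [h1 i, h2 i]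
    · rw [← div_eq_mul_inv]
      rcases lt_or_gt_of_ne (Finset.ne_of_mem_erase hj) with hlt | hlt
      · rw [Fin.succAbove_castSucc_of_lt _ _ hlt]
        exact div_nonneg_of_nonpos (by linarith [h1 j, hμ hlt.le]) (by linarith [hμ hlt.le])
      · rw [Fin.succAbove_castSucc_of_le _ _ hlt.le]
        exact div_nonneg (by linarith [h2 j, hμ hlt.le]) (by linarith [hμ hlt.le])
  · conv_lhs => rw [← modByMonic_add_div R Q, hint, hq]
    simp only [hρe, hb, map_neg, map_mul, neg_mul, Finset.sum_neg_distrib]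
    rw [show ∀ a b c : ℝ[X], a * (b + c) = (b + c) * a from fun a b c => mul_comm _ _]
    simp only [mul_assoc, sub_neg_eq_add]
    exact add_comm _ _

/-- A repetition among the `μ` squeezes some `ν` between two equal values. The common linear factor
is divided out and put back with weight zero, which reduces to distinct `μ`. -/
theorem exists_interlacing_weights {m : ℕ} (μ : Fin m → ℝ) (ν : Fin (m + 1) → ℝ)
    (hμ : Antitone μ) (h1 : ∀ i, μ i ≤ ν i.castSucc) (h2 : ∀ i, ν i.succ ≤ μ i) :
    ∃ (β : Fin m → ℝ) (d : ℝ), (∀ i, 0 ≤ β i) ∧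
      ∏ j, (X - C (ν j)) = (X - C d) * ∏ j, (X - C (μ j)) -
        ∑ i, C (β i) * ∏ j, if j = i then 1 else X - C (μ j) := by
  induction m with
  | zero =>
    exact exists_interlacing_weights_of_injective μ ν hμ h1 h2 fun i => i.elim0
  | succ m ih =>
    by_cases hinj : Function.Injective μ
    · exact exists_interlacing_weights_of_injective μ ν hμ h1 h2 hinj
    obtain ⟨a, b, hab, hμab⟩ : ∃ a b, a < b ∧ μ a = μ b := by
      simp only [Function.Injective] at hinj
      push Not at hinj
      obtain ⟨a, b, h, hne⟩ := hinj
      rcases lt_or_gt_of_ne hne with h' | h'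
      exacts [⟨a, b, h', h⟩, ⟨b, a, h', h.symm⟩]
    -- the eigenvalue following `μ a` is tied with it
    have ha : (a : ℕ) < m := by have := b.2; have : (a : ℕ) < b := hab; omega
    set t : Fin (m + 1) := ⟨a + 1, by omega⟩ with ht
    have hat : a ≤ t := by rw [Fin.le_def, ht]; simp
    have htb : t ≤ b := by rw [Fin.le_def, ht]; exact hab
    have hμt : μ t = μ a := le_antisymm (hμ hat) (hμab ▸ hμ htb)
    have hνt : ν t.castSucc = μ t := by
      refine le_antisymm ?_ (h1 t)
      rw [hμt]
      have : t.castSucc = a.succ := by ext; simp [ht]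
      rw [this]; exact h2 a
    obtain ⟨β, d, hβ, hprod⟩ := ih (μ ∘ t.succAbove) (ν ∘ t.castSucc.succAbove)
      (hμ.comp_monotone t.strictMono_succAbove.monotone)
      (fun j => by
        rcases lt_or_ge j.castSucc t with hj | hj
        · have e1 : t.castSucc.succAbove j.castSucc = j.castSucc.castSucc := by
            rw [Fin.succAbove_of_castSucc_lt]; exact hj
          simp only [Function.comp_apply, e1, Fin.succAbove_of_castSucc_lt _ _ hj]
          exact h1 _
        · have e1 : t.castSucc.succAbove j.castSucc = j.succ.castSucc := by
            rw [Fin.succAbove_of_le_castSucc, Fin.succ_castSucc]; exact hj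
          simp only [Function.comp_apply, e1, Fin.succAbove_of_le_castSucc _ _ hj]
          exact h1 _)
      (fun j => by
        have hanti : ν j.succ.succ ≤ μ j.castSucc :=
          (h2 j.succ).trans (hμ (Fin.castSucc_lt_succ).le)
        rcases lt_or_ge j.succ t with hj | hj
        · have e1 : t.castSucc.succAbove j.succ = j.castSucc.succ := by
            rw [Fin.succAbove_of_castSucc_lt, Fin.succ_castSucc]; exact hj
          have hj' : j.castSucc < t := (Fin.castSucc_lt_succ).trans hj
          simp only [Function.comp_apply, e1, Fin.succAbove_of_castSucc_lt _ _ hj']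
          exact h2 _
        · have e1 : t.castSucc.succAbove j.succ = j.succ.succ := by
            rw [Fin.succAbove_of_le_castSucc]; exact hj
          simp only [Function.comp_apply, e1]
          rcases lt_or_ge j.castSucc t with hj' | hj'
          · rw [Fin.succAbove_of_castSucc_lt _ _ hj']; exact hanti
          · rw [Fin.succAbove_of_le_castSucc _ _ hj']; exact h2 _)
    clear_value t
    refine ⟨t.insertNth (α := fun _ => ℝ) 0 β, d, fun i => ?_, ?_⟩
    · refine Fin.succAboveCases t ?_ (fun j => ?_) i <;> simp [hβ]
    · rw [Fin.prod_univ_succAbove _ t.castSucc,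
        Fin.prod_univ_succAbove (fun j => X - C (μ j)) t,
        Fin.sum_univ_succAbove _ t]
      simp only [Function.comp_apply] at hprod
      rw [hprod, hνt]
      simp only [Fin.insertNth_apply_same, map_zero, zero_mul, zero_add,
        Fin.insertNth_apply_succAbove, Fin.prod_univ_succAbove _ t, Fin.succAbove_ne,
        (Fin.succAbove_ne t _).symm, if_false, Fin.succAbove_right_inj]
      rw [mul_sub, Finset.mul_sum]
      exact congrArg₂ (· - ·) (by ring) (Finset.sum_congr rfl fun i _ => by ring)

end Interlacing

theorem exists_unitary_conj_of_charpoly_eq {ι : Type*} [Fintype ι] [DecidableEq ι]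
    {A B : Matrix ι ι ℂ} (hA : A.IsHermitian) (hB : B.IsHermitian) (h : A.charpoly = B.charpoly) :
    ∃ U ∈ Matrix.unitaryGroup ι ℂ, A = U * B * Uᴴ := by
  refine ⟨_, (hA.eigenvectorUnitary * star hB.eigenvectorUnitary).2, ?_⟩
  have h1 := hB.conjStarAlgAut_star_eigenvectorUnitary
  have h2 := hA.spectral_theorem
  rw [(hA.eigenvalues_eq_eigenvalues_iff hB).2 h, ← h1, ← Unitary.conjStarAlgAut_mul_apply,
    Unitary.conjStarAlgAut_apply] at h2
  exact h2

section BorderMatrix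

variable {m : ℕ}

/-- The matrix with corner `Y`, last column `b` and last entry `d`. -/
def border (Y : Matrix (Fin m) (Fin m) ℂ) (b : Fin m → ℂ) (d : ℝ) :
    Matrix (Fin (m + 1)) (Fin (m + 1)) ℂ :=
  Matrix.of (Fin.snoc (α := fun _ => Fin (m + 1) → ℂ)
    (fun i => Fin.snoc (α := fun _ => ℂ) (Y i) (b i)) (Fin.snoc (α := fun _ => ℂ) (star b) (d : ℂ)))

theorem corner_border (Y : Matrix (Fin m) (Fin m) ℂ) (b : Fin m → ℂ) (d : ℝ) :
    corner (border Y b d) = Y := by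
  ext i j; simp [corner, border]

theorem lastCol_border (Y : Matrix (Fin m) (Fin m) ℂ) (b : Fin m → ℂ) (d : ℝ) :
    lastCol (border Y b d) = b := by
  ext i; simp [lastCol, border]

theorem border_last_last (Y : Matrix (Fin m) (Fin m) ℂ) (b : Fin m → ℂ) (d : ℝ) :
    border Y b d (Fin.last m) (Fin.last m) = d := by
  simp [border]

theorem isHermitian_border {Y : Matrix (Fin m) (Fin m) ℂ} (hY : Y.IsHermitian) (b : Fin m → ℂ)
    (d : ℝ) : (border Y b d).IsHermitian := by
  ext i j
  refine Fin.lastCases ?_ (fun i => ?_) i <;> refine Fin.lastCases ?_ (fun j => ?_) j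
  · simp [border]
  · simp [border]
  · simp [border]
  · simpa [border] using hY.apply i j

theorem charpoly_diagonal_ofReal (μ : Fin m → ℝ) :
    (Matrix.diagonal fun i => (μ i : ℂ)).charpoly = (∏ i, (X - C (μ i))).map Complex.ofRealHom := by
  rw [Matrix.charpoly_diagonal, Polynomial.map_prod]
  simp

theorem isHermitian_diagonal_ofReal (μ : Fin m → ℝ) :
    (Matrix.diagonal fun i => (μ i : ℂ)).IsHermitian :=
  Matrix.isHermitian_diagonal_of_self_adjoint _ (by ext i; simp)

/-- A Hermitian matrix can be bordered so that the eigenvalues become any prescribed sequence that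
interlaces the given eigenvalues. -/
theorem exists_border_charpoly {Y : Matrix (Fin m) (Fin m) ℂ} (hY : Y.IsHermitian) {μ : Fin m → ℝ}
    {ν : Fin (m + 1) → ℝ} (hμ : Antitone μ) (h1 : ∀ i, μ i ≤ ν i.castSucc)
    (h2 : ∀ i, ν i.succ ≤ μ i)
    (hYc : Y.charpoly = (∏ i, (X - C (μ i))).map Complex.ofRealHom) :
    ∃ (b : Fin m → ℂ) (d : ℝ),
      (border Y b d).charpoly = (∏ i, (X - C (ν i))).map Complex.ofRealHom := by
  obtain ⟨β, d, hβ, hprod⟩ := exists_interlacing_weights μ ν hμ h1 h2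
  obtain ⟨U, hU, hYU⟩ := exists_unitary_conj_of_charpoly_eq hY (isHermitian_diagonal_ofReal μ)
    (hYc.trans (charpoly_diagonal_ofReal μ).symm)
  have hU1 : U * Uᴴ = 1 := (Unitary.mem_iff.1 hU).2
  have hU2 : Uᴴ * U = 1 := (Unitary.mem_iff.1 hU).1
  -- In the eigenbasis of `Y` the entries of the new column must have squared moduli `β i`; their
  -- phases are free and are taken trivial.
  refine ⟨U *ᵥ fun i => (Real.sqrt (β i) : ℂ), d, Polynomial.eq_of_infinite_eval_eq _ _
    (Set.Infinite.mono (s := ((Finset.univ.image fun i => (μ i : ℂ) : Finset ℂ) : Set ℂ)ᶜ) ?_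
      (Finset.finite_toSet _).infinite_compl)⟩
  intro T hT
  have hT' : ∀ i, T - μ i ≠ 0 := fun i hi =>
    hT (by rw [sub_eq_zero.1 hi]; exact Finset.mem_coe.2 (Finset.mem_image_of_mem _ (Finset.mem_univ i)))
  have hinv : (Matrix.scalar (Fin m) T - Y) *
      (U * (Matrix.diagonal fun i => (T - μ i)⁻¹) * Uᴴ) = 1 := by
    have e1 : Matrix.scalar (Fin m) T - Y = U * (Matrix.diagonal fun i => T - μ i) * Uᴴ := by
      rw [show (Matrix.diagonal fun i => T - (μ i : ℂ)) = Matrix.scalar (Fin m) T -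
        Matrix.diagonal fun i => (μ i : ℂ) from (Matrix.diagonal_sub _ _).symm, mul_sub, sub_mul,
        ← hYU, ← (Matrix.scalar_commute T (fun _ => Commute.all _ _) U).eq, mul_assoc, hU1, mul_one]
    have e2 : (Matrix.diagonal fun i => T - (μ i : ℂ)) * (Matrix.diagonal fun i => (T - μ i)⁻¹) = 1 := by
      rw [Matrix.diagonal_mul_diagonal]
      simp [mul_inv_cancel₀ (hT' _)]
    calc _ = U * (Matrix.diagonal fun i => T - (μ i : ℂ)) * (Uᴴ * U) *
          (Matrix.diagonal fun i => (T - μ i)⁻¹) * Uᴴ := by rw [e1]; noncomm_ring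
      _ = _ := by rw [hU2, mul_one, mul_assoc U, e2, mul_one, hU1]
  rw [Set.mem_ofPred_eq, eval_charpoly_border (isHermitian_border hY _ _) (by
    rw [corner_border]; exact IsUnit.of_mul_eq_one _ hinv), corner_border, lastCol_border,
    border_last_last, Matrix.inv_eq_right_inv hinv, hYc, hprod]
  have hw : star (U *ᵥ fun i => (Real.sqrt (β i) : ℂ)) ⬝ᵥ
      (U * (Matrix.diagonal fun i => (T - μ i)⁻¹) * Uᴴ) *ᵥ (U *ᵥ fun i => (Real.sqrt (β i) : ℂ)) =
      ∑ i, (T - μ i)⁻¹ * β i := by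
    rw [Matrix.mulVec_mulVec, mul_assoc, hU2, mul_one, ← Matrix.mulVec_mulVec, Matrix.star_mulVec,
      ← Matrix.dotProduct_mulVec, Matrix.mulVec_mulVec, hU2, Matrix.one_mulVec]
    simp only [dotProduct, Matrix.mulVec_diagonal, Pi.star_apply]
    refine Finset.sum_congr rfl fun i _ => ?_
    have : (Real.sqrt (β i) : ℂ) * Real.sqrt (β i) = β i := by
      exact_mod_cast Real.mul_self_sqrt (hβ i)
    simp only [Complex.star_def, Complex.conj_ofReal]
    linear_combination (T - μ i)⁻¹ * this
  rw [hw]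
  simp only [Polynomial.map_prod, Polynomial.map_sub, Polynomial.map_mul, Polynomial.map_sum, map_X,
    map_C, eval_prod, eval_sub, eval_mul, eval_finsetSum, eval_X, eval_C, Complex.ofRealHom_eq_coe]
  rw [mul_sub, Finset.mul_sum, mul_comm]
  congr 1
  refine Finset.sum_congr rfl fun i _ => ?_
  rw [← Finset.mul_prod_erase _ _ (Finset.mem_univ i), ← Finset.mul_prod_erase _ (fun j => eval T
    (Polynomial.map Complex.ofRealHom (if j = i then 1 else X - C (μ j)))) (Finset.mem_univ i)]
  have e3 : ∏ j ∈ Finset.univ.erase i, eval T (Polynomial.map Complex.ofRealHom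
      (if j = i then 1 else X - C (μ j))) = ∏ j ∈ Finset.univ.erase i, (T - (μ j : ℂ)) :=
    Finset.prod_congr rfl fun j hj => by simp [Finset.ne_of_mem_erase hj]
  rw [e3]
  have := hT' i
  simp only [if_true, Polynomial.map_one, eval_one, one_mul]
  field_simp

end BorderMatrix
end GelfandCetlin
end

noncomputable section
namespace GelfandCetlin

/-! ### Submanifolds cut out by a local diffeomorphism -/

section Chart

variable {E : Type*} [NormedAddCommGroup E] [NormedSpace ℝ E] [FiniteDimensional ℝ E]

/-- The inverse function theorem, with a source on which the inverse is smooth. -/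
theorem exists_chart_of_injective_fderiv {Φ : E → E} (hΦ : ContDiff ℝ ∞ Φ) {x : E}
    (hinj : ∀ v, fderiv ℝ Φ x v = 0 → v = 0) {U : Set E} (hU : U ∈ 𝓝 x) :
    ∃ φ : OpenPartialHomeomorph E E, x ∈ φ.source ∧ φ.source ⊆ U ∧ (φ : E → E) = Φ ∧
      ContDiffOn ℝ ∞ φ.symm φ.target := by
  have : CompleteSpace E := FiniteDimensional.complete ℝ E
  have hn : (∞ : WithTop ℕ∞) ≠ 0 := by simp
  set e : E ≃L[ℝ] E := (LinearEquiv.ofInjectiveEndo (fderiv ℝ Φ x : E →ₗ[ℝ] E)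
    ((injective_iff_map_eq_zero _).2 hinj)).toContinuousLinearEquiv with he
  have hex : (e : E →L[ℝ] E) = fderiv ℝ Φ x := by ext v; rfl
  have hder : HasFDerivAt Φ (e : E →L[ℝ] E) x := by
    rw [hex]; exact (hΦ.differentiable hn x).hasFDerivAt
  set φ₀ := hΦ.contDiffAt.toOpenPartialHomeomorph Φ hder hn
  have hcont : Continuous (fderiv ℝ Φ) := hΦ.continuous_fderiv hn
  -- Invertibility of the derivative is an open condition. Shrinking the source to this set makes
  -- the inverse smooth at every point of the target, not only at the image of `x`.
  have hV : {y | fderiv ℝ Φ y ∈ Set.range ((↑) : (E ≃L[ℝ] E) → E →L[ℝ] E)} ∈ 𝓝 x := by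
    refine hcont.continuousAt.preimage_mem_nhds ?_
    rw [← hex]
    exact ContinuousLinearEquiv.nhds e
  obtain ⟨s, hs, hso, hxs⟩ := mem_nhds_iff.1 (Filter.inter_mem hU hV)
  refine ⟨φ₀.restrOpen s hso, ⟨hΦ.contDiffAt.mem_toOpenPartialHomeomorph_source hder hn, hxs⟩,
    fun y hy => (hs hy.2).1, rfl, fun z hz => ?_⟩
  have hy : (φ₀.restrOpen s hso).symm z ∈ (φ₀.restrOpen s hso).source :=
    (φ₀.restrOpen s hso).map_target hz
  obtain ⟨e', he'⟩ := (hs hy.2).2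
  refine ((φ₀.restrOpen s hso).contDiffAt_symm (f₀' := e') hz ?_ ?_).contDiffWithinAt
  · rw [he']; exact (hΦ.differentiable hn _).hasFDerivAt
  · exact hΦ.contDiffAt

theorem exists_submanifold_chart {Φ : E → E} (hΦ : ContDiff ℝ ∞ Φ) {x : E}
    (hinj : ∀ v, fderiv ℝ Φ x v = 0 → v = 0) {F : Set E} {W : Submodule ℝ E}
    (hF : ∀ᶠ y in 𝓝 x, y ∈ F ↔ Φ y ∈ W) :
    ∃ (φ : OpenPartialHomeomorph E E) (W : Submodule ℝ E), x ∈ φ.source ∧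
      ContDiffOn ℝ ∞ φ φ.source ∧ ContDiffOn ℝ ∞ φ.symm φ.target ∧
      φ '' (F ∩ φ.source) = (W : Set E) ∩ φ.target := by
  obtain ⟨φ, hx, hU, hφ, hsymm⟩ := exists_chart_of_injective_fderiv hΦ hinj hF
  refine ⟨φ, W, hx, by rw [hφ]; exact hΦ.contDiffOn, hsymm, ?_⟩
  ext z
  constructor
  · rintro ⟨y, ⟨hyF, hy⟩, rfl⟩
    refine ⟨?_, φ.map_source hy⟩
    rw [hφ]
    exact (hU hy).1 hyF
  · rintro ⟨hzW, hz⟩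
    have hy := φ.map_target hz
    refine ⟨φ.symm z, ⟨(hU hy).2 ?_, hy⟩, φ.right_inv hz⟩
    rw [← hφ, φ.right_inv hz]
    exact hzW

/-- A curve in `F` has an image in `W` whose slopes stay in the closed space `W`. Conversely the
local inverse lifts the straight line through `Φ x` in an admissible direction to a smooth curve in
`F`. -/
theorem tangentVectors_eq_of_chart {Φ : E → E} (hΦ : ContDiff ℝ ∞ Φ) {x : E}
    (hinj : ∀ v, fderiv ℝ Φ x v = 0 → v = 0) {F : Set E} {W : Submodule ℝ E}
    (hF : ∀ᶠ y in 𝓝 x, y ∈ F ↔ Φ y ∈ W) (hxF : x ∈ F) :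
    tangentVectors F x = {v | fderiv ℝ Φ x v ∈ W} := by
  have hn : (∞ : WithTop ℕ∞) ≠ 0 := by simp
  have hder : HasFDerivAt Φ (fderiv ℝ Φ x) x := (hΦ.differentiable hn x).hasFDerivAt
  have hxW : Φ x ∈ W := hF.self_of_nhds.1 hxF
  ext v
  constructor
  · rintro ⟨c, hc, rfl, hcF, hcv⟩
    have h1 : HasDerivAt (fun t => Φ (c t)) (fderiv ℝ Φ (c 0) v) 0 :=
      HasFDerivAt.comp_hasDerivAt (0 : ℝ) hder hcv
    have h2 := hasDerivAt_iff_tendsto_slope.1 h1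
    refine W.closed_of_finiteDimensional.mem_of_tendsto h2 ?_
    have h3 : ∀ᶠ t in 𝓝 (0 : ℝ), Φ (c t) ∈ W := by
      filter_upwards [hcF, hcv.continuousAt.eventually hF] with t ht1 ht2
      exact ht2.1 ht1
    filter_upwards [h3.filter_mono nhdsWithin_le_nhds] with t ht
    exact W.smul_mem _ (W.sub_mem ht hxW)
  · intro hv
    obtain ⟨φ, hx, hU, hφ, hsymm⟩ := exists_chart_of_injective_fderiv hΦ hinj hF
    have hlin : ContDiff ℝ ∞ fun t : ℝ => Φ x + t • fderiv ℝ Φ x v := by fun_prop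
    have h0 : Φ x + (0 : ℝ) • fderiv ℝ Φ x v = φ x := by rw [hφ]; simp
    have htar : φ x ∈ φ.target := φ.map_source hx
    have hinv : ∀ z ∈ φ.target, Φ (φ.symm z) = z := fun z hz => by
      have := φ.right_inv hz
      rwa [hφ] at this
    have hs : ContDiffAt ℝ ∞ φ.symm (φ x) :=
      hsymm.contDiffAt (φ.open_target.mem_nhds htar)
    have hcd : ContDiffAt ℝ ∞ (fun t : ℝ => φ.symm (Φ x + t • fderiv ℝ Φ x v)) 0 :=
      ContDiffAt.comp (0 : ℝ) (by rw [h0]; exact hs) hlin.contDiffAt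
    have hev : ∀ᶠ t in 𝓝 (0 : ℝ), Φ x + t • fderiv ℝ Φ x v ∈ φ.target := by
      refine hlin.continuous.continuousAt.eventually (φ.open_target.mem_nhds ?_)
      beta_reduce
      rwa [h0]
    have hc0 : φ.symm (Φ x + (0 : ℝ) • fderiv ℝ Φ x v) = x := by rw [h0, φ.left_inv hx]
    refine ⟨_, hcd, hc0, ?_, ?_⟩
    · filter_upwards [hev] with t ht
      refine (hU (φ.map_target ht)).2 ?_
      rw [hinv _ ht]
      exact W.add_mem hxW (W.smul_mem _ hv)
    · have hd := (hcd.differentiableAt hn).hasDerivAt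
      set v' := deriv (fun t : ℝ => φ.symm (Φ x + t • fderiv ℝ Φ x v)) 0
      have h1 : HasDerivAt (fun t : ℝ => Φ (φ.symm (Φ x + t • fderiv ℝ Φ x v)))
          (fderiv ℝ Φ x v') 0 := HasFDerivAt.comp_hasDerivAt (0 : ℝ) (by rw [hc0]; exact hder) hd
      have h2 : HasDerivAt (fun t : ℝ => Φ x + t • fderiv ℝ Φ x v) (fderiv ℝ Φ x v) 0 := by
        simpa using ((hasDerivAt_id (0 : ℝ)).smul_const (fderiv ℝ Φ x v)).const_add (Φ x)
      have h3 := h1.unique (h2.congr_of_eventuallyEq (by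
        filter_upwards [hev] with t ht
        exact hinv _ ht))
      have h4 : v' = v := sub_eq_zero.1 (hinj _ (by rw [map_sub, h3, sub_self]))
      rwa [h4] at hd

end Chart
end GelfandCetlin
end

noncomputable section
namespace GelfandCetlin
open Polynomial

/-! ### Local equations for the last column -/

section Level

variable {m : ℕ} (S : Finset ℝ) (Y₀ : Matrix (Fin m) (Fin m) ℂ) (b₀ : Fin m → ℂ)

open Classical in
/-- The component at `c` of `levelMap`. -/
def levelTerm (Y : Matrix (Fin m) (Fin m) ℂ) (b : Fin m → ℂ) (c : ℝ) : Fin m → ℂ :=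
  if specWeight S c Y₀ b₀ = 0 then specProj S c Y₀ *ᵥ (specProj S c Y *ᵥ b)
  else specProj S c Y₀ *ᵥ (b - b₀) +
    (((specWeight S c Y b - specWeight S c Y₀ b₀) / 2 -
      (star (specProj S c Y₀ *ᵥ b₀) ⬝ᵥ (b - b₀)).re) / specWeight S c Y₀ b₀) •
        (specProj S c Y₀ *ᵥ b₀)

/-- A map whose membership in `levelSpace` expresses that the weights of `(Y, b)` agree with those
of `(Y₀, b₀)`, and whose derivative in `b` at `(Y₀, b₀)` is the identity. -/
def levelMap (Y : Matrix (Fin m) (Fin m) ℂ) (b : Fin m → ℂ) : Fin m → ℂ :=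
  ∑ c ∈ S, levelTerm S Y₀ b₀ Y b c

/-- The linearised equations preserving the weights of `b₀`. -/
def levelSpace : Submodule ℝ (Fin m → ℂ) where
  carrier := {w | ∀ c ∈ S, (specWeight S c Y₀ b₀ = 0 → specProj S c Y₀ *ᵥ w = 0) ∧
    (star (specProj S c Y₀ *ᵥ b₀) ⬝ᵥ w).re = 0}
  add_mem' {v w} hv hw c hc := by
    refine ⟨fun h => ?_, ?_⟩
    · rw [Matrix.mulVec_add, (hv c hc).1 h, (hw c hc).1 h, add_zero]
    · rw [dotProduct_add, Complex.add_re, (hv c hc).2, (hw c hc).2, add_zero]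
  zero_mem' c hc := by simp
  smul_mem' a w hw c hc := by
    refine ⟨fun h => ?_, ?_⟩
    · rw [Matrix.mulVec_smul, (hw c hc).1 h, smul_zero]
    · rw [dotProduct_smul, Complex.smul_re, (hw c hc).2, smul_zero]

variable {S Y₀ b₀}

theorem specProj_mulVec_self (hS : aeval Y₀ (Lagrange.nodal S (id : ℝ → ℝ)) = 0) {c : ℝ}
    (hc : c ∈ S) (w : Fin m → ℂ) :
    specProj S c Y₀ *ᵥ (specProj S c Y₀ *ᵥ w) = specProj S c Y₀ *ᵥ w := by
  rw [Matrix.mulVec_mulVec, specProj_mul_self hS hc]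

theorem specProj_mulVec_of_ne (hS : aeval Y₀ (Lagrange.nodal S (id : ℝ → ℝ)) = 0) {c c' : ℝ}
    (hc : c ∈ S) (hne : c ≠ c') (w : Fin m → ℂ) :
    specProj S c' Y₀ *ᵥ (specProj S c Y₀ *ᵥ w) = 0 := by
  rw [Matrix.mulVec_mulVec, specProj_mul_of_ne hS hc hne, Matrix.zero_mulVec]

theorem specProj_mulVec_levelMap (hS : aeval Y₀ (Lagrange.nodal S (id : ℝ → ℝ)) = 0)
    (Y : Matrix (Fin m) (Fin m) ℂ) (b : Fin m → ℂ) {c : ℝ} (hc : c ∈ S) :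
    specProj S c Y₀ *ᵥ levelMap S Y₀ b₀ Y b = levelTerm S Y₀ b₀ Y b c := by
  rw [levelMap, Matrix.mulVec_sum, Finset.sum_eq_single c]
  · unfold levelTerm
    split_ifs
    · rw [specProj_mulVec_self hS hc]
    · rw [Matrix.mulVec_add, Matrix.mulVec_smul, specProj_mulVec_self hS hc,
        specProj_mulVec_self hS hc]
  · intro c' hc' hne
    unfold levelTerm
    split_ifs
    · rw [specProj_mulVec_of_ne hS hc' hne]
    · rw [Matrix.mulVec_add, Matrix.mulVec_smul, specProj_mulVec_of_ne hS hc' hne,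
        specProj_mulVec_of_ne hS hc' hne, smul_zero, add_zero]
  · exact fun h => (h hc).elim

/-- The projections of `Y₀` separate the terms of `levelMap`. At a non-zero weight the correction in
`levelTerm` makes the real inner product with the component of `b₀` equal to half the change of the
weight. At weight zero the squared length has zero derivative, so the vanishing of the component
itself is imposed instead, compressed to the fixed eigenspace of `Y₀`. -/
theorem levelMap_mem_levelSpace_iff (hY₀ : Y₀.IsHermitian)
    (hS : aeval Y₀ (Lagrange.nodal S (id : ℝ → ℝ)) = 0)
    (Y : Matrix (Fin m) (Fin m) ℂ) (b : Fin m → ℂ) :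
    levelMap S Y₀ b₀ Y b ∈ levelSpace S Y₀ b₀ ↔ ∀ c ∈ S,
      (specWeight S c Y₀ b₀ = 0 → specProj S c Y₀ *ᵥ (specProj S c Y *ᵥ b) = 0) ∧
      (specWeight S c Y₀ b₀ ≠ 0 → specWeight S c Y b = specWeight S c Y₀ b₀) := by
  refine forall₂_congr fun c hc => ?_
  have h1 := specProj_mulVec_levelMap (b₀ := b₀) hS Y b hc
  by_cases hw : specWeight S c Y₀ b₀ = 0
  · have h2 : specProj S c Y₀ *ᵥ b₀ = 0 := (specWeight_eq_zero_iff hY₀ hS hc b₀).1 hw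
    rw [h1, levelTerm, if_pos hw, h2]
    simp [hw]
  · have h2 : (star (specProj S c Y₀ *ᵥ b₀) ⬝ᵥ levelMap S Y₀ b₀ Y b).re =
        (specWeight S c Y b - specWeight S c Y₀ b₀) / 2 := by
      rw [← dotProduct_mulVec_of_isHermitian (isHermitian_specProj hY₀ S c), h1, levelTerm,
        if_neg hw, dotProduct_add, dotProduct_smul, Complex.add_re, Complex.smul_re,
        dotProduct_mulVec_of_isHermitian (isHermitian_specProj hY₀ S c), ← specWeight]
      rw [smul_eq_mul]
      field_simp
      ring
    rw [h2]
    simp [hw, sub_eq_zero]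

theorem specWeight_add_smul (hY₀ : Y₀.IsHermitian) (c : ℝ) (b' : Fin m → ℂ) (t : ℝ) :
    specWeight S c Y₀ (b₀ + t • b') = specWeight S c Y₀ b₀ +
      2 * t * (star (specProj S c Y₀ *ᵥ b₀) ⬝ᵥ b').re + t ^ 2 * specWeight S c Y₀ b' := by
  have h1 : (star b' ⬝ᵥ specProj S c Y₀ *ᵥ b₀).re = (star (specProj S c Y₀ *ᵥ b₀) ⬝ᵥ b').re := by
    rw [Matrix.star_dotProduct, Complex.star_def, Complex.conj_re]
  have h2 : (star b₀ ⬝ᵥ specProj S c Y₀ *ᵥ b').re = (star (specProj S c Y₀ *ᵥ b₀) ⬝ᵥ b').re := by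
    rw [dotProduct_mulVec_of_isHermitian (isHermitian_specProj hY₀ S c)]
  unfold specWeight
  simp only [star_add, star_smul, star_trivial, Matrix.mulVec_add, Matrix.mulVec_smul,
    add_dotProduct, dotProduct_add, smul_dotProduct, dotProduct_smul, Complex.add_re,
    Complex.smul_re, smul_eq_mul, h1, h2]
  ring

/-- The linear part of the change of weight cancels against the inner product subtracted in
`levelTerm`; only the quadratic part of the weight survives, in `q`. This shows that the derivative
in the column direction is the identity. -/
theorem exists_levelMap_line (hY₀ : Y₀.IsHermitian)
    (hS : aeval Y₀ (Lagrange.nodal S (id : ℝ → ℝ)) = 0) (b' : Fin m → ℂ) :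
    ∃ q : Fin m → ℂ, ∀ t : ℝ,
      levelMap S Y₀ b₀ Y₀ (b₀ + t • b') = t • b' + t ^ 2 • q := by
  classical
  refine ⟨∑ c ∈ S, if specWeight S c Y₀ b₀ = 0 then 0 else
    (specWeight S c Y₀ b' / 2 / specWeight S c Y₀ b₀) • (specProj S c Y₀ *ᵥ b₀), fun t => ?_⟩
  conv_rhs => rw [show t • b' = ∑ c ∈ S, t • (specProj S c Y₀ *ᵥ b') by
    rw [← Finset.smul_sum, sum_specProj_mulVec hS], Finset.smul_sum, ← Finset.sum_add_distrib]
  refine Finset.sum_congr rfl fun c hc => ?_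
  rw [levelTerm]
  split_ifs with hw
  · have h2 : specProj S c Y₀ *ᵥ b₀ = 0 := (specWeight_eq_zero_iff hY₀ hS hc b₀).1 hw
    rw [specProj_mulVec_self hS hc, Matrix.mulVec_add, h2, Matrix.mulVec_smul]
    simp
  · rw [specWeight_add_smul hY₀, add_sub_cancel_left, Matrix.mulVec_smul, smul_smul,
      dotProduct_smul, Complex.smul_re, smul_eq_mul]
    congr 2
    field_simp
    ring

end Level

/-! ### Smoothness of matrix-valued functions -/

section Smooth

variable {E : Type*} [NormedAddCommGroup E] [NormedSpace ℝ E] {ι : Type*} [Fintype ι]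

theorem contDiff_matrix_mul {A B : E → Matrix ι ι ℂ} (hA : ContDiff ℝ ∞ A) (hB : ContDiff ℝ ∞ B) :
    ContDiff ℝ ∞ fun y => A y * B y := by
  refine contDiff_pi.2 fun i => contDiff_pi.2 fun j => ?_
  simp only [Matrix.mul_apply]
  exact ContDiff.sum fun k _ => (contDiff_pi.1 (contDiff_pi.1 hA i) k).mul
    (contDiff_pi.1 (contDiff_pi.1 hB k) j)

theorem contDiff_matrix_mulVec {A : E → Matrix ι ι ℂ} {b : E → ι → ℂ} (hA : ContDiff ℝ ∞ A)
    (hb : ContDiff ℝ ∞ b) : ContDiff ℝ ∞ fun y => A y *ᵥ b y := by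
  refine contDiff_pi.2 fun i => ?_
  simp only [Matrix.mulVec, dotProduct]
  exact ContDiff.sum fun k _ => (contDiff_pi.1 (contDiff_pi.1 hA i) k).mul (contDiff_pi.1 hb k)

theorem contDiff_dotProduct {a b : E → ι → ℂ} (ha : ContDiff ℝ ∞ a) (hb : ContDiff ℝ ∞ b) :
    ContDiff ℝ ∞ fun y => a y ⬝ᵥ b y := by
  simp only [dotProduct]
  exact ContDiff.sum fun k _ => (contDiff_pi.1 ha k).mul (contDiff_pi.1 hb k)

theorem contDiff_star_pi {a : E → ι → ℂ} (ha : ContDiff ℝ ∞ a) :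
    ContDiff ℝ ∞ fun y => star (a y) :=
  contDiff_pi.2 fun k => (starL' ℝ : ℂ ≃L[ℝ] ℂ).contDiff.comp (contDiff_pi.1 ha k)

variable [DecidableEq ι]

theorem contDiff_aeval_matrix {A : E → Matrix ι ι ℂ} (hA : ContDiff ℝ ∞ A) (f : ℝ[X]) :
    ContDiff ℝ ∞ fun y => aeval (A y) f := by
  have hpow : ∀ k : ℕ, ContDiff ℝ ∞ fun y => A y ^ k := by
    intro k
    induction k with
    | zero => simp only [pow_zero]; exact contDiff_const
    | succ k ih => simp only [pow_succ]; exact contDiff_matrix_mul ih hA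
  simp only [aeval_eq_sum_range]
  exact ContDiff.sum fun k _ => (hpow k).const_smul _

theorem contDiff_specWeight {A : E → Matrix ι ι ℂ} {b : E → ι → ℂ} (hA : ContDiff ℝ ∞ A)
    (hb : ContDiff ℝ ∞ b) (S : Finset ℝ) (c : ℝ) :
    ContDiff ℝ ∞ fun y => specWeight S c (A y) (b y) :=
  Complex.reCLM.contDiff.comp (contDiff_dotProduct (contDiff_star_pi hb)
    (contDiff_matrix_mulVec (contDiff_aeval_matrix hA _) hb))

theorem contDiff_levelMap {m : ℕ} {A : E → Matrix (Fin m) (Fin m) ℂ} {b : E → Fin m → ℂ}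
    (hA : ContDiff ℝ ∞ A) (hb : ContDiff ℝ ∞ b) (S : Finset ℝ) (Y₀ : Matrix (Fin m) (Fin m) ℂ)
    (b₀ : Fin m → ℂ) : ContDiff ℝ ∞ fun y => levelMap S Y₀ b₀ (A y) (b y) := by
  unfold levelMap
  refine ContDiff.sum fun c _ => ?_
  unfold levelTerm
  split_ifs
  · exact contDiff_matrix_mulVec contDiff_const
      (contDiff_matrix_mulVec (contDiff_aeval_matrix hA _) hb)
  · refine ContDiff.add (contDiff_matrix_mulVec contDiff_const (hb.sub contDiff_const))
      (ContDiff.fun_smul ?_ contDiff_const)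
    refine ContDiff.div_const (ContDiff.sub (ContDiff.div_const
      ((contDiff_specWeight hA hb S c).sub contDiff_const) _) ?_) _
    exact Complex.reCLM.contDiff.comp (contDiff_dotProduct contDiff_const (hb.sub contDiff_const))

end Smooth
end GelfandCetlin
end

noncomputable section
namespace GelfandCetlin
open Polynomial

/-! ### Matrices with prescribed spectra of the leading submatrices -/

section IsoSpectral

variable {n : ℕ}

/-- The Hermitian matrices all of whose leading submatrices have the same characteristic polynomials
as those of `x`. -/
def isospectralSet (x : Matrix (Fin n) (Fin n) ℂ) : Set (Matrix (Fin n) (Fin n) ℂ) :=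
  {y | y.IsHermitian ∧ ∀ (m : ℕ) (hm : m ≤ n), (leading y m hm).charpoly = (leading x m hm).charpoly}

/-- The part of the `j`-th column above the diagonal. -/
def upperCol (y : Matrix (Fin n) (Fin n) ℂ) (j : Fin n) : Fin j → ℂ :=
  fun i => y (Fin.castLE j.2.le i) j

theorem corner_leading (y : Matrix (Fin n) (Fin n) ℂ) (j : Fin n) :
    corner (leading y (j + 1) j.2) = leading y j j.2.le := rfl

theorem lastCol_leading (y : Matrix (Fin n) (Fin n) ℂ) (j : Fin n) :
    lastCol (leading y (j + 1) j.2) = upperCol y j := rfl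

theorem leading_last_last (y : Matrix (Fin n) (Fin n) ℂ) (j : Fin n) :
    leading y (j + 1) j.2 (Fin.last j) (Fin.last j) = y j j := rfl

theorem leading_add (x y : Matrix (Fin n) (Fin n) ℂ) (m : ℕ) (hm : m ≤ n) :
    leading (x + y) m hm = leading x m hm + leading y m hm := rfl

theorem leading_smul (t : ℝ) (y : Matrix (Fin n) (Fin n) ℂ) (m : ℕ) (hm : m ≤ n) :
    leading (t • y) m hm = t • leading y m hm := rfl

variable {x : Matrix (Fin n) (Fin n) ℂ} (hx : x.IsHermitian)

/-- The eigenvalues of the `j × j` leading submatrix of `x`. -/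
abbrev levelSpec (j : Fin n) : Finset ℝ := specSet (isHermitian_leading hx j j.2.le)

theorem aeval_nodal_levelSpec (j : Fin n) :
    aeval (leading x j j.2.le) (Lagrange.nodal (levelSpec hx j) (id : ℝ → ℝ)) = 0 :=
  aeval_nodal_specSet _ (isHermitian_leading hx _ _) rfl

/-- The local equations of `isospectralSet x` near `x`. -/
def chartMap (y : Matrix (Fin n) (Fin n) ℂ) : Matrix (Fin n) (Fin n) ℂ :=
  Matrix.of fun i j => if h : i < j then
    levelMap (levelSpec hx j) (leading x j j.2.le) (upperCol x j) (leading y j j.2.le)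
      (upperCol y j) ⟨i, h⟩
    else if i = j then y i i - x i i else y i j - star (y j i)

/-- The linear subspace onto which `chartMap` maps `isospectralSet x` near `x`. -/
def chartSpace : Submodule ℝ (Matrix (Fin n) (Fin n) ℂ) where
  carrier := {v | (∀ i j, j ≤ i → v i j = 0) ∧
    ∀ j, upperCol v j ∈ levelSpace (levelSpec hx j) (leading x j j.2.le) (upperCol x j)}
  add_mem' {v w} hv hw :=
    ⟨fun i j h => by rw [Matrix.add_apply, hv.1 i j h, hw.1 i j h, add_zero],
      fun j => Submodule.add_mem _ (hv.2 j) (hw.2 j)⟩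
  zero_mem' := ⟨fun _ _ _ => rfl, fun j => Submodule.zero_mem _⟩
  smul_mem' a v hv :=
    ⟨fun i j h => by rw [Matrix.smul_apply, hv.1 i j h, smul_zero],
      fun j => Submodule.smul_mem _ a (hv.2 j)⟩

theorem mem_chartSpace {v : Matrix (Fin n) (Fin n) ℂ} : v ∈ chartSpace hx ↔
    (∀ i j, j ≤ i → v i j = 0) ∧
    ∀ j, upperCol v j ∈ levelSpace (levelSpec hx j) (leading x j j.2.le) (upperCol x j) := Iff.rfl

theorem upperCol_chartMap (y : Matrix (Fin n) (Fin n) ℂ) (j : Fin n) :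
    upperCol (chartMap hx y) j = levelMap (levelSpec hx j) (leading x j j.2.le) (upperCol x j)
      (leading y j j.2.le) (upperCol y j) := by
  ext i
  have h : Fin.castLE j.2.le i < j := i.2
  rw [upperCol, chartMap, Matrix.of_apply, dif_pos h]
  rfl

theorem chartMap_self (y : Matrix (Fin n) (Fin n) ℂ) (i : Fin n) :
    chartMap hx y i i = y i i - x i i := by
  simp [chartMap]

theorem chartMap_of_lt (y : Matrix (Fin n) (Fin n) ℂ) {i j : Fin n} (h : j < i) :
    chartMap hx y i j = y i j - star (y j i) := by
  rw [chartMap, Matrix.of_apply, dif_neg h.not_gt, if_neg h.ne']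

theorem contDiff_apply_apply (i j : Fin n) :
    ContDiff ℝ ∞ fun y : Matrix (Fin n) (Fin n) ℂ => y i j :=
  contDiff_pi.1 (contDiff_pi.1 (contDiff_id (E := Matrix (Fin n) (Fin n) ℂ)) i) j

theorem contDiff_leading (m : ℕ) (hm : m ≤ n) :
    ContDiff ℝ ∞ fun y : Matrix (Fin n) (Fin n) ℂ => leading y m hm :=
  contDiff_pi.2 fun _ => contDiff_pi.2 fun _ => contDiff_apply_apply _ _

theorem contDiff_upperCol (j : Fin n) :
    ContDiff ℝ ∞ fun y : Matrix (Fin n) (Fin n) ℂ => upperCol y j :=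
  contDiff_pi.2 fun _ => contDiff_apply_apply _ _

theorem contDiff_chartMap : ContDiff ℝ ∞ (chartMap hx) := by
  refine contDiff_pi.2 fun i => contDiff_pi.2 fun j => ?_
  rcases lt_trichotomy i j with h | rfl | h
  · have h1 := contDiff_pi.1 (contDiff_levelMap (contDiff_leading (j : ℕ) j.2.le)
      (contDiff_upperCol j) (levelSpec hx j) (leading x j j.2.le) (upperCol x j)) ⟨i, h⟩
    convert h1 using 2 with y
    rw [chartMap, Matrix.of_apply, dif_pos h]
  · simp only [chartMap_self]
    exact (contDiff_apply_apply _ _).sub contDiff_const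
  · simp only [chartMap_of_lt hx _ h]
    exact (contDiff_apply_apply _ _).sub
      ((starL' ℝ : ℂ ≃L[ℝ] ℂ).contDiff.comp (contDiff_apply_apply _ _))

/-- Reads off an entry of the derivative from the restriction to a line; the quadratic term does not
contribute at `t = 0`. -/
theorem fderiv_chartMap_apply {v : Matrix (Fin n) (Fin n) ℂ} {i j : Fin n} {a q : ℂ}
    (h : ∀ t : ℝ, chartMap hx (x + t • v) i j = t • a + t ^ 2 • q) :
    fderiv ℝ (chartMap hx) x v i j = a := by
  have h1 : HasDerivAt (fun t : ℝ => x + t • v) v 0 := by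
    have := ((hasDerivAt_id (0 : ℝ)).smul_const v).const_add x
    rwa [one_smul] at this
  have h2 : HasFDerivAt (chartMap hx) (fderiv ℝ (chartMap hx) x) (x + (0 : ℝ) • v) := by
    rw [zero_smul, add_zero]
    exact ((contDiff_chartMap hx).differentiable (by simp) x).hasFDerivAt
  have h3 := hasDerivAt_pi.1 (hasDerivAt_pi.1 (h2.comp_hasDerivAt (0 : ℝ) h1) i) j
  have h4 : HasDerivAt (fun t : ℝ => t • a + t ^ 2 • q) a 0 := by
    have := ((hasDerivAt_id (0 : ℝ)).smul_const a).fun_add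
      ((hasDerivAt_pow 2 (0 : ℝ)).smul_const q)
    simpa using this
  refine h3.unique (h4.congr_of_eventuallyEq (Filter.Eventually.of_forall fun t => h t))

theorem fderiv_chartMap_self (v : Matrix (Fin n) (Fin n) ℂ) (i : Fin n) :
    fderiv ℝ (chartMap hx) x v i i = v i i :=
  fderiv_chartMap_apply hx (q := 0) fun t => by
    rw [chartMap_self, Matrix.add_apply, Matrix.smul_apply]; simp

theorem fderiv_chartMap_of_lt (v : Matrix (Fin n) (Fin n) ℂ) {i j : Fin n} (h : j < i) :
    fderiv ℝ (chartMap hx) x v i j = v i j - star (v j i) :=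
  fderiv_chartMap_apply hx (q := 0) fun t => by
    rw [chartMap_of_lt hx _ h, Matrix.add_apply, Matrix.smul_apply, Matrix.add_apply,
      Matrix.smul_apply, star_add, hx.apply, star_smul]
    simp only [star_trivial, smul_zero, add_zero, smul_sub]
    ring

/-- Along `v` the preceding leading block stays fixed, so only the dependence of `levelMap` on the
column matters, and there the derivative is the identity. The derivative of `chartMap` is thus
unitriangular with respect to the columns. -/
theorem upperCol_fderiv_chartMap {v : Matrix (Fin n) (Fin n) ℂ} {j : Fin n}
    (hv : leading v j j.2.le = 0) : upperCol (fderiv ℝ (chartMap hx) x v) j = upperCol v j := by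
  obtain ⟨q, hq⟩ := exists_levelMap_line (b₀ := upperCol x j) (isHermitian_leading hx j j.2.le)
    (aeval_nodal_levelSpec hx j) (upperCol v j)
  ext i
  refine fderiv_chartMap_apply hx (q := q i) fun t => ?_
  have h1 := congrFun (upperCol_chartMap hx (x + t • v) j) i
  rw [leading_add, leading_smul, hv, smul_zero, add_zero] at h1
  exact h1.trans (congrFun (hq t) i)

/-- Triangularity is exploited by induction on the leading blocks of `v`: once a block vanishes, the
derivative returns the next column itself. The entries below the diagonal follow from those above
it. -/
theorem eq_zero_of_fderiv_chartMap_eq_zero {v : Matrix (Fin n) (Fin n) ℂ}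
    (h : fderiv ℝ (chartMap hx) x v = 0) : v = 0 := by
  have hdiag : ∀ i, v i i = 0 := fun i => by rw [← fderiv_chartMap_self hx v i, h]; rfl
  have hlow : ∀ i j, j < i → v i j = star (v j i) := fun i j hij =>
    sub_eq_zero.1 (by
    rw [← fderiv_chartMap_of_lt hx v hij, h]; rfl)
  have key : ∀ m (hm : m ≤ n), leading v m hm = 0 := by
    intro m
    induction m with
    | zero => intro hm; ext i; exact i.elim0
    | succ m ih =>
      intro hm
      have h1 : upperCol v ⟨m, hm⟩ = 0 := by
        rw [← upperCol_fderiv_chartMap hx (j := ⟨m, hm⟩) (ih (Nat.le_of_succ_le hm)), h]; rfl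
      have h2 : ∀ i : Fin m, v (Fin.castLE (Nat.le_of_succ_le hm) i) ⟨m, hm⟩ = 0 := fun i =>
        congrFun h1 i
      ext i j
      refine Fin.lastCases ?_ (fun i => ?_) i <;> refine Fin.lastCases ?_ (fun j => ?_) j
      · exact hdiag _
      · refine (hlow _ _ j.2).trans ?_
        exact (congrArg star (h2 j)).trans (star_zero _)
      · exact h2 i
      · exact congrFun (congrFun (ih (Nat.le_of_succ_le hm)) i) j
  exact key n le_rfl

/-- The determinant is continuous in `y` and equals `1` at `y = x`. This supplies the hypothesis of
`specProj_mulVec_eq_zero_of_compression` near `x`. -/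
theorem eventually_det_specProj_ne_zero : ∀ᶠ y in 𝓝 x, ∀ j : Fin n, ∀ c ∈ levelSpec hx j,
    (1 - (specProj (levelSpec hx j) c (leading y j j.2.le) -
      specProj (levelSpec hx j) c (leading x j j.2.le))).det ≠ 0 := by
  refine Filter.eventually_all.2 fun j => (Filter.eventually_all_finset _).2 fun c _ => ?_
  have hcont : Continuous fun y : Matrix (Fin n) (Fin n) ℂ =>
      (1 - (specProj (levelSpec hx j) c (leading y j j.2.le) -
        specProj (levelSpec hx j) c (leading x j j.2.le))).det := by
    refine Continuous.matrix_det (continuous_const.sub (Continuous.sub ?_ continuous_const))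
    exact (contDiff_aeval_matrix (contDiff_leading _ _) _).continuous
  refine hcont.continuousAt.eventually_ne ?_
  simp

/-- Near `x`, the set `isospectralSet x` is the preimage of a linear subspace under `chartMap`. -/
theorem eventually_mem_isospectralSet_iff :
    ∀ᶠ y in 𝓝 x, y ∈ isospectralSet x ↔ chartMap hx y ∈ chartSpace hx := by
  filter_upwards [eventually_det_specProj_ne_zero hx] with y hdet
  have step : ∀ (hy : y.IsHermitian) (j : Fin n),
      (leading y j j.2.le).charpoly = (leading x j j.2.le).charpoly →
      ((leading y (j + 1) j.2).charpoly = (leading x (j + 1) j.2).charpoly ↔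
        y j j = x j j ∧ upperCol (chartMap hx y) j ∈
          levelSpace (levelSpec hx j) (leading x j j.2.le) (upperCol x j)) := by
    intro hy j hj
    have hSy : aeval (leading y j j.2.le) (Lagrange.nodal (levelSpec hx j) (id : ℝ → ℝ)) = 0 :=
      aeval_nodal_specSet _ (isHermitian_leading hy _ _) hj
    rw [charpoly_border_eq_iff (isHermitian_leading hy _ _) (isHermitian_leading hx _ _) hSy
      (aeval_nodal_levelSpec hx j) hj, corner_leading, lastCol_leading, corner_leading,
      lastCol_leading, leading_last_last, leading_last_last, upperCol_chartMap,
      levelMap_mem_levelSpace_iff (isHermitian_leading hx _ _) (aeval_nodal_levelSpec hx j)]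
    refine and_congr_right fun _ => forall₂_congr fun c hc => ?_
    have h1 := specWeight_eq_zero_iff (isHermitian_leading hy _ _) hSy hc (upperCol y j)
    constructor
    · intro h
      refine ⟨fun h0 => ?_, fun _ => h⟩
      rw [h1.1 (h.trans h0), Matrix.mulVec_zero]
    · rintro ⟨h2, h3⟩
      -- At weight zero the chart only controls the compressed component; for `y` near `x` its
      -- vanishing forces the component of the column of `y` to vanish.
      by_cases h0 : specWeight (levelSpec hx j) c (leading x j j.2.le) (upperCol x j) = 0
      · rw [h0, h1]
        exact specProj_mulVec_eq_zero_of_compression hc hSy (hdet j c hc) (h2 h0)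
      · exact h3 h0
  rw [mem_chartSpace]
  constructor
  · rintro ⟨hy, hch⟩
    have h1 := fun j : Fin n => (step hy j (hch j j.2.le)).1 (hch (j + 1) j.2)
    refine ⟨fun i j hij => ?_, fun j => (h1 j).2⟩
    rcases hij.eq_or_lt with rfl | hlt
    · rw [chartMap_self, (h1 j).1, sub_self]
    · rw [chartMap_of_lt hx _ hlt, hy.apply, sub_self]
  · rintro ⟨h1, h2⟩
    have hd : ∀ i, y i i = x i i := fun i => by
      have := h1 i i le_rfl
      rwa [chartMap_self, sub_eq_zero] at this
    have hl : ∀ i j, j < i → y i j = star (y j i) := fun i j hij => by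
      have := h1 i j hij.le
      rwa [chartMap_of_lt hx _ hij, sub_eq_zero] at this
    have hy : y.IsHermitian := by
      ext i j
      rw [Matrix.conjTranspose_apply]
      rcases lt_trichotomy i j with h | rfl | h
      · rw [hl j i h, star_star]
      · rw [hd, hx.apply]
      · rw [hl i j h]
    refine ⟨hy, fun m => ?_⟩
    induction m with
    | zero => intro hm; rw [Subsingleton.elim (leading y 0 hm) (leading x 0 hm)]
    | succ m ih =>
      intro hm
      exact (step hy ⟨m, hm⟩ (ih (Nat.le_of_succ_le hm))).2 ⟨hd _, h2 _⟩

theorem tangentVectors_isospectralSet :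
    tangentVectors (isospectralSet x) x = {v | fderiv ℝ (chartMap hx) x v ∈ chartSpace hx} :=
  tangentVectors_eq_of_chart (contDiff_chartMap hx)
    (fun _ => eq_zero_of_fderiv_chartMap_eq_zero hx) (eventually_mem_isospectralSet_iff hx)
    ⟨hx, fun _ _ => rfl⟩

theorem isSmoothSubmanifold_isospectralSet (z : Matrix (Fin n) (Fin n) ℂ) :
    IsSmoothSubmanifold (isospectralSet z) := by
  intro x hx
  have h : isospectralSet z = isospectralSet x := by
    ext y
    exact and_congr_right fun _ => forall₂_congr fun m hm => by rw [hx.2 m hm]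
  rw [h]
  exact exists_submanifold_chart (contDiff_chartMap hx.1)
    (fun _ => eq_zero_of_fderiv_chartMap_eq_zero hx.1) (eventually_mem_isospectralSet_iff hx.1)

end IsoSpectral
end GelfandCetlin
end

noncomputable section
namespace GelfandCetlin
open Polynomial

/-! ### Exponential curves of matrices -/

section Exp

/-- The calculus of the exponential requires a submultiplicative norm, which the entrywise sup norm
is not in general. Passing to continuous functionals, namely the matrix entries, transfers the
result from the operator norm to the sup norm. -/
theorem contDiff_clm_exp_smul {𝔸 : Type*} [NormedRing 𝔸] [NormedAlgebra ℝ 𝔸] [CompleteSpace 𝔸]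
    (φ : 𝔸 →L[ℝ] ℂ) (a : 𝔸) : ContDiff ℝ ∞ fun t : ℝ => φ (NormedSpace.exp (t • a)) := by
  have h1 : ContDiff ℝ ∞ (NormedSpace.exp : 𝔸 → 𝔸) :=
    contDiff_iff_contDiffAt.2 fun y => (NormedSpace.exp_analytic (𝕂 := ℝ) y).contDiffAt
  exact φ.contDiff.comp (h1.comp (contDiff_id.smul contDiff_const))

theorem hasDerivAt_clm_exp_smul {𝔸 : Type*} [NormedRing 𝔸] [NormedAlgebra ℝ 𝔸] [CompleteSpace 𝔸]
    (φ : 𝔸 →L[ℝ] ℂ) (a : 𝔸) : HasDerivAt (fun t : ℝ => φ (NormedSpace.exp (t • a))) (φ a) 0 := by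
  have h1 := hasDerivAt_exp_smul_const (𝕂 := ℝ) a (0 : ℝ)
  rw [zero_smul, NormedSpace.exp_zero, one_mul] at h1
  exact φ.hasFDerivAt.comp_hasDerivAt (0 : ℝ) h1

variable {n : ℕ}

theorem contDiff_exp_smul_matrix (Z : Matrix (Fin n) (Fin n) ℂ) :
    ContDiff ℝ ∞ fun t : ℝ => NormedSpace.exp (t • Z) :=
  contDiff_pi.2 fun i => contDiff_pi.2 fun j =>
    @contDiff_clm_exp_smul (Matrix (Fin n) (Fin n) ℂ) Matrix.linftyOpNormedRing
      Matrix.linftyOpNormedAlgebra (inferInstanceAs (CompleteSpace (Fin n → Fin n → ℂ)))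
      ((ContinuousLinearMap.proj (R := ℝ) (φ := fun _ : Fin n => ℂ) j).comp
        (ContinuousLinearMap.proj (R := ℝ) (φ := fun _ : Fin n => Fin n → ℂ) i)) Z

theorem hasDerivAt_exp_smul_matrix (Z : Matrix (Fin n) (Fin n) ℂ) :
    HasDerivAt (fun t : ℝ => NormedSpace.exp (t • Z)) Z 0 :=
  hasDerivAt_pi.2 fun i => hasDerivAt_pi.2 fun j =>
    @hasDerivAt_clm_exp_smul (Matrix (Fin n) (Fin n) ℂ) Matrix.linftyOpNormedRing
      Matrix.linftyOpNormedAlgebra (inferInstanceAs (CompleteSpace (Fin n → Fin n → ℂ)))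
      ((ContinuousLinearMap.proj (R := ℝ) (φ := fun _ : Fin n => ℂ) j).comp
        (ContinuousLinearMap.proj (R := ℝ) (φ := fun _ : Fin n => Fin n → ℂ) i)) Z

theorem hasDerivAt_matrix_mul {A B : ℝ → Matrix (Fin n) (Fin n) ℂ}
    {A' B' : Matrix (Fin n) (Fin n) ℂ} {t : ℝ} (hA : HasDerivAt A A' t) (hB : HasDerivAt B B' t) :
    HasDerivAt (fun s => A s * B s) (A' * B t + A t * B') t := by
  refine hasDerivAt_pi.2 fun i => hasDerivAt_pi.2 fun j => ?_
  simp only [Matrix.mul_apply, Matrix.add_apply, ← Finset.sum_add_distrib]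
  exact HasDerivAt.fun_sum fun k _ => HasDerivAt.fun_mul (hasDerivAt_pi.1 (hasDerivAt_pi.1 hA i) k)
    (hasDerivAt_pi.1 (hasDerivAt_pi.1 hB k) j)

end Exp

/-! ### Matrices supported on a leading block -/

section Pad

variable {n : ℕ}

/-- The inclusion of the first `m` coordinates. -/
def incl (m : ℕ) (hm : m ≤ n) : Matrix (Fin n) (Fin m) ℂ :=
  (1 : Matrix (Fin n) (Fin n) ℂ).submatrix id (Fin.castLE hm)

/-- Extension by zero of a leading block. -/
def pad (m : ℕ) (hm : m ≤ n) (Z : Matrix (Fin m) (Fin m) ℂ) : Matrix (Fin n) (Fin n) ℂ :=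
  incl m hm * Z * (incl m hm)ᴴ

theorem incl_conjTranspose_mul (m : ℕ) (hm : m ≤ n) : (incl m hm)ᴴ * incl m hm = 1 := by
  ext i j
  simp [incl, Matrix.mul_apply, Matrix.one_apply, Fin.castLE_inj, eq_comm]

theorem leading_eq (x : Matrix (Fin n) (Fin n) ℂ) (m : ℕ) (hm : m ≤ n) :
    leading x m hm = (incl m hm)ᴴ * x * incl m hm := by
  ext i j
  simp [incl, leading, Matrix.mul_apply, Matrix.one_apply]

theorem incl_mul_incl {m l : ℕ} (hl : l ≤ m) (hm : m ≤ n) :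
    incl m hm * incl l hl = incl l (hl.trans hm) := by
  ext i j
  simp [incl, Matrix.mul_apply, Matrix.one_apply]

theorem leading_leading (x : Matrix (Fin n) (Fin n) ℂ) {m l : ℕ} (hl : l ≤ m) (hm : m ≤ n) :
    leading (leading x m hm) l hl = leading x l (hl.trans hm) := rfl

theorem pad_pad {m l : ℕ} (hl : l ≤ m) (hm : m ≤ n) (Z : Matrix (Fin l) (Fin l) ℂ) :
    pad m hm (pad l hl Z) = pad l (hl.trans hm) Z := by
  rw [pad, pad, pad, ← incl_mul_incl hl hm, Matrix.conjTranspose_mul]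
  simp only [Matrix.mul_assoc]

theorem leading_lie_pad (m : ℕ) (hm : m ≤ n) (Z : Matrix (Fin m) (Fin m) ℂ)
    (x : Matrix (Fin n) (Fin n) ℂ) :
    leading ⁅pad m hm Z, x⁆ m hm = ⁅Z, leading x m hm⁆ := by
  have h := incl_conjTranspose_mul m hm
  rw [leading_eq, leading_eq, Ring.lie_def, Ring.lie_def, pad, Matrix.mul_sub, Matrix.sub_mul]
  congr 1
  · calc _ = ((incl m hm)ᴴ * incl m hm) * Z * ((incl m hm)ᴴ * x * incl m hm) := by
          simp only [Matrix.mul_assoc]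
      _ = _ := by rw [h, Matrix.one_mul]
  · calc _ = ((incl m hm)ᴴ * x * incl m hm) * Z * ((incl m hm)ᴴ * incl m hm) := by
          simp only [Matrix.mul_assoc]
      _ = _ := by rw [h, Matrix.mul_one]

theorem trace_pad_mul (m : ℕ) (hm : m ≤ n) (Z : Matrix (Fin m) (Fin m) ℂ)
    (v : Matrix (Fin n) (Fin n) ℂ) :
    (pad m hm Z * v).trace = (Z * leading v m hm).trace := by
  rw [pad, leading_eq, Matrix.mul_assoc, Matrix.mul_assoc, Matrix.trace_mul_comm]
  simp only [Matrix.mul_assoc]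

theorem conjTranspose_pad (m : ℕ) (hm : m ≤ n) (Z : Matrix (Fin m) (Fin m) ℂ) :
    (pad m hm Z)ᴴ = pad m hm Zᴴ := by
  simp [pad, Matrix.mul_assoc]

theorem pad_neg (m : ℕ) (hm : m ≤ n) (Z : Matrix (Fin m) (Fin m) ℂ) :
    pad m hm (-Z) = -pad m hm Z := by
  simp [pad]

theorem pad_mul (m : ℕ) (hm : m ≤ n) (Z Z' : Matrix (Fin m) (Fin m) ℂ) :
    pad m hm Z * pad m hm Z' = pad m hm (Z * Z') := by
  rw [pad, pad, pad]
  calc _ = incl m hm * Z * ((incl m hm)ᴴ * incl m hm) * Z' * (incl m hm)ᴴ := by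
        simp only [Matrix.mul_assoc]
    _ = _ := by rw [incl_conjTranspose_mul, Matrix.mul_one, Matrix.mul_assoc (incl m hm)]

/-- The leading blocks of a commutator with a matrix supported on a leading block. -/
theorem leading_lie_pad_of_le {m l : ℕ} (hml : m ≤ l) (hl : l ≤ n) (Z : Matrix (Fin m) (Fin m) ℂ)
    (x : Matrix (Fin n) (Fin n) ℂ) :
    leading ⁅pad m (hml.trans hl) Z, x⁆ l hl = ⁅pad m hml Z, leading x l hl⁆ := by
  rw [← pad_pad hml hl, leading_lie_pad]

theorem leading_lie_pad_of_ge {m l : ℕ} (hl : l ≤ m) (hm : m ≤ n) (Z : Matrix (Fin m) (Fin m) ℂ)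
    (x : Matrix (Fin n) (Fin n) ℂ) (h : Commute Z (leading x m hm)) :
    leading ⁅pad m hm Z, x⁆ l (hl.trans hm) = 0 := by
  rw [← leading_leading _ hl hm, leading_lie_pad, Ring.lie_def, h.eq, sub_self]
  rfl

theorem trace_mul_lie_of_commute {m : ℕ} {Z Y : Matrix (Fin m) (Fin m) ℂ} (h : Commute Z Y)
    (W : Matrix (Fin m) (Fin m) ℂ) : (Z * ⁅W, Y⁆).trace = 0 := by
  rw [Ring.lie_def, mul_sub, Matrix.trace_sub, ← mul_assoc, ← mul_assoc, Matrix.trace_mul_comm,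
    ← mul_assoc, h.eq, sub_self]

/-- The span of the infinitesimal actions at `x` of the centralisers of its leading submatrices. -/
def centralTangent (x : Matrix (Fin n) (Fin n) ℂ) : Submodule ℝ (Matrix (Fin n) (Fin n) ℂ) :=
  Submodule.span ℝ {v | ∃ (m : ℕ) (hm : m ≤ n) (Z : Matrix (Fin m) (Fin m) ℂ), Zᴴ = -Z ∧
    Commute Z (leading x m hm) ∧ v = ⁅pad m hm Z, x⁆}

/-- This is the isotropy of the span. A generator from level `m ≤ l` has as its `l`-block a
commutator with the `l`-block of `x`, hence is trace-orthogonal to whatever commutes with that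
block. A generator from level `m ≥ l` has vanishing `l`-block. -/
theorem trace_mul_leading_of_mem_centralTangent {x v : Matrix (Fin n) (Fin n) ℂ}
    (hv : v ∈ centralTangent x) (l : ℕ) (hl : l ≤ n) (Z' : Matrix (Fin l) (Fin l) ℂ)
    (hZ' : Commute Z' (leading x l hl)) : (Z' * leading v l hl).trace = 0 := by
  induction hv using Submodule.span_induction with
  | mem v hv =>
    obtain ⟨m, hm, Z, -, hc, rfl⟩ := hv
    rcases le_total m l with h | h
    · rw [leading_lie_pad_of_le h hl, trace_mul_lie_of_commute hZ']
    · rw [leading_lie_pad_of_ge h hm Z x hc]; simp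
  | zero => 
    have : leading (0 : Matrix (Fin n) (Fin n) ℂ) l hl = 0 := rfl
    rw [this]; simp
  | add v w _ _ hv hw => rw [leading_add, mul_add, Matrix.trace_add, hv, hw, add_zero]
  | smul a v _ hv => rw [leading_smul, mul_smul_comm, Matrix.trace_smul, hv, smul_zero]

theorem commute_inverse {U V Q : Matrix (Fin n) (Fin n) ℂ} (hUV : U * V = 1) (hVU : V * U = 1)
    (hQ : Commute Q U) : Q * V = V * Q := by
  calc Q * V = V * U * Q * V := by rw [hVU, one_mul]
    _ = V * (Q * U) * V := by rw [hQ.eq]; simp only [mul_assoc]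
    _ = V * Q * (U * V) := by simp only [mul_assoc]
    _ = V * Q := by rw [hUV, mul_one]

/-- Since `U` commutes with the projection onto the first `l` coordinates, it is block diagonal, and
conjugation by it restricts to a conjugation of the `l`-block. -/
theorem charpoly_leading_conj {U V : Matrix (Fin n) (Fin n) ℂ} (hUV : U * V = 1) (hVU : V * U = 1)
    (x : Matrix (Fin n) (Fin n) ℂ) (l : ℕ) (hl : l ≤ n)
    (hQ : Commute (incl l hl * (incl l hl)ᴴ) U) :
    (leading (U * x * V) l hl).charpoly = (leading x l hl).charpoly := by
  have hJJ := incl_conjTranspose_mul l hl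
  have hQV := commute_inverse hUV hVU hQ
  rw [leading_eq, leading_eq]
  generalize incl l hl = J at *
  have e2 : Jᴴ * U = Jᴴ * U * J * Jᴴ := by
    calc _ = (Jᴴ * J) * Jᴴ * U := by rw [hJJ, Matrix.one_mul]
      _ = Jᴴ * (J * Jᴴ * U) := by simp only [Matrix.mul_assoc]
      _ = _ := by rw [hQ.eq]; simp only [Matrix.mul_assoc]
  have e3 : V * J = J * (Jᴴ * V * J) := by
    calc _ = V * (J * Jᴴ) * J := by rw [Matrix.mul_assoc, Matrix.mul_assoc, hJJ, Matrix.mul_one]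
      _ = _ := by rw [← hQV]; simp only [Matrix.mul_assoc]
  have e4 : Jᴴ * (U * x * V) * J = (Jᴴ * U * J) * ((Jᴴ * x * J) * (Jᴴ * V * J)) := by
    calc _ = (Jᴴ * U) * x * (V * J) := by simp only [Matrix.mul_assoc]
      _ = Jᴴ * U * J * Jᴴ * x * (J * (Jᴴ * V * J)) := by rw [← e2, ← e3]
      _ = _ := by simp only [Matrix.mul_assoc]
  have e5 : (Jᴴ * V * J) * (Jᴴ * U * J) = 1 := by
    calc _ = Jᴴ * V * (J * Jᴴ * U) * J := by simp only [Matrix.mul_assoc]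
      _ = Jᴴ * (V * U) * (J * Jᴴ) * J := by rw [hQ.eq]; simp only [Matrix.mul_assoc]
      _ = (Jᴴ * J) * (Jᴴ * J) := by rw [hVU]; simp only [Matrix.mul_assoc, Matrix.one_mul]
      _ = 1 := by rw [hJJ, Matrix.one_mul]
  rw [e4, Matrix.charpoly_mul_comm, Matrix.mul_assoc, e5, Matrix.mul_one]

theorem leading_conj_eq {U V : Matrix (Fin n) (Fin n) ℂ} (hUV : U * V = 1) (hVU : V * U = 1)
    (x : Matrix (Fin n) (Fin n) ℂ) (m : ℕ) (hm : m ≤ n)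
    (hQ : Commute (incl m hm * (incl m hm)ᴴ) U) (hB : Commute (pad m hm (leading x m hm)) U) :
    leading (U * x * V) m hm = leading x m hm := by
  have hJJ := incl_conjTranspose_mul m hm
  have hQV := commute_inverse hUV hVU hQ
  rw [pad, leading_eq] at hB
  rw [leading_eq, leading_eq]
  generalize incl m hm = J at *
  have e1 : J * (Jᴴ * x * J) * Jᴴ = (J * Jᴴ) * x * (J * Jᴴ) := by simp only [Matrix.mul_assoc]
  have e6 : ∀ B : Matrix (Fin n) (Fin n) ℂ, Jᴴ * B * J = Jᴴ * ((J * Jᴴ) * B * (J * Jᴴ)) * J := by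
    intro B
    calc _ = (Jᴴ * J) * (Jᴴ * B * J) * (Jᴴ * J) := by rw [hJJ, Matrix.one_mul, Matrix.mul_one]
      _ = _ := by simp only [Matrix.mul_assoc]
  rw [e6, e6 x]
  congr 2
  calc _ = (J * Jᴴ * U) * x * (V * (J * Jᴴ)) := by simp only [Matrix.mul_assoc]
    _ = U * (J * Jᴴ * x * (J * Jᴴ)) * V := by rw [hQ.eq, ← hQV]; simp only [Matrix.mul_assoc]
    _ = _ := by rw [← e1, ← hB.eq, Matrix.mul_assoc, hUV, Matrix.mul_one]

/-- The curve is the conjugation of `x` by `exp (t P)`, where `P` is the padding of `Z`. Blocks of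
size at least `m` are conjugated; the `m`-block, and with it every smaller one, is fixed because `Z`
commutes with it. -/
theorem lie_pad_mem_tangentVectors {x : Matrix (Fin n) (Fin n) ℂ} (hx : x.IsHermitian) {m : ℕ}
    (hm : m ≤ n) {Z : Matrix (Fin m) (Fin m) ℂ} (hZ : Zᴴ = -Z) (hc : Commute Z (leading x m hm)) :
    ⁅pad m hm Z, x⁆ ∈ tangentVectors (isospectralSet x) x := by
  set P := pad m hm Z with hP
  have hPs : Pᴴ = -P := by rw [hP, conjTranspose_pad, hZ, pad_neg]
  obtain ⟨U, V, hUV, h1, h2, hU0, hV0, hcomm, hUd, hVd, hU', hV'⟩ :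
      ∃ U V : ℝ → Matrix (Fin n) (Fin n) ℂ, (∀ t, (U t)ᴴ = V t) ∧ (∀ t, U t * V t = 1) ∧
        (∀ t, V t * U t = 1) ∧ U 0 = 1 ∧ V 0 = 1 ∧
        (∀ (t : ℝ) (B : Matrix (Fin n) (Fin n) ℂ), Commute B P → Commute B (U t)) ∧
        ContDiff ℝ ∞ U ∧ ContDiff ℝ ∞ V ∧ HasDerivAt U P 0 ∧ HasDerivAt V (-P) 0 := by
    have h1 : ∀ t : ℝ, NormedSpace.exp (t • P) * NormedSpace.exp (t • -P) = 1 := fun t => by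
      rw [← Matrix.exp_add_of_commute _ _ (by
        rw [smul_neg]; exact (Commute.refl _).neg_right), smul_neg, add_neg_cancel,
        NormedSpace.exp_zero]
    refine ⟨fun t => NormedSpace.exp (t • P), fun t => NormedSpace.exp (t • -P), fun t => ?_, h1,
      fun t => mul_eq_one_comm.1 (h1 t), by simp [NormedSpace.exp_zero],
      by simp [NormedSpace.exp_zero], fun t B hB => (hB.smul_right t).exp_right,
      contDiff_exp_smul_matrix P, contDiff_exp_smul_matrix (-P), hasDerivAt_exp_smul_matrix P,
      hasDerivAt_exp_smul_matrix (-P)⟩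
    rw [← Matrix.exp_conjTranspose, Matrix.conjTranspose_smul, hPs, star_trivial]
  refine ⟨fun t => U t * x * V t, ?_, by simp [hU0, hV0], Filter.Eventually.of_forall
    fun t => ⟨?_, fun l hl => ?_⟩, ?_⟩
  · exact (contDiff_matrix_mul (contDiff_matrix_mul hUd contDiff_const) hVd).contDiffAt
  · beta_reduce
    rw [← hUV]
    exact Matrix.isHermitian_mul_mul_conjTranspose _ hx
  · rcases le_total m l with h | h
    · refine charpoly_leading_conj (h1 t) (h2 t) x l hl (hcomm t _ ?_)
      have e0 : incl l hl * (incl l hl)ᴴ = pad l hl 1 := by rw [pad, Matrix.mul_one]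
      rw [e0, hP, ← pad_pad h hl, Commute, SemiconjBy, pad_mul, pad_mul, one_mul, mul_one]
    · have e0 : incl m hm * (incl m hm)ᴴ = pad m hm 1 := by rw [pad, Matrix.mul_one]
      have e1 := leading_conj_eq (h1 t) (h2 t) x m hm
        (hcomm t _ (by rw [e0, hP, Commute, SemiconjBy, pad_mul, pad_mul, one_mul, mul_one]))
        (hcomm t _ (by rw [hP, Commute, SemiconjBy, pad_mul, pad_mul, hc.eq]))
      rw [← leading_leading _ h hm, e1, leading_leading]
  · have h3 := hasDerivAt_matrix_mul (hasDerivAt_matrix_mul hU' (hasDerivAt_const (0 : ℝ) x)) hV'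
    rw [hU0, hV0] at h3
    have h4 : (P * x + 1 * 0) * 1 + 1 * x * -P = ⁅P, x⁆ := by
      rw [Ring.lie_def]; noncomm_ring
    rwa [h4] at h3

theorem centralTangent_subset_tangentVectors {x : Matrix (Fin n) (Fin n) ℂ} (hx : x.IsHermitian) :
    (centralTangent x : Set (Matrix (Fin n) (Fin n) ℂ)) ⊆
      tangentVectors (isospectralSet x) x := by
  rw [tangentVectors_isospectralSet hx]
  intro v hv
  induction hv using Submodule.span_induction with
  | mem v hv =>
    obtain ⟨m, hm, Z, hZ, hc, rfl⟩ := hv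
    have := lie_pad_mem_tangentVectors hx hm hZ hc
    rwa [tangentVectors_isospectralSet hx] at this
  | zero => rw [Set.mem_ofPred_eq, map_zero]; exact Submodule.zero_mem _
  | add v w _ _ hv hw => rw [Set.mem_ofPred_eq, map_add]; exact Submodule.add_mem _ hv hw
  | smul a v _ hv => rw [Set.mem_ofPred_eq, map_smul]; exact Submodule.smul_mem _ a hv

end Pad
end GelfandCetlin
end

noncomputable section
namespace GelfandCetlin
open Polynomial

/-! ### The tangent spaces of the isospectral sets -/

section Rotation

variable {m : ℕ} {S : Finset ℝ} {Y : Matrix (Fin m) (Fin m) ℂ}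

theorem conjTranspose_vecMulVec_star {ι : Type*} (a b : ι → ℂ) :
    (Matrix.vecMulVec a (star b))ᴴ = Matrix.vecMulVec b (star a) := by
  ext i j
  simp [Matrix.vecMulVec_apply, mul_comm]

theorem commute_vecMulVec_star {ι : Type*} [Fintype ι] {Y : Matrix ι ι ℂ} (hY : Y.IsHermitian)
    {c : ℝ} {a b : ι → ℂ} (ha : Y *ᵥ a = c • a) (hb : Y *ᵥ b = c • b) :
    Commute (Matrix.vecMulVec a (star b)) Y := by
  have h : star b ᵥ* Y = c • star b := by
    have := congrArg star hb
    rwa [Matrix.star_mulVec, hY.eq, star_smul, star_trivial c] at this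
  rw [Commute, SemiconjBy, Matrix.vecMulVec_mul, Matrix.mul_vecMulVec, ha, h]
  ext i j
  simp [Matrix.vecMulVec_apply]
  ring

theorem vecMulVec_star_mulVec {ι : Type*} [Fintype ι] (a b w : ι → ℂ) :
    Matrix.vecMulVec a (star b) *ᵥ w = (star b ⬝ᵥ w) • a := by
  ext i
  simp [Matrix.mulVec, Matrix.vecMulVec_apply, dotProduct, Finset.mul_sum, mul_comm,
    mul_left_comm]

/-- The skew-Hermitian matrices commuting with `Y` move `b` in all directions preserving the
weights. -/
theorem exists_skew_mulVec_eq (hY : Y.IsHermitian)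
    (hS : aeval Y (Lagrange.nodal S (id : ℝ → ℝ)) = 0) {b b' : Fin m → ℂ}
    (hb' : b' ∈ levelSpace S Y b) :
    ∃ Z : Matrix (Fin m) (Fin m) ℂ, Zᴴ = -Z ∧ Commute Z Y ∧ Z *ᵥ b = b' := by
  have key : ∀ c ∈ S, ∃ Z : Matrix (Fin m) (Fin m) ℂ, Zᴴ = -Z ∧ Commute Z Y ∧
      Z *ᵥ b = specProj S c Y *ᵥ b' := by
    intro c hc
    obtain ⟨h1, h2⟩ := hb' c hc
    by_cases hw : specWeight S c Y b = 0
    · exact ⟨0, by simp, Commute.zero_left _, by rw [h1 hw, Matrix.zero_mulVec]⟩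
    set w := specWeight S c Y b with hwdef
    have hw' : (w : ℂ) ≠ 0 := by exact_mod_cast hw
    have hww : star (specProj S c Y *ᵥ b) ⬝ᵥ b = w := by
      rw [← dotProduct_mulVec_of_isHermitian (isHermitian_specProj hY S c),
        ← ofReal_specWeight hY hS hc]
    have hea := mulVec_specProj_mulVec hS hc b
    have heb := mulVec_specProj_mulVec hS hc b'
    set u := specProj S c Y *ᵥ b with hu
    set u' := specProj S c Y *ᵥ b' with hu'
    set β := star u' ⬝ᵥ b with hβ
    have hβre : star β = -β := by
      have h3 : star β = star u ⬝ᵥ b' := by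
        rw [hβ, hu', hu, ← dotProduct_mulVec_of_isHermitian (isHermitian_specProj hY S c),
          ← Matrix.star_dotProduct]
      rw [← h3] at h2
      apply Complex.ext
      · have : β.re = 0 := by simpa using h2
        simp [this]
      · simp
    -- The first, skew-Hermitian, term sends `b` to `u' - (β / w) u`. The second removes the error;
    -- it is skew-Hermitian because the condition on `b'` makes `β` purely imaginary. Both commute
    -- with `Y` as `u` and `u'` lie in the same eigenspace.
    refine ⟨(w : ℂ)⁻¹ • (Matrix.vecMulVec u' (star u) - Matrix.vecMulVec u (star u')) +
      (β / w ^ 2) • Matrix.vecMulVec u (star u), ?_, ?_, ?_⟩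
    · rw [Matrix.conjTranspose_add, Matrix.conjTranspose_smul, Matrix.conjTranspose_smul,
        Matrix.conjTranspose_sub, conjTranspose_vecMulVec_star, conjTranspose_vecMulVec_star,
        conjTranspose_vecMulVec_star, star_div₀, hβre]
      simp only [star_inv₀, star_pow, Complex.star_def, Complex.conj_ofReal, neg_div, neg_smul,
        neg_add, ← smul_neg, neg_sub]
    · exact (((commute_vecMulVec_star hY heb hea).sub_left
        (commute_vecMulVec_star hY hea heb)).smul_left _).add_left
        ((commute_vecMulVec_star hY hea hea).smul_left _)
    · rw [Matrix.add_mulVec, Matrix.smul_mulVec, Matrix.smul_mulVec, Matrix.sub_mulVec,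
        vecMulVec_star_mulVec, vecMulVec_star_mulVec, vecMulVec_star_mulVec, hww, ← hβ, smul_sub,
        smul_smul, smul_smul, smul_smul, inv_mul_cancel₀ hw', one_smul]
      have : β / (w : ℂ) ^ 2 * w = (w : ℂ)⁻¹ * β := by field_simp
      rw [this, sub_add_cancel]
  choose! Z hZ1 hZ2 hZ3 using key
  refine ⟨∑ c ∈ S, Z c, ?_, ?_, ?_⟩
  · rw [Matrix.conjTranspose_sum, ← Finset.sum_neg_distrib]
    exact Finset.sum_congr rfl hZ1
  · exact Commute.sum_left _ _ _ hZ2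
  · rw [Matrix.sum_mulVec, Finset.sum_congr rfl hZ3, sum_specProj_mulVec hS]

end Rotation

section PadApply

variable {n : ℕ}

theorem pad_mul_apply_castLE (m : ℕ) (hm : m ≤ n) (Z : Matrix (Fin m) (Fin m) ℂ)
    (y : Matrix (Fin n) (Fin n) ℂ) (i : Fin m) (k : Fin n) :
    (pad m hm Z * y) (Fin.castLE hm i) k = (Z *ᵥ fun i' => y (Fin.castLE hm i') k) i := by
  have h1 : ∀ B : Matrix (Fin m) (Fin n) ℂ, (incl m hm * B) (Fin.castLE hm i) k = B i k := by
    intro B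
    simp [incl, Matrix.mul_apply, Matrix.one_apply, Fin.castLE_inj]
  have h2 : (incl m hm)ᴴ * y = y.submatrix (Fin.castLE hm) id := by
    ext i j
    simp [incl, Matrix.mul_apply, Matrix.one_apply]
  rw [pad, Matrix.mul_assoc, Matrix.mul_assoc, h1, h2]
  rfl

theorem pad_apply_eq_zero_left (m : ℕ) (hm : m ≤ n) (Z : Matrix (Fin m) (Fin m) ℂ) {k : Fin n}
    (hk : m ≤ k) (l : Fin n) : pad m hm Z k l = 0 := by
  have h : ∀ i : Fin m, k ≠ Fin.castLE hm i := fun i h => by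
    have := i.2; have := congrArg Fin.val h; simp at this; omega
  rw [pad, Matrix.mul_assoc, Matrix.mul_apply]
  refine Finset.sum_eq_zero fun i _ => ?_
  simp [incl, h i]

theorem pad_apply_eq_zero_right (m : ℕ) (hm : m ≤ n) (Z : Matrix (Fin m) (Fin m) ℂ) {k : Fin n}
    (hk : m ≤ k) (l : Fin n) : pad m hm Z l k = 0 := by
  have h := pad_apply_eq_zero_left m hm Zᴴ hk l
  rw [← conjTranspose_pad, Matrix.conjTranspose_apply, star_eq_zero] at h
  exact h

theorem upperCol_lie_pad (j : Fin n) (Z : Matrix (Fin j) (Fin j) ℂ)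
    (x : Matrix (Fin n) (Fin n) ℂ) :
    upperCol ⁅pad j j.2.le Z, x⁆ j = Z *ᵥ upperCol x j := by
  ext i
  rw [upperCol, Ring.lie_def, Matrix.sub_apply, pad_mul_apply_castLE, Matrix.mul_apply,
    Finset.sum_eq_zero fun k _ => by rw [pad_apply_eq_zero_right _ _ _ le_rfl, mul_zero], sub_zero]
  rfl

theorem lie_pad_apply_self (j : Fin n) (Z : Matrix (Fin j) (Fin j) ℂ)
    (x : Matrix (Fin n) (Fin n) ℂ) : ⁅pad j j.2.le Z, x⁆ j j = 0 := by
  rw [Ring.lie_def, Matrix.sub_apply, Matrix.mul_apply, Matrix.mul_apply,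
    Finset.sum_eq_zero fun k _ => by rw [pad_apply_eq_zero_left _ _ _ le_rfl, zero_mul],
    Finset.sum_eq_zero fun k _ => by rw [pad_apply_eq_zero_right _ _ _ le_rfl, mul_zero], sub_zero]

theorem leading_succ_eq_zero {v : Matrix (Fin n) (Fin n) ℂ} (hv : v.IsHermitian) {j : Fin n}
    (h1 : leading v j j.2.le = 0) (h2 : v j j = 0) (h3 : upperCol v j = 0) :
    leading v (j + 1) j.2 = 0 := by
  have h4 : ∀ i : Fin j, v (Fin.castLE j.2.le i) j = 0 := fun i => congrFun h3 i
  ext i k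
  refine Fin.lastCases ?_ (fun i => ?_) i <;> refine Fin.lastCases ?_ (fun k => ?_) k
  · exact h2
  · refine (hv.apply _ _).symm.trans ?_
    exact (congrArg star (h4 k)).trans (star_zero _)
  · exact h4 i
  · exact congrFun (congrFun h1 i) k

variable {x : Matrix (Fin n) (Fin n) ℂ} (hx : x.IsHermitian)

/-- A space of Hermitian matrices is contained in `centralTangent x` if this holds infinitesimally
at each level. -/
theorem le_centralTangent {Λ : Submodule ℝ (Matrix (Fin n) (Fin n) ℂ)}
    (h1 : centralTangent x ≤ Λ) (h2 : ∀ v ∈ Λ, v.IsHermitian)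
    (h3 : ∀ v ∈ Λ, ∀ j : Fin n, leading v j j.2.le = 0 → v j j = 0 ∧
      upperCol v j ∈ levelSpace (levelSpec hx j) (leading x j j.2.le) (upperCol x j)) :
    Λ ≤ centralTangent x := by
  intro v hv
  have key : ∀ m (hm : m ≤ n), ∃ a ∈ centralTangent x, leading (v - a) m hm = 0 := by
    intro m
    induction m with
    | zero => exact fun hm => ⟨0, Submodule.zero_mem _, by ext i; exact i.elim0⟩
    | succ m ih =>
      intro hm
      obtain ⟨a, ha, hva⟩ := ih (Nat.le_of_succ_le hm)
      set j : Fin n := ⟨m, hm⟩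
      have hΛ : v - a ∈ Λ := Λ.sub_mem hv (h1 ha)
      obtain ⟨h4, h5⟩ := h3 _ hΛ j hva
      -- The commutator of `x` with the padding of `Z` has zero `j`-block and zero diagonal entry at
      -- `j`, and its `j`-th column is that of `v - a`. Subtracting it clears one more row and
      -- column without disturbing the block already cleared.
      obtain ⟨Z, hZ1, hZ2, hZ3⟩ := exists_skew_mulVec_eq (isHermitian_leading hx j j.2.le)
        (aeval_nodal_levelSpec hx j) h5
      have hmem : ⁅pad j j.2.le Z, x⁆ ∈ centralTangent x :=
        Submodule.subset_span ⟨j, j.2.le, Z, hZ1, hZ2, rfl⟩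
      refine ⟨a + ⁅pad j j.2.le Z, x⁆, Submodule.add_mem _ ha hmem, ?_⟩
      rw [← sub_sub]
      refine leading_succ_eq_zero (j := j) (h2 _ (Λ.sub_mem hΛ (h1 hmem))) ?_ ?_ ?_
      · have e1 := leading_lie_pad_of_ge le_rfl j.2.le Z x hZ2
        have e2 : leading (v - a - ⁅pad j j.2.le Z, x⁆) j j.2.le =
          leading (v - a) j j.2.le - leading ⁅pad j j.2.le Z, x⁆ j j.2.le := rfl
        rw [e2, e1, sub_zero]; exact hva
      · rw [Matrix.sub_apply, h4, lie_pad_apply_self, sub_zero]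
      · have e2 : upperCol (v - a - ⁅pad j j.2.le Z, x⁆) j =
          upperCol (v - a) j - upperCol ⁅pad j j.2.le Z, x⁆ j := rfl
        rw [e2, upperCol_lie_pad, hZ3, sub_self]
  obtain ⟨a, ha, hva⟩ := key n le_rfl
  have : v = a := sub_eq_zero.1 hva
  rwa [this]

theorem isHermitian_of_mem_tangentVectors {v : Matrix (Fin n) (Fin n) ℂ}
    (hv : fderiv ℝ (chartMap hx) x v ∈ chartSpace hx) : v.IsHermitian ∧ ∀ i, v i i = 0 := by
  have hd : ∀ i, v i i = 0 := fun i => by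
    rw [← fderiv_chartMap_self hx v i]; exact hv.1 i i le_rfl
  have hl : ∀ i j, j < i → v i j = star (v j i) := fun i j hij => sub_eq_zero.1 (by
    rw [← fderiv_chartMap_of_lt hx v hij]; exact hv.1 i j hij.le)
  refine ⟨?_, hd⟩
  ext i j
  rw [Matrix.conjTranspose_apply]
  rcases lt_trichotomy i j with h | rfl | h
  · rw [hl j i h, star_star]
  · rw [hd, star_zero]
  · rw [hl i j h]

/-- The chart describes the tangent space as the preimage of `chartSpace`. For a tangent vector with
zero `j`-block the derivative returns the `j`-th column, so this column satisfies the linearised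
weight equations, as `le_centralTangent` requires. -/
theorem tangentVectors_eq_centralTangent {x : Matrix (Fin n) (Fin n) ℂ} (hx : x.IsHermitian) :
    tangentVectors (isospectralSet x) x = centralTangent x := by
  refine Set.Subset.antisymm ?_ (centralTangent_subset_tangentVectors hx)
  have h := centralTangent_subset_tangentVectors hx
  rw [tangentVectors_isospectralSet hx] at h ⊢
  exact le_centralTangent hx (Λ := (chartSpace hx).comap (fderiv ℝ (chartMap hx) x).toLinearMap) h
    (fun v hv => (isHermitian_of_mem_tangentVectors hx hv).1)
    (fun v hv j hj => ⟨(isHermitian_of_mem_tangentVectors hx hv).2 j, by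
      rw [← upperCol_fderiv_chartMap hx hj]; exact hv.2 j⟩)

theorem isHermitian_of_mem_centralTangent {x : Matrix (Fin n) (Fin n) ℂ} (hx : x.IsHermitian)
    {v : Matrix (Fin n) (Fin n) ℂ}
    (hv : v ∈ centralTangent x) : v.IsHermitian := by
  have h := centralTangent_subset_tangentVectors hx hv
  rw [tangentVectors_isospectralSet hx] at h
  exact (isHermitian_of_mem_tangentVectors hx h).1

end PadApply
end GelfandCetlin
end

noncomputable section
namespace GelfandCetlin
open Polynomial

/-! ### The symplectic complement of the tangent spaces -/

section BorderTrace

variable {m : ℕ}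

theorem trace_mul_of_corner_eq_zero {B V : Matrix (Fin (m + 1)) (Fin (m + 1)) ℂ}
    (hB : B.IsHermitian) (hV : V.IsHermitian) (h0 : corner V = 0) :
    (B * V).trace = star (lastCol B) ⬝ᵥ lastCol V + star (lastCol V) ⬝ᵥ lastCol B +
      B (Fin.last m) (Fin.last m) * V (Fin.last m) (Fin.last m) := by
  have h1 : ∀ i j : Fin m, V i.castSucc j.castSucc = 0 := fun i j => congrFun (congrFun h0 i) j
  have h2 : ∀ i, V (Fin.last m) i = star (V i (Fin.last m)) := fun i => (hV.apply _ _).symm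
  have h3 : ∀ i, B (Fin.last m) i = star (B i (Fin.last m)) := fun i => (hB.apply _ _).symm
  simp only [Matrix.trace, Matrix.diag, Matrix.mul_apply, Fin.sum_univ_castSucc, h1, mul_zero,
    Finset.sum_const_zero, zero_add, dotProduct, lastCol, Pi.star_apply]
  rw [← add_assoc]
  congr 1
  rw [add_comm]
  congr 1
  · exact Finset.sum_congr rfl fun i _ => by rw [h3]
  · exact Finset.sum_congr rfl fun i _ => by rw [h2, mul_comm]

theorem trace_vecMulVec_star_mul {ι : Type*} [Fintype ι] (a b : ι → ℂ) (V : Matrix ι ι ℂ) :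
    (Matrix.vecMulVec a (star b) * V).trace = star b ⬝ᵥ V *ᵥ a := by
  rw [Matrix.vecMulVec_mul, Matrix.trace_vecMulVec, dotProduct_comm, Matrix.dotProduct_mulVec]

/-- Shows that the last columns of the powers of `H` generate a space stable under the corner,
containing all polynomials in the corner applied to the last column of `H`. -/
theorem lastCol_pow_succ (H : Matrix (Fin (m + 1)) (Fin (m + 1)) ℂ) (p : ℕ) :
    lastCol (H ^ (p + 1)) = corner H *ᵥ lastCol (H ^ p) +
      (H ^ p) (Fin.last m) (Fin.last m) • lastCol H := by
  ext i
  have h := border_mulVec_castSucc H (fun k => (H ^ p) k (Fin.last m)) i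
  rw [pow_succ']
  exact h

variable {H V : Matrix (Fin (m + 1)) (Fin (m + 1)) ℂ} {S : Finset ℝ}

/-- The first-order conditions on a variation `V` of the last column of `H` that is orthogonal to
the centraliser of `H`. -/
theorem last_eq_zero_and_lastCol_mem_levelSpace (hH : H.IsHermitian) (hV : V.IsHermitian)
    (h0 : corner V = 0) (hS : aeval (corner H) (Lagrange.nodal S (id : ℝ → ℝ)) = 0)
    (hstable : ∀ c ∈ S, Module.finrank ℂ (eigSpace H c) ≠
      Module.finrank ℂ (eigSpace (corner H) c))
    (hZ : ∀ Z : Matrix (Fin (m + 1)) (Fin (m + 1)) ℂ, Zᴴ = -Z → Commute Z H →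
      (Z * V).trace.im = 0) :
    V (Fin.last m) (Fin.last m) = 0 ∧ lastCol V ∈ levelSpace S (corner H) (lastCol H) := by
  have hY := isHermitian_corner hH
  have hre : ∀ B : Matrix (Fin (m + 1)) (Fin (m + 1)) ℂ, B.IsHermitian → Commute B H →
      (B * V).trace.re = 0 := by
    intro B hB hBH
    have := hZ (Complex.I • B) (by rw [Matrix.conjTranspose_smul, hB.eq]; simp)
      (hBH.smul_left _)
    rw [smul_mul_assoc, Matrix.trace_smul] at this
    simpa using this
  have hreal : ∀ B : Matrix (Fin (m + 1)) (Fin (m + 1)) ℂ, B.IsHermitian →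
      B (Fin.last m) (Fin.last m) = ((B (Fin.last m) (Fin.last m)).re : ℂ) := fun B hB =>
    (Complex.conj_eq_iff_re.1 (hB.apply _ _)).symm
  -- Testing against the scalar matrix `i` gives the trace of `V`, which is its last diagonal entry.
  have hd : V (Fin.last m) (Fin.last m) = 0 := by
    have h1 := hre 1 Matrix.isHermitian_one (Commute.one_left _)
    rw [trace_mul_of_corner_eq_zero Matrix.isHermitian_one hV h0] at h1
    have h2 : lastCol (1 : Matrix (Fin (m + 1)) (Fin (m + 1)) ℂ) = 0 := by
      ext i; simp [lastCol, (Fin.castSucc_lt_last i).ne]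
    rw [h2] at h1
    rw [hreal V hV]
    simpa using h1
  refine ⟨hd, ?_⟩
  -- the variation is orthogonal to the Krylov space of the last column
  have hpow : ∀ p, (star (lastCol (H ^ p)) ⬝ᵥ lastCol V).re = 0 := by
    intro p
    have h1 := hre (H ^ p) (hH.pow p) ((Commute.refl H).pow_left p)
    rw [trace_mul_of_corner_eq_zero (hH.pow p) hV h0, hd, mul_zero, add_zero,
      Matrix.star_dotProduct (lastCol V), Complex.add_re, Complex.star_def, Complex.conj_re] at h1
    linarith
  set M : Submodule ℝ (Fin m → ℂ) := Submodule.span ℝ (Set.range fun p => lastCol (H ^ p)) with hM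
  have hMre : ∀ w ∈ M, (star w ⬝ᵥ lastCol V).re = 0 := by
    intro w hw
    induction hw using Submodule.span_induction with
    | mem w hw => obtain ⟨p, rfl⟩ := hw; exact hpow p
    | zero => simp
    | add v w _ _ hv hw => rw [star_add, add_dotProduct, Complex.add_re, hv, hw, add_zero]
    | smul a v _ hv =>
      rw [star_smul, star_trivial a, smul_dotProduct, Complex.smul_re, hv, smul_zero]
  have hbM : lastCol H ∈ M := Submodule.subset_span ⟨1, by simp⟩
  -- The last diagonal entry of `H ^ p` is real because `H ^ p` is Hermitian, so the real span
  -- suffices.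
  have hYM : ∀ w ∈ M, corner H *ᵥ w ∈ M := by
    intro w hw
    induction hw using Submodule.span_induction with
    | mem w hw =>
      obtain ⟨p, rfl⟩ := hw
      have h1 := lastCol_pow_succ H p
      rw [hreal _ (hH.pow p)] at h1
      have h2 : corner H *ᵥ lastCol (H ^ p) = lastCol (H ^ (p + 1)) -
          ((H ^ p) (Fin.last m) (Fin.last m)).re • lastCol H := eq_sub_of_add_eq h1.symm
      rw [h2]
      exact M.sub_mem (Submodule.subset_span ⟨p + 1, rfl⟩) (M.smul_mem _ hbM)
    | zero => rw [Matrix.mulVec_zero]; exact M.zero_mem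
    | add v w _ _ hv hw => rw [Matrix.mulVec_add]; exact M.add_mem hv hw
    | smul a v _ hv => rw [Matrix.mulVec_smul]; exact M.smul_mem a hv
  have haeval : ∀ f : ℝ[X], aeval (corner H) f *ᵥ lastCol H ∈ M := by
    have hk : ∀ k : ℕ, (corner H ^ k) *ᵥ lastCol H ∈ M := by
      intro k
      induction k with
      | zero => simpa using hbM
      | succ k ih => rw [pow_succ', ← Matrix.mulVec_mulVec]; exact hYM _ ih
    intro f
    induction f using Polynomial.induction_on' with
    | add p q hp hq => rw [map_add, Matrix.add_mulVec]; exact M.add_mem hp hq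
    | monomial k a =>
      rw [aeval_monomial, ← Algebra.smul_def, Matrix.smul_mulVec]
      exact M.smul_mem a (hk k)
  intro c hc
  refine ⟨fun hw => ?_, hMre _ (haeval _)⟩
  have hPb := (specWeight_eq_zero_iff hY hS hc _).1 hw
  have hbE : ∀ e ∈ eigSpace (corner H) c, star (lastCol H) ⬝ᵥ e = 0 := by
    intro e he
    rw [← specProj_mulVec_of_eigenvector hc (mem_eigSpace.1 he),
      dotProduct_mulVec_of_isHermitian (isHermitian_specProj hY S c), hPb, star_zero,
      zero_dotProduct]
  -- At weight zero the last column is orthogonal to the eigenspace of the corner. The change of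
  -- multiplicity can then only come from an eigenvector of `H` with non-zero last entry.
  obtain ⟨w, hwE, hwl⟩ : ∃ w ∈ eigSpace H c, w (Fin.last m) ≠ 0 := by
    by_contra hcon
    push Not at hcon
    exact hstable c hc ((finrank_eigSpace_border_eq_iff hH c).2 ⟨hbE, hcon⟩)
  set e := specProj S c (corner H) *ᵥ lastCol V with he
  have heE : e ∈ eigSpace (corner H) c := mem_eigSpace.2 (mulVec_specProj_mulVec hS hc _)
  have hê : snocZero m e ∈ eigSpace H c := (snocZero_mem_eigSpace_iff hH).2 ⟨heE, hbE e heE⟩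
  rw [mem_eigSpace] at hwE hê
  have hz : star (snocZero m e) ⬝ᵥ V *ᵥ w = w (Fin.last m) * (star e ⬝ᵥ lastCol V) := by
    have h1 : ∀ i : Fin m, (V *ᵥ w) i.castSucc = w (Fin.last m) * lastCol V i := fun i => by
      rw [border_mulVec_castSucc, h0, Matrix.zero_mulVec, Pi.zero_apply, zero_add]
    rw [dotProduct, Fin.sum_univ_castSucc]
    simp only [Pi.star_apply, snocZero_castSucc, snocZero_last, star_zero, zero_mul, add_zero, h1,
      dotProduct, Finset.mul_sum]
    exact Finset.sum_congr rfl fun i _ => by ring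
  have hzs : star w ⬝ᵥ V *ᵥ snocZero m e = star (star (snocZero m e) ⬝ᵥ V *ᵥ w) := by
    rw [dotProduct_mulVec_of_isHermitian hV, Matrix.star_dotProduct]
  set z := star (snocZero m e) ⬝ᵥ V *ᵥ w with hzdef
  have hc1 := commute_vecMulVec_star hH hwE hê
  have hc2 := commute_vecMulVec_star hH hê hwE
  -- The eigenvectors `w` and `(e, 0)` of `H` at `c` give rank-one matrices commuting with `H`.
  -- Their sum and difference annihilate the real and imaginary parts of `z`, which is the last
  -- entry of `w` times the inner product of `e` with the last column of `V`.
  have t1 := hre (Matrix.vecMulVec w (star (snocZero m e)) +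
    Matrix.vecMulVec (snocZero m e) (star w)) (by
      rw [Matrix.IsHermitian, Matrix.conjTranspose_add, conjTranspose_vecMulVec_star,
        conjTranspose_vecMulVec_star]
      exact add_comm _ _) (hc1.add_left hc2)
  have t2 := hZ (Matrix.vecMulVec w (star (snocZero m e)) -
    Matrix.vecMulVec (snocZero m e) (star w)) (by
      rw [Matrix.conjTranspose_sub, conjTranspose_vecMulVec_star,
        conjTranspose_vecMulVec_star, neg_sub]) (hc1.sub_left hc2)
  rw [add_mul, Matrix.trace_add, trace_vecMulVec_star_mul, trace_vecMulVec_star_mul, hzs,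
    Complex.add_re, Complex.star_def, Complex.conj_re] at t1
  rw [sub_mul, Matrix.trace_sub, trace_vecMulVec_star_mul, trace_vecMulVec_star_mul, hzs,
    Complex.sub_im, Complex.star_def, Complex.conj_im] at t2
  have hz0 : z = 0 := Complex.ext (by rw [Complex.zero_re]; linarith)
    (by rw [Complex.zero_im]; linarith)
  rw [hz0] at hz
  have h5 : star e ⬝ᵥ lastCol V = 0 := (mul_eq_zero.1 hz.symm).resolve_left hwl
  rw [he, ← dotProduct_mulVec_of_isHermitian (isHermitian_specProj hY S c)] at h5
  refine (specWeight_eq_zero_iff hY hS hc _).1 ?_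
  rw [specWeight, h5, Complex.zero_re]

/-- If the multiplicity of `c` is stable, there is an infinitesimal rotation of `H` that moves the
last column only, in the direction of an eigenvector. -/
theorem exists_lie_of_finrank_eq (hH : H.IsHermitian) {c : ℝ}
    (h : Module.finrank ℂ (eigSpace H c) = Module.finrank ℂ (eigSpace (corner H) c))
    {e : Fin m → ℂ} (he : e ∈ eigSpace (corner H) c) :
    ∃ X : Matrix (Fin (m + 1)) (Fin (m + 1)) ℂ, Xᴴ = -X ∧ corner ⁅X, H⁆ = 0 ∧
      lastCol ⁅X, H⁆ = e := by
  obtain ⟨h1, h2⟩ := (finrank_eigSpace_border_eq_iff hH c).1 h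
  set ε : Fin (m + 1) → ℂ := Pi.single (Fin.last m) 1 with hε
  -- Eigenvectors of `H` at `c` have zero last entry, so `ε` is orthogonal to the kernel of `H - c`
  -- and the equation is solved spectrally. The summand at `c' = c` vanishes, since the projection
  -- of `ε` is zero.
  obtain ⟨s, hHs⟩ : ∃ s, H *ᵥ s = ε + c • s := by
    set S' := specSet hH with hS'
    have hn := aeval_nodal_specSet hH hH rfl
    have hPε : ∀ c' ∈ S', c' = c → specProj S' c' H *ᵥ ε = 0 := by
      rintro c' hc' rfl
      refine (specWeight_eq_zero_iff hH hn hc' _).1 ?_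
      have h3 := h2 (specProj S' c' H *ᵥ ε) (mem_eigSpace.2 (mulVec_specProj_mulVec hn hc' _))
      have h4 : star ε = Pi.single (Fin.last m) 1 := by
        rw [hε, ← Pi.single_star, star_one]
      rw [specWeight, h4, single_dotProduct, h3, mul_zero, Complex.zero_re]
    refine ⟨∑ c' ∈ S', (c' - c)⁻¹ • (specProj S' c' H *ᵥ ε), ?_⟩
    rw [Matrix.mulVec_sum, Finset.smul_sum]
    conv_rhs => enter [1]; rw [← sum_specProj_mulVec hn ε]
    rw [← Finset.sum_add_distrib]
    refine Finset.sum_congr rfl fun c' hc' => ?_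
    rw [Matrix.mulVec_smul, mulVec_specProj_mulVec hn hc']
    by_cases hcc : c' = c
    · rw [hPε c' hc' hcc]; simp
    · have : c' - c ≠ 0 := sub_ne_zero.2 hcc
      rw [smul_smul, smul_smul]
      conv_rhs => enter [1]; rw [← one_smul ℝ (specProj S' c' H *ᵥ ε)]
      rw [← add_smul]
      congr 1
      field_simp
      ring
  have hê : snocZero m e ∈ eigSpace H c := (snocZero_mem_eigSpace_iff hH).2 ⟨he, h1 e he⟩
  rw [mem_eigSpace] at hê
  -- The terms with the factor `c` cancel, since `(e, 0)` is an eigenvector and `s` is one up to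
  -- `ε`. What remains lives in the last row and column.
  have hlie : ⁅Matrix.vecMulVec (snocZero m e) (star s) - Matrix.vecMulVec s (star (snocZero m e)),
      H⁆ = Matrix.vecMulVec (snocZero m e) (star ε) + Matrix.vecMulVec ε (star (snocZero m e)) := by
    have e1 : star s ᵥ* H = star ε + c • star s := by
      have := congrArg star hHs
      rwa [Matrix.star_mulVec, hH.eq, star_add, star_smul, star_trivial c] at this
    have e2 : star (snocZero m e) ᵥ* H = c • star (snocZero m e) := by
      have := congrArg star hê
      rwa [Matrix.star_mulVec, hH.eq, star_smul, star_trivial c] at this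
    rw [Ring.lie_def, sub_mul, mul_sub, Matrix.vecMulVec_mul, Matrix.vecMulVec_mul,
      Matrix.mul_vecMulVec, Matrix.mul_vecMulVec, e1, e2, hHs, hê]
    ext i j
    simp [Matrix.vecMulVec_apply]
    ring
  refine ⟨Matrix.vecMulVec (snocZero m e) (star s) - Matrix.vecMulVec s (star (snocZero m e)),
    ?_, ?_, ?_⟩
  · rw [Matrix.conjTranspose_sub, conjTranspose_vecMulVec_star, conjTranspose_vecMulVec_star,
      neg_sub]
  · rw [hlie]
    ext i j
    simp [corner, Matrix.vecMulVec_apply, hε, (Fin.castSucc_lt_last _).ne]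
  · rw [hlie]
    ext i
    simp [lastCol, Matrix.vecMulVec_apply, hε, (Fin.castSucc_lt_last _).ne]

end BorderTrace
end GelfandCetlin
end

noncomputable section
namespace GelfandCetlin
open Polynomial

/-! ### Lagrangian isospectral sets -/

theorem finrank_eigSpace_eq_count {ι : Type*} [Fintype ι] [DecidableEq ι] {Y : Matrix ι ι ℂ}
    (hY : Y.IsHermitian) (c : ℝ) :
    Module.finrank ℂ (eigSpace Y c) = Y.charpoly.roots.count (c : ℂ) := by
  rw [finrank_eigSpace hY, hY.roots_charpoly_eq_eigenvalues, Multiset.count_map,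
    Finset.card_def, Finset.filter_val]
  congr 1
  refine Multiset.filter_congr fun i _ => ?_
  simp [eq_comm]

section Lagrangian

variable {n : ℕ}

/-- Some eigenvalue of a leading submatrix of `x` has the same multiplicity at the next level. -/
def HasStableEigenvalue (x : Matrix (Fin n) (Fin n) ℂ) : Prop :=
  ∃ (j : Fin n) (c : ℝ), Module.finrank ℂ (eigSpace (leading x j j.2.le) c) ≠ 0 ∧
    Module.finrank ℂ (eigSpace (leading x (j + 1) j.2) c) =
      Module.finrank ℂ (eigSpace (leading x j j.2.le) c)

theorem hasStableEigenvalue_congr {x y : Matrix (Fin n) (Fin n) ℂ} (hx : x.IsHermitian)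
    (hy : y ∈ isospectralSet x) : HasStableEigenvalue y ↔ HasStableEigenvalue x := by
  have h : ∀ (m : ℕ) (hm : m ≤ n) (c : ℝ), Module.finrank ℂ (eigSpace (leading y m hm) c) =
      Module.finrank ℂ (eigSpace (leading x m hm) c) := fun m hm c => by
    rw [finrank_eigSpace_eq_count (isHermitian_leading hy.1 m hm),
      finrank_eigSpace_eq_count (isHermitian_leading hx m hm), hy.2 m hm]
  simp only [HasStableEigenvalue, h]

theorem isospectralSet_eq_of_mem {x y : Matrix (Fin n) (Fin n) ℂ} (hy : y ∈ isospectralSet x) :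
    isospectralSet y = isospectralSet x := by
  ext z
  exact and_congr_right fun _ => forall₂_congr fun m hm => by rw [hy.2 m hm]

theorem mem_skewHerm {Y : Matrix (Fin n) (Fin n) ℂ} : Y ∈ SkewHerm n ↔ Yᴴ = -Y := by
  rw [SkewHerm, ← SetLike.mem_coe]
  exact skewAdjoint.mem_iff

theorem isHermitian_lie {x X : Matrix (Fin n) (Fin n) ℂ} (hx : x.IsHermitian) (hX : Xᴴ = -X) :
    (⁅X, x⁆).IsHermitian := by
  rw [Matrix.IsHermitian, Ring.lie_def, Matrix.conjTranspose_sub, Matrix.conjTranspose_mul,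
    Matrix.conjTranspose_mul, hX, hx.eq]
  noncomm_ring

theorem isHermitian_of_mem_orbitTangent {x : Matrix (Fin n) (Fin n) ℂ} (hx : x.IsHermitian)
    (v : orbitTangent x) : (v : Matrix (Fin n) (Fin n) ℂ).IsHermitian := by
  obtain ⟨_, X, rfl⟩ := v
  exact isHermitian_lie hx (mem_skewHerm.1 X.2)

theorem lie_mem_orbitTangent (x : Matrix (Fin n) (Fin n) ℂ) {Y : Matrix (Fin n) (Fin n) ℂ}
    (hY : Yᴴ = -Y) : ⁅Y, x⁆ ∈ orbitTangent x :=
  ⟨⟨Y, mem_skewHerm.2 hY⟩, rfl⟩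

theorem kksForm_eq {x : Matrix (Fin n) (Fin n) ℂ} (v w : orbitTangent x)
    {Y : Matrix (Fin n) (Fin n) ℂ} (hY : Yᴴ = -Y)
    (hw : (w : Matrix (Fin n) (Fin n) ℂ) = ⁅Y, x⁆) :
    kksForm x v w = (Y * (v : Matrix (Fin n) (Fin n) ℂ)).trace.im := by
  obtain ⟨_, X, rfl⟩ := v
  have hw' : w = ⟨infAction x ⟨Y, mem_skewHerm.2 hY⟩, ⟨Y, mem_skewHerm.2 hY⟩, rfl⟩ :=
    Subtype.ext hw
  rw [hw', kksForm_apply, Matrix.trace_smul, trace_mul_lie]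
  simp [infAction]

/-- The Hermitian matrices orthogonal to the centralisers of the leading submatrices of `x`. -/
def centralOrthogonal (x : Matrix (Fin n) (Fin n) ℂ) :
    Submodule ℝ (Matrix (Fin n) (Fin n) ℂ) where
  carrier := {v | v.IsHermitian ∧ ∀ (l : ℕ) (hl : l ≤ n) (Z : Matrix (Fin l) (Fin l) ℂ), Zᴴ = -Z →
    Commute Z (leading x l hl) → (Z * leading v l hl).trace.im = 0}
  add_mem' {v w} hv hw := ⟨hv.1.add hw.1, fun l hl Z h1 h2 => by
    rw [leading_add, mul_add, Matrix.trace_add, Complex.add_im, hv.2 l hl Z h1 h2,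
      hw.2 l hl Z h1 h2, add_zero]⟩
  zero_mem' := ⟨Matrix.isHermitian_zero, fun l hl Z _ _ => by
    have : leading (0 : Matrix (Fin n) (Fin n) ℂ) l hl = 0 := rfl
    rw [this, mul_zero, Matrix.trace_zero, Complex.zero_im]⟩
  smul_mem' t v hv := ⟨by
    rw [Matrix.IsHermitian, Matrix.conjTranspose_smul, hv.1.eq, star_trivial],
    fun l hl Z h1 h2 => by
      rw [leading_smul, mul_smul_comm, Matrix.trace_smul, Complex.smul_im, hv.2 l hl Z h1 h2,
        smul_zero]⟩

theorem mem_levelSpec_iff {x : Matrix (Fin n) (Fin n) ℂ} (hx : x.IsHermitian) (j : Fin n) (c : ℝ) :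
    c ∈ levelSpec hx j ↔ Module.finrank ℂ (eigSpace (leading x j j.2.le) c) ≠ 0 := by
  rw [finrank_eigSpace (isHermitian_leading hx j j.2.le), Finset.card_ne_zero,
    Finset.filter_nonempty_iff]
  simp [specSet]

/-- The same induction as for the tangent space, `le_centralTangent`; orthogonality to the
centraliser of the next block now supplies the linearised weight equations at each level. -/
theorem centralOrthogonal_le_centralTangent {x : Matrix (Fin n) (Fin n) ℂ} (hx : x.IsHermitian)
    (hst : ¬ HasStableEigenvalue x) : centralOrthogonal x ≤ centralTangent x := by
  refine le_centralTangent hx (fun v hv => ⟨isHermitian_of_mem_centralTangent hx hv,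
    fun l hl Z _ hZ => by
      rw [trace_mul_leading_of_mem_centralTangent hv l hl Z hZ, Complex.zero_im]⟩)
    (fun v hv => hv.1) fun v hv j hj => ?_
  refine last_eq_zero_and_lastCol_mem_levelSpace (H := leading x (j + 1) j.2)
    (V := leading v (j + 1) j.2) (S := levelSpec hx j) (isHermitian_leading hx _ _)
    (isHermitian_leading hv.1 _ _) hj (aeval_nodal_levelSpec hx j) (fun c hc h => ?_)
    (fun Z h1 h2 => hv.2 _ _ Z h1 h2)
  exact hst ⟨j, c, (mem_levelSpec_iff hx j c).1 hc, h⟩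

theorem kksForm_eq_zero_of_mem_centralTangent {x : Matrix (Fin n) (Fin n) ℂ}
    (v w : orbitTangent x) (hv : ∀ (l : ℕ) (hl : l ≤ n) (Z : Matrix (Fin l) (Fin l) ℂ), Zᴴ = -Z →
      Commute Z (leading x l hl) → (Z * leading (v : Matrix (Fin n) (Fin n) ℂ) l hl).trace.im = 0)
    (hw : (w : Matrix (Fin n) (Fin n) ℂ) ∈ centralTangent x) : kksForm x v w = 0 := by
  obtain ⟨Y, h1, h2, h3⟩ : ∃ Y : Matrix (Fin n) (Fin n) ℂ, Yᴴ = -Y ∧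
      (w : Matrix (Fin n) (Fin n) ℂ) = ⁅Y, x⁆ ∧
      (Y * (v : Matrix (Fin n) (Fin n) ℂ)).trace.im = 0 := by
    generalize (w : Matrix (Fin n) (Fin n) ℂ) = w at hw
    induction hw using Submodule.span_induction with
    | mem w hw =>
      obtain ⟨m, hm, Z, hZ, hc, rfl⟩ := hw
      exact ⟨pad m hm Z, by rw [conjTranspose_pad, hZ, pad_neg], rfl,
        by rw [trace_pad_mul]; exact hv m hm Z hZ hc⟩
    | zero => exact ⟨0, by simp, by rw [Ring.lie_def, zero_mul, mul_zero, sub_zero], by simp⟩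
    | add a b _ _ ha hb =>
      obtain ⟨A, a1, a2, a3⟩ := ha
      obtain ⟨B, b1, b2, b3⟩ := hb
      refine ⟨A + B, by rw [Matrix.conjTranspose_add, a1, b1, neg_add], ?_, ?_⟩
      · rw [a2, b2, Ring.lie_def, Ring.lie_def, Ring.lie_def]; noncomm_ring
      · rw [add_mul, Matrix.trace_add, Complex.add_im, a3, b3, add_zero]
    | smul t a _ ha =>
      obtain ⟨A, a1, a2, a3⟩ := ha
      refine ⟨t • A, by rw [Matrix.conjTranspose_smul, a1, star_trivial, smul_neg], ?_, ?_⟩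
      · rw [a2, Ring.lie_def, Ring.lie_def, smul_mul_assoc, mul_smul_comm, smul_sub]
      · rw [smul_mul_assoc, Matrix.trace_smul, Complex.smul_im, a3, smul_zero]
  rw [kksForm_eq v w h1 h2, h3]

/-- Isotropy is unconditional. For the reverse inclusion, pairing with the generators of the tangent
space turns symplectic orthogonality into membership in `centralOrthogonal`. -/
theorem isLagrangian_isospectralSet {lam : Fin n → ℝ} {x : Matrix (Fin n) (Fin n) ℂ}
    (hx : x.IsHermitian) (hsub : isospectralSet x ⊆ orbit lam) (hst : ¬ HasStableEigenvalue x) :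
    IsLagrangian lam (isospectralSet x) where
  subset := hsub
  submanifold := isSmoothSubmanifold_isospectralSet x
  tangent_eq y hy v := by
    rw [← isospectralSet_eq_of_mem hy, tangentVectors_eq_centralTangent hy.1]
    constructor
    · intro hv w hw
      exact kksForm_eq_zero_of_mem_centralTangent v w (fun l hl Z _ hZ => by
        rw [trace_mul_leading_of_mem_centralTangent hv l hl Z hZ, Complex.zero_im]) hw
    · intro h
      refine centralOrthogonal_le_centralTangent hy.1
        (fun h' => hst ((hasStableEigenvalue_congr hx hy).1 h'))
        ⟨isHermitian_of_mem_orbitTangent hy.1 v, fun l hl Z h1 h2 => ?_⟩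
      have hs : (pad l hl Z)ᴴ = -pad l hl Z := by rw [conjTranspose_pad, h1, pad_neg]
      rw [← trace_pad_mul, ← kksForm_eq v ⟨_, lie_mem_orbitTangent y hs⟩ hs rfl]
      exact h _ (Submodule.subset_span ⟨l, hl, Z, h1, h2, rfl⟩)

/-- A stable eigenvalue yields a rotation `v` that is symplectically orthogonal to the tangent
space: its blocks up to size `j` vanish and its larger blocks are commutators with the blocks of
`x`. If `v` were tangent, its `j`-th column `e` would have no component in the eigenspace, because
the weight at `c` is zero; but `e` is a non-zero eigenvector. -/
theorem not_hasStableEigenvalue_of_isLagrangian {lam : Fin n → ℝ} {x : Matrix (Fin n) (Fin n) ℂ}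
    (hx : x.IsHermitian) (h : IsLagrangian lam (isospectralSet x)) : ¬ HasStableEigenvalue x := by
  rintro ⟨j, c, hc, hst⟩
  have hmem : x ∈ isospectralSet x := ⟨hx, fun _ _ => rfl⟩
  have hc' := (mem_levelSpec_iff hx j c).2 hc
  obtain ⟨⟨e, he⟩, hne⟩ : ∃ e : eigSpace (leading x j j.2.le) c, e ≠ 0 :=
    @exists_ne _ (Module.nontrivial_of_finrank_pos (R := ℂ) (Nat.pos_of_ne_zero hc)) 0
  obtain ⟨X, hX, hX0, hXe⟩ := exists_lie_of_finrank_eq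
    (isHermitian_leading hx (j + 1) j.2) hst he
  set P := pad (j + 1) j.2 X with hP
  have hPs : Pᴴ = -P := by rw [hP, conjTranspose_pad, hX, pad_neg]
  have hlead : leading ⁅P, x⁆ (j + 1) j.2 = ⁅X, leading x (j + 1) j.2⁆ := leading_lie_pad _ _ _ _
  have hl0 : leading ⁅P, x⁆ j j.2.le = 0 := by rw [← corner_leading, hlead, hX0]
  have hle : upperCol ⁅P, x⁆ j = e := by rw [← lastCol_leading, hlead, hXe]
  set v : orbitTangent x := ⟨⁅P, x⁆, lie_mem_orbitTangent x hPs⟩ with hv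
  have hvt : (v : Matrix (Fin n) (Fin n) ℂ) ∈ tangentVectors (isospectralSet x) x := by
    rw [h.tangent_eq x hmem v]
    intro w hw
    rw [tangentVectors_eq_centralTangent hx] at hw
    refine kksForm_eq_zero_of_mem_centralTangent v w (fun l hl Z _ hZ => ?_) hw
    rcases Nat.lt_or_ge j l with hjl | hjl
    · have : leading ⁅P, x⁆ l hl = ⁅pad (j + 1) hjl X, leading x l hl⁆ :=
        leading_lie_pad_of_le hjl hl X x
      rw [hv, this, trace_mul_lie_of_commute hZ, Complex.zero_im]
    · rw [hv, ← leading_leading _ hjl j.2.le, hl0]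
      have : leading (0 : Matrix (Fin j) (Fin j) ℂ) l hjl = 0 := rfl
      rw [this, mul_zero, Matrix.trace_zero, Complex.zero_im]
  rw [tangentVectors_isospectralSet hx] at hvt
  have h1 := ((mem_chartSpace hx).1 hvt).2 j
  rw [upperCol_fderiv_chartMap hx hl0, hle] at h1
  have hY := isHermitian_leading hx j j.2.le
  have hS := aeval_nodal_levelSpec hx j
  have hbE := ((finrank_eigSpace_border_eq_iff (isHermitian_leading hx (j + 1) j.2) c).1 hst).1
  have hPb := hbE (specProj (levelSpec hx j) c (leading x j j.2.le) *ᵥ upperCol x j)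
    (mem_eigSpace.2 (mulVec_specProj_mulVec hS hc' _))
  have hw : specWeight (levelSpec hx j) c (leading x j j.2.le) (upperCol x j) = 0 := by
    rw [specWeight]
    exact (congrArg Complex.re hPb).trans Complex.zero_re
  have h2 := (h1 c hc').1 hw
  rw [specProj_mulVec_of_eigenvector hc' (mem_eigSpace.1 he)] at h2
  exact hne (Subtype.ext h2)

end Lagrangian
end GelfandCetlin
end

noncomputable section
namespace GelfandCetlin
open Polynomial

/-! ### Fibers of the Gelfand-Cetlin system -/

section Fiber

theorem eq_of_ofFn_eq {α : Type*} {k m : ℕ} (h : k = m) {e : Fin k → α} {a : Fin m → α}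
    (hea : List.ofFn e = List.ofFn a) (i : Fin m) : e (Fin.cast h.symm i) = a i := by
  subst h
  exact congrFun (List.ofFn_injective hea) i

/-- The decreasing list of eigenvalues is determined by the characteristic polynomial. -/
theorem eigenvalues₀_eq_iff {m : ℕ} {Y : Matrix (Fin m) (Fin m) ℂ} (hY : Y.IsHermitian)
    {a : Fin m → ℝ} (ha : Antitone a) :
    (∀ i, hY.eigenvalues₀ (Fin.cast (Fintype.card_fin m).symm i) = a i) ↔
      Y.charpoly = (∏ i, (X - C (a i))).map Complex.ofRealHom := by
  constructor
  · intro h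
    have h1 : ∀ k, hY.eigenvalues₀ k = a (Fin.cast (Fintype.card_fin m) k) := fun k => h (Fin.cast (Fintype.card_fin m) k)
    rw [hY.charpoly_eq, Polynomial.map_prod]
    simp only [Matrix.IsHermitian.eigenvalues, h1]
    have h2 := Equiv.prod_comp ((Fintype.equivOfCardEq (Fintype.card_fin
      (Fintype.card (Fin m)))).symm.trans (finCongr (Fintype.card_fin m)))
      (fun i => (X - C (a i : ℂ)))
    simpa using h2
  · intro h
    refine eq_of_ofFn_eq (Fintype.card_fin m) ?_
    have hroots : Y.charpoly.roots = Multiset.map (fun i => (a i : ℂ)) Finset.univ.val := by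
      rw [h, Polynomial.map_prod]
      simp only [Polynomial.map_sub, map_X, map_C, Complex.ofRealHom_eq_coe]
      exact roots_multiset_prod_X_sub_C (Finset.univ.val.map fun i => (a i : ℂ)) ▸ by
        rw [Multiset.map_map]; rfl
    rw [← hY.sort_roots_charpoly_eq_eigenvalues₀, hroots]
    simp only [Fin.univ_val_map, Multiset.map_coe, List.map_ofFn, Function.comp_def,
      RCLike.re_to_complex, Complex.ofReal_re, Multiset.coe_sort]
    apply List.mergeSort_of_pairwise
    simp_rw [decide_eq_true_eq, ← List.sortedGE_iff_pairwise]
    exact ha.sortedGE_ofFn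

theorem finrank_eigSpace_of_charpoly_eq {m : ℕ} {Y : Matrix (Fin m) (Fin m) ℂ}
    (hY : Y.IsHermitian) {a : Fin m → ℝ}
    (h : Y.charpoly = (∏ i, (X - C (a i))).map Complex.ofRealHom) (c : ℝ) :
    Module.finrank ℂ (eigSpace Y c) = (Finset.univ.filter fun i => a i = c).card := by
  have hroots : Y.charpoly.roots = Multiset.map (fun i => (a i : ℂ)) Finset.univ.val := by
    rw [h, Polynomial.map_prod]
    simp only [Polynomial.map_sub, map_X, map_C, Complex.ofRealHom_eq_coe]
    exact roots_multiset_prod_X_sub_C (Finset.univ.val.map fun i => (a i : ℂ)) ▸ by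
      rw [Multiset.map_map]; rfl
  rw [finrank_eigSpace_eq_count hY, hroots, Multiset.count_map, Finset.card_def,
    Finset.filter_val]
  congr 1
  refine Multiset.filter_congr fun i _ => ?_
  simp [eq_comm]

variable {n : ℕ}

/-- The coordinates of `u` at level `m`, the prescribed eigenvalues of the `m × m` leading
submatrix. -/
def levelRow (u : GCIndex n → ℝ) (m : ℕ) (hm : m ≤ n) (i : Fin m) : ℝ :=
  u ⟨(i + 1, m - i), by have := i.2; dsimp only; omega⟩

variable {lam : Fin n → ℝ} {u : GCIndex n → ℝ}

theorem levelRow_le_castSucc (hu : u ∈ gcPolytope lam) {m : ℕ} (hm : m + 1 ≤ n) (i : Fin m) :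
    levelRow u m (Nat.le_of_succ_le hm) i ≤ levelRow u (m + 1) hm i.castSucc := by
  have h := (hu.2 (i + 1) (m - i) (by omega) (by omega) (by omega)).1
  refine h.trans_eq (congrArg u (Subtype.ext (Prod.ext rfl ?_)))
  have := i.2
  simp only [Fin.val_castSucc]; omega

theorem levelRow_succ_le (hu : u ∈ gcPolytope lam) {m : ℕ} (hm : m + 1 ≤ n) (i : Fin m) :
    levelRow u (m + 1) hm i.succ ≤ levelRow u m (Nat.le_of_succ_le hm) i := by
  have h := (hu.2 (i + 1) (m - i) (by omega) (by omega) (by omega)).2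
  refine Eq.trans_le (congrArg u (Subtype.ext (Prod.ext ?_ ?_))) h
  · simp
  · have := i.2
    simp only [Fin.val_succ]; omega

theorem levelRow_antitone (hu : u ∈ gcPolytope lam) (m : ℕ) (hm : m ≤ n) :
    Antitone (levelRow u m hm) := by
  cases m with
  | zero => exact fun i => i.elim0
  | succ m =>
    exact Fin.antitone_iff_succ_le.2 fun i =>
      (levelRow_succ_le hu hm i).trans (levelRow_le_castSucc hu hm i)

theorem levelRow_self (hu : u ∈ gcPolytope lam) : levelRow u n le_rfl = lam :=
  funext fun i => hu.1 i

theorem eigenvalues₀_leading_congr {y : Matrix (Fin n) (Fin n) ℂ} (hy : y.IsHermitian) {m m' : ℕ}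
    (h : m = m') (hm : m ≤ n) (hm' : m' ≤ n) (i : Fin (Fintype.card (Fin m)))
    (i' : Fin (Fintype.card (Fin m'))) (hi : (i : ℕ) = i') :
    (isHermitian_leading hy m hm).eigenvalues₀ i =
      (isHermitian_leading hy m' hm').eigenvalues₀ i' := by
  subst h
  rw [Fin.ext hi]

/-- The condition on the full matrix already places `y` in the orbit, since the top row of `u` is
`lam` and Hermitian matrices with equal characteristic polynomials are unitarily conjugate. -/
theorem mem_gcFiber_iff (hu : u ∈ gcPolytope lam) (y : Matrix (Fin n) (Fin n) ℂ) :
    y ∈ gcFiber lam u ↔ y.IsHermitian ∧ ∀ (m : ℕ) (hm : m ≤ n), (leading y m hm).charpoly =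
      (∏ i, (X - C (levelRow u m hm i))).map Complex.ofRealHom := by
  constructor
  · rintro ⟨⟨y, hy⟩, hyu, rfl⟩
    have hyH := isHermitian_of_mem_orbit hy
    refine ⟨hyH, fun m hm => (eigenvalues₀_eq_iff (isHermitian_leading hyH m hm)
      (levelRow_antitone hu m hm)).1 fun i => ?_⟩
    have h1 := congrFun (Set.mem_singleton_iff.1 hyu) ⟨(i + 1, m - i), by
      have := i.2; dsimp only; omega⟩
    rw [levelRow, ← h1]
    exact eigenvalues₀_leading_congr hyH (by dsimp only; omega) _ _ _ _ (by simp)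
  · rintro ⟨hyH, h⟩
    have hyo : y ∈ orbit lam := by
      have h1 := h n le_rfl
      rw [levelRow_self hu, ← charpoly_diagonal_ofReal] at h1
      exact exists_unitary_conj_of_charpoly_eq hyH (isHermitian_diagonal_ofReal lam) h1
    refine ⟨⟨y, hyo⟩, ?_, rfl⟩
    rw [Set.mem_preimage, Set.mem_singleton_iff]
    funext p
    obtain ⟨⟨i, j⟩, hi, hj, hij⟩ := p
    dsimp only at hi hj hij
    have h2 := (eigenvalues₀_eq_iff (isHermitian_leading hyH (i + j - 1) (by omega))
      (levelRow_antitone hu (i + j - 1) (by omega))).2 (h _ _) ⟨i - 1, by omega⟩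
    refine Eq.trans h2 (congrArg u (Subtype.ext (Prod.ext ?_ ?_)))
    · dsimp only; omega
    · dsimp only; omega

theorem exists_charpoly_leading_eq (hu : u ∈ gcPolytope lam) (m : ℕ) (hm : m ≤ n) :
    ∃ Y : Matrix (Fin m) (Fin m) ℂ, Y.IsHermitian ∧ ∀ (l : ℕ) (hl : l ≤ m),
      (leading Y l hl).charpoly =
        (∏ i, (X - C (levelRow u l (hl.trans hm) i))).map Complex.ofRealHom := by
  induction m with
  | zero =>
    refine ⟨0, Matrix.isHermitian_zero, fun l hl => ?_⟩
    obtain rfl := Nat.le_zero.1 hl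
    simp
  | succ m ih =>
    obtain ⟨Y, hY, h⟩ := ih (Nat.le_of_succ_le hm)
    obtain ⟨b, d, hbd⟩ := exists_border_charpoly hY (levelRow_antitone hu m (Nat.le_of_succ_le hm))
      (levelRow_le_castSucc hu hm) (levelRow_succ_le hu hm) (h m le_rfl)
    refine ⟨border Y b d, isHermitian_border hY b d, fun l hl => ?_⟩
    rcases Nat.lt_or_ge m l with hlm | hlm
    · obtain rfl : l = m + 1 := by omega
      exact hbd
    · have h1 : leading (border Y b d) l hl = leading Y l hlm := by
        conv_rhs => rw [← corner_border Y b d]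
        rfl
      rw [h1]
      exact h l hlm

/-- The fibers over the polytope are nonempty isospectral sets. -/
theorem exists_gcFiber_eq_isospectralSet (hu : u ∈ gcPolytope lam) :
    ∃ x : Matrix (Fin n) (Fin n) ℂ, x.IsHermitian ∧ gcFiber lam u = isospectralSet x ∧
      ∀ (m : ℕ) (hm : m ≤ n), (leading x m hm).charpoly =
        (∏ i, (X - C (levelRow u m hm i))).map Complex.ofRealHom := by
  obtain ⟨x, hx, h⟩ := exists_charpoly_leading_eq hu n le_rfl
  refine ⟨x, hx, ?_, h⟩
  ext y
  rw [mem_gcFiber_iff hu]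
  exact and_congr_right fun _ => forall₂_congr fun m hm => by rw [h m hm]

theorem isLagrangian_gcFiber_iff (hu : u ∈ gcPolytope lam) :
    IsLagrangian lam (gcFiber lam u) ↔ ¬ ∃ (j : Fin n) (c : ℝ),
      (Finset.univ.filter fun i => levelRow u j j.2.le i = c).card ≠ 0 ∧
      (Finset.univ.filter fun i => levelRow u (j + 1) j.2 i = c).card =
        (Finset.univ.filter fun i => levelRow u j j.2.le i = c).card := by
  obtain ⟨x, hx, hfib, h⟩ := exists_gcFiber_eq_isospectralSet hu
  have h1 : HasStableEigenvalue x ↔ ∃ (j : Fin n) (c : ℝ),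
      (Finset.univ.filter fun i => levelRow u j j.2.le i = c).card ≠ 0 ∧
      (Finset.univ.filter fun i => levelRow u (j + 1) j.2 i = c).card =
        (Finset.univ.filter fun i => levelRow u j j.2.le i = c).card := by
    refine exists_congr fun j => exists_congr fun c => ?_
    rw [finrank_eigSpace_of_charpoly_eq (isHermitian_leading hx _ _) (h _ _),
      finrank_eigSpace_of_charpoly_eq (isHermitian_leading hx _ _) (h _ _)]
  rw [← h1, hfib]
  refine ⟨not_hasStableEigenvalue_of_isLagrangian hx, isLagrangian_isospectralSet hx ?_⟩
  rw [← hfib]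
  rintro _ ⟨y, -, rfl⟩
  exact y.2

end Fiber
end GelfandCetlin
end

noncomputable section
namespace GelfandCetlin

/-! ### Triangular arrays of interlacing numbers -/

section Interlacing

/-- The rows `a m 1, …, a m m` for `m ≤ n` interlace. -/
structure IsInterlacing (n : ℕ) (a : ℕ → ℕ → ℝ) : Prop where
  le_succ : ∀ m i, 1 ≤ i → i ≤ m → m < n → a m i ≤ a (m + 1) i
  succ_le : ∀ m i, 1 ≤ i → i ≤ m → m < n → a (m + 1) (i + 1) ≤ a m i

/-- The number of entries of the `m`-th row that equal `c`. -/
def rowMult (a : ℕ → ℕ → ℝ) (m : ℕ) (c : ℝ) : ℕ :=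
  ((Finset.Icc 1 m).filter fun x => a m x = c).card

/-- The entries of the `m`-th row that equal `c` are those at the positions `s, …, t`. -/
structure IsRowInterval (a : ℕ → ℕ → ℝ) (m : ℕ) (c : ℝ) (s t : ℕ) : Prop where
  one_le : 1 ≤ s
  le : s ≤ t
  le_row : t ≤ m
  eq_iff : ∀ x, 1 ≤ x → x ≤ m → (a m x = c ↔ s ≤ x ∧ x ≤ t)

/-- The interval of equal entries at the positions `S, …, T` of the `M`-th row shrinks in the next
row. -/
structure IsPeak (n : ℕ) (a : ℕ → ℕ → ℝ) (M S T : ℕ) (c : ℝ) : Prop where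
  one_le : 1 ≤ S
  le : S ≤ T
  le_row : T ≤ M
  lt : M < n
  eq : ∀ x, S ≤ x → x ≤ T → a M x = c
  lt_left : c < a (M + 1) S
  lt_right : a (M + 1) (T + 1) < c

variable {n : ℕ} {a : ℕ → ℕ → ℝ}

theorem IsInterlacing.antitone (ha : IsInterlacing n a) {m i i' : ℕ} (hi : 1 ≤ i) (hii : i ≤ i')
    (hm : i' ≤ m) (hn : m ≤ n) : a m i' ≤ a m i := by
  induction i', hii using Nat.le_induction with
  | base => exact le_rfl
  | succ k hk ih =>
    obtain ⟨m, rfl⟩ : ∃ m', m = m' + 1 := ⟨m - 1, by omega⟩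
    exact ((ha.succ_le m k (by omega) (by omega) (by omega)).trans
      (ha.le_succ m k (by omega) (by omega) (by omega))).trans (ih (by omega))

/-- Each entry is squeezed between two neighbours in the next row, so a constant stretch forces the
whole triangle below it to be constant. In the diagram this triangle is bounded by the L-block with
corner box `(S, M + 1 - T)`. -/
theorem IsInterlacing.eq_of_add_le (ha : IsInterlacing n a) {M S T : ℕ} {c : ℝ} (hS : 1 ≤ S)
    (hT : T ≤ M) (hM : M ≤ n) (h : ∀ x, S ≤ x → x ≤ T → a M x = c) (d : ℕ) :
    ∀ m x, m + d = M → S ≤ x → x + d ≤ T → a m x = c := by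
  induction d with
  | zero =>
    rintro m x rfl hx hxT
    exact h x hx hxT
  | succ d ih =>
    intro m x hm hx hxT
    have h1 := ha.le_succ m x (by omega) (by omega) (by omega)
    have h2 := ha.succ_le m x (by omega) (by omega) (by omega)
    rw [ih (m + 1) x (by omega) hx (by omega)] at h1
    rw [ih (m + 1) (x + 1) (by omega) (by omega) (by omega)] at h2
    exact le_antisymm h1 h2

theorem IsInterlacing.exists_isRowInterval (ha : IsInterlacing n a) {m i : ℕ} (hi : 1 ≤ i)
    (him : i ≤ m) (hm : m ≤ n) : ∃ s t, IsRowInterval a m (a m i) s t ∧ s ≤ i ∧ i ≤ t := by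
  set F := (Finset.Icc 1 m).filter fun x => a m x = a m i with hF
  have hiF : i ∈ F := by simp [hF, hi, him]
  have hne : F.Nonempty := ⟨i, hiF⟩
  have h1 := F.min'_mem hne
  have h2 := F.max'_mem hne
  have hmem : ∀ y ∈ F, (1 ≤ y ∧ y ≤ m) ∧ a m y = a m i := fun y hy => by
    rwa [hF, Finset.mem_filter, Finset.mem_Icc] at hy
  replace h1 := hmem _ h1
  replace h2 := hmem _ h2
  refine ⟨F.min' hne, F.max' hne, ⟨h1.1.1, F.min'_le_max' hne, h2.1.2, fun x hx hxm => ⟨fun h => ?_,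
    fun h => ?_⟩⟩, F.min'_le i hiF, F.le_max' i hiF⟩
  · have hxF : x ∈ F := by simp [hF, hx, hxm, h]
    exact ⟨F.min'_le x hxF, F.le_max' x hxF⟩
  · exact le_antisymm ((ha.antitone h1.1.1 h.1 hxm hm).trans_eq h1.2)
      (h2.2.symm.trans_le (ha.antitone hx h.2 h2.1.2 hm))

namespace IsRowInterval

variable {m s t : ℕ} {c : ℝ}

theorem eq (h : IsRowInterval a m c s t) {x : ℕ} (h1 : s ≤ x) (h2 : x ≤ t) : a m x = c :=
  (h.eq_iff x (h.one_le.trans h1) (h2.trans h.le_row)).2 ⟨h1, h2⟩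

theorem rowMult_eq (h : IsRowInterval a m c s t) : rowMult a m c = t + 1 - s := by
  have : ((Finset.Icc 1 m).filter fun x => a m x = c) = Finset.Icc s t := by
    ext x
    rw [Finset.mem_filter, Finset.mem_Icc, Finset.mem_Icc]
    constructor
    · exact fun hx => (h.eq_iff x hx.1.1 hx.1.2).1 hx.2
    · exact fun hx => ⟨⟨h.one_le.trans hx.1, hx.2.trans h.le_row⟩, h.eq hx.1 hx.2⟩
  rw [rowMult, this, Nat.card_Icc]

/-- Positions strictly inside are squeezed to `c`, and positions outside are strictly separated from
`c`. Only the two ends `s` and `t + 1` are undecided, which gives the four transitions below. -/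
theorem succ_eq_iff (h : IsRowInterval a m c s t) (ha : IsInterlacing n a) (hm : m < n) {x : ℕ}
    (hx : 1 ≤ x) (hxm : x ≤ m + 1) : a (m + 1) x = c ↔ (s + 1 ≤ x ∧ x ≤ t) ∨
      (x = s ∧ a (m + 1) s = c) ∨ (x = t + 1 ∧ a (m + 1) (t + 1) = c) := by
  have h0 := h.one_le
  have h0' := h.le_row
  have h0'' := h.le
  have hlt : x < s → c < a (m + 1) x := fun hxs => by
    refine lt_of_lt_of_le (lt_of_le_of_ne ?_ fun h' => ?_) (ha.le_succ m x hx (by omega) hm)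
    · rw [← h.eq le_rfl h.le]
      exact ha.antitone hx hxs.le (by omega) hm.le
    · have := ((h.eq_iff x hx (by omega)).1 h'.symm).1
      omega
  have hgt : t + 1 < x → a (m + 1) x < c := fun hxt => by
    obtain ⟨x, rfl⟩ : ∃ x', x = x' + 1 := ⟨x - 1, by omega⟩
    refine lt_of_le_of_lt (ha.succ_le m x (by omega) (by omega) hm)
      (lt_of_le_of_ne ?_ fun h' => ?_)
    · rw [← h.eq h.le le_rfl]
      exact ha.antitone (by omega) (by omega) (by omega) hm.le
    · have := ((h.eq_iff x (by omega) (by omega)).1 h').2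
      omega
  have hmid : s + 1 ≤ x → x ≤ t → a (m + 1) x = c := fun h1 h2 => by
    obtain ⟨x, rfl⟩ : ∃ x', x = x' + 1 := ⟨x - 1, by omega⟩
    exact le_antisymm ((ha.succ_le m x (by omega) (by omega) hm).trans_eq (h.eq (by omega)
      (by omega))) ((h.eq (by omega) h2).symm.trans_le (ha.le_succ m _ hx (by omega) hm))
  constructor
  · intro hxc
    rcases lt_trichotomy x s with h1 | rfl | h1
    · exact absurd hxc (hlt h1).ne'
    · exact Or.inr (Or.inl ⟨rfl, hxc⟩)
    · rcases lt_trichotomy x (t + 1) with h2 | rfl | h2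
      · exact Or.inl ⟨h1, by omega⟩
      · exact Or.inr (Or.inr ⟨rfl, hxc⟩)
      · exact absurd hxc (hgt h2).ne
  · rintro (⟨h1, h2⟩ | ⟨rfl, h1⟩ | ⟨rfl, h1⟩)
    · exact hmid h1 h2
    · exact h1
    · exact h1

theorem expand (h : IsRowInterval a m c s t) (ha : IsInterlacing n a) (hm : m < n)
    (h1 : a (m + 1) s = c) (h2 : a (m + 1) (t + 1) = c) :
    IsRowInterval a (m + 1) c s (t + 1) := by
  have h0 := h.le
  refine ⟨h.one_le, by omega, by have := h.le_row; omega, fun x hx hxm => ?_⟩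
  rw [h.succ_eq_iff ha hm hx hxm]
  simp only [h1, h2, and_true]
  omega

theorem keep_left (h : IsRowInterval a m c s t) (ha : IsInterlacing n a) (hm : m < n)
    (h1 : a (m + 1) s = c) (h2 : a (m + 1) (t + 1) ≠ c) :
    IsRowInterval a (m + 1) c s t := by
  have h0 := h.le
  refine ⟨h.one_le, by omega, by have := h.le_row; omega, fun x hx hxm => ?_⟩
  rw [h.succ_eq_iff ha hm hx hxm]
  simp only [h1, h2, and_true, and_false, or_false]
  omega

theorem keep_right (h : IsRowInterval a m c s t) (ha : IsInterlacing n a) (hm : m < n)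
    (h1 : a (m + 1) s ≠ c) (h2 : a (m + 1) (t + 1) = c) :
    IsRowInterval a (m + 1) c (s + 1) (t + 1) := by
  have h0 := h.le
  refine ⟨by omega, by omega, by have := h.le_row; omega, fun x hx hxm => ?_⟩
  rw [h.succ_eq_iff ha hm hx hxm]
  simp only [h1, h2, and_true, and_false, false_or]
  omega

theorem shrink (h : IsRowInterval a m c s t) (ha : IsInterlacing n a) (hm : m < n)
    (h1 : a (m + 1) s ≠ c) (h2 : a (m + 1) (t + 1) ≠ c) (hst : s < t) :
    IsRowInterval a (m + 1) c (s + 1) t := by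
  refine ⟨by omega, by omega, by have := h.le_row; omega, fun x hx hxm => ?_⟩
  rw [h.succ_eq_iff ha hm hx hxm]
  simp only [h1, h2, and_false, or_false]

theorem rowMult_succ_of_shrink (h : IsRowInterval a m c s t) (ha : IsInterlacing n a) (hm : m < n)
    (h1 : a (m + 1) s ≠ c) (h2 : a (m + 1) (t + 1) ≠ c) : rowMult a (m + 1) c = t - s := by
  rcases h.le.lt_or_eq with hst | rfl
  · rw [(h.shrink ha hm h1 h2 hst).rowMult_eq]; omega
  · rw [rowMult, Nat.sub_self, Finset.card_eq_zero, Finset.filter_eq_empty_iff]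
    intro x hx
    rw [Finset.mem_Icc] at hx
    rw [h.succ_eq_iff ha hm hx.1 hx.2]
    simp only [h1, h2, and_false, or_false]
    omega

theorem isPeak (h : IsRowInterval a m c s t) (ha : IsInterlacing n a) (hm : m < n)
    (h1 : a (m + 1) s ≠ c) (h2 : a (m + 1) (t + 1) ≠ c) : IsPeak n a m s t c := by
  have e1 := ha.le_succ m s h.one_le (h.le.trans h.le_row) hm
  have e2 := ha.succ_le m t (h.one_le.trans h.le) h.le_row hm
  rw [h.eq le_rfl h.le] at e1
  rw [h.eq h.le le_rfl] at e2
  exact ⟨h.one_le, h.le, h.le_row, hm, fun x => h.eq, lt_of_le_of_ne e1 h1.symm,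
    lt_of_le_of_ne e2 h2⟩

end IsRowInterval

theorem IsPeak.isRowInterval {M S T : ℕ} {c : ℝ} (h : IsPeak n a M S T c)
    (ha : IsInterlacing n a) : IsRowInterval a M c S T := by
  have h0 := h.one_le
  have h0' := h.le_row
  have h0'' := h.le
  have hlt := h.lt
  refine ⟨h.one_le, h.le, h.le_row, fun x hx hxM => ⟨fun hxc => ?_, fun hx' => h.eq x hx'.1 hx'.2⟩⟩
  by_contra hcon
  rcases Nat.lt_or_ge x S with hxS | hxS
  · obtain ⟨S', rfl⟩ : ∃ S', S = S' + 1 := ⟨S - 1, by omega⟩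
    have := ha.succ_le M S' (by omega) (by omega) hlt
    have := ha.antitone hx (show x ≤ S' by omega) (by omega) hlt.le
    have := h.lt_left
    linarith
  · have hxT : T + 1 ≤ x := by omega
    have := ha.le_succ M (T + 1) (by omega) (by omega) hlt
    have := ha.antitone (by omega) hxT hxM hlt.le
    have := h.lt_right
    linarith

/-- Without stable multiplicities every box in a position `Q` that excludes the corners of the last
row lies on the hook below a peak. -/
theorem exists_isPeak (ha : IsInterlacing n a)
    (hst : ∀ m < n, ∀ c, rowMult a m c ≠ 0 → rowMult a (m + 1) c ≠ rowMult a m c)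
    {Q : ℕ → ℕ → Prop}
    (hQ : ∀ s t c, IsRowInterval a n c s t → ∀ i j, s ≤ i → n + 1 ≤ j + t → ¬ Q i j)
    (k : ℕ) : ∀ m, m + k = n → ∀ s t d c, IsRowInterval a m c s t → s + 2 * d ≤ t →
      Q (s + d) (m + 1 + d - t) → ∃ M S T, m ≤ M ∧ IsPeak n a M S T c ∧ S = s + d ∧
        M + 1 - T = m + 1 + d - t := by
  -- The box `(s + d, m + 1 + d - t)` is the invariant of the climb: an expanding interval keeps
  -- `d`, a shrinking one lowers `d` by one. Shrinking at `d = 0` is a peak whose hook has its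
  -- corner at this box. The climb cannot reach row `n`, where `hQ` excludes the box.
  induction k with
  | zero =>
    rintro m rfl s t d c h hd hq
    have := h.le_row
    exact absurd hq (hQ s t c h _ _ (by omega) (by omega))
  | succ k ih =>
    intro m hmk s t d c h hd hq
    have hm : m < n := by omega
    have hle := h.le
    have hle' := h.le_row
    have hne := hst m hm c (by rw [h.rowMult_eq]; omega)
    rw [h.rowMult_eq] at hne
    by_cases h1 : a (m + 1) s = c <;> by_cases h2 : a (m + 1) (t + 1) = c
    · obtain ⟨M, S, T, e1, e2, e3, e4⟩ := ih (m + 1) (by omega) s (t + 1) d c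
        (h.expand ha hm h1 h2) (by omega) (by
          have : m + 1 + 1 + d - (t + 1) = m + 1 + d - t := by omega
          rwa [this])
      exact ⟨M, S, T, by omega, e2, e3, by omega⟩
    · exact absurd (h.keep_left ha hm h1 h2).rowMult_eq hne
    · exact absurd ((h.keep_right ha hm h1 h2).rowMult_eq.trans (by omega)) hne
    · rcases Nat.eq_zero_or_pos d with rfl | hdpos
      · exact ⟨m, s, t, le_rfl, h.isPeak ha hm h1 h2, rfl, by omega⟩
      · obtain ⟨d, rfl⟩ : ∃ d', d = d' + 1 := ⟨d - 1, by omega⟩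
        have e5 : s + (d + 1) = s + 1 + d := by omega
        have e6 : m + 1 + (d + 1) - t = m + 1 + 1 + d - t := by omega
        rw [e5, e6] at hq
        obtain ⟨M, S, T, e1, e2, e3, e4⟩ := ih (m + 1) (by omega) (s + 1) t d c
          (h.shrink ha hm h1 h2 (by omega)) (by omega) hq
        exact ⟨M, S, T, by omega, e2, by omega, by omega⟩

/-- The hooks below the peaks cover all boxes if and only if no multiplicity is stable. Here the
box in the `i`-th column and the `j`-th row of the diagram holds the `i`-th entry of the row
`i + j - 1` of the array. -/
theorem forall_exists_isPeak_iff (ha : IsInterlacing n a) {Q : ℕ → ℕ → Prop}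
    (hQdown : ∀ i j i' j', Q i j → i' ≤ i → j' ≤ j → Q i' j')
    (hQ : ∀ s t c, IsRowInterval a n c s t → ∀ i j, s ≤ i → n + 1 ≤ j + t → ¬ Q i j)
    (hQn : ∀ i j, 1 ≤ i → 1 ≤ j → Q i j → i + j ≤ n)
    (hQl : ∀ m i, 1 ≤ i → i ≤ m → m < n → a m i ≠ a (m + 1) i → Q i (m + 1 - i))
    (hQr : ∀ m i, 1 ≤ i → i ≤ m → m < n → a (m + 1) (i + 1) ≠ a m i → Q i (m + 1 - i)) :
    (∀ i j, 1 ≤ i → 1 ≤ j → Q i j → ∃ M S T c, IsPeak n a M S T c ∧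
      ((i = S ∧ M + 1 ≤ j + T ∧ j + S ≤ M + 1) ∨ (j + T = M + 1 ∧ S ≤ i ∧ i ≤ T))) ↔
    ¬ ∃ m < n, ∃ c, rowMult a m c ≠ 0 ∧ rowMult a (m + 1) c = rowMult a m c := by
  constructor
  · rintro hcov ⟨m, hm, c, hc, hst⟩
    obtain ⟨x, hx⟩ := Finset.card_ne_zero.1 hc
    rw [Finset.mem_filter, Finset.mem_Icc] at hx
    obtain ⟨⟨hx1, hxm⟩, rfl⟩ := hx
    obtain ⟨s, t, h, hsx, hxt⟩ := ha.exists_isRowInterval hx1 hxm hm.le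
    have h0 := h.one_le
    have h1 := h.le
    have h2 := h.le_row
    -- The hook covering the box belongs to a peak in some row `M ≥ m`. If `M > m`, both upper
    -- neighbours of the box lie in the constant triangle of the peak, against the assumed jump. So
    -- `M = m`, and the interval itself is the peak.
    have key : ∀ i, s ≤ i → i ≤ t → Q i (m + 1 - i) →
        (a (m + 1) i ≠ a m x ∨ a (m + 1) (i + 1) ≠ a m x) → IsPeak n a m s t (a m x) := by
      intro i hi1 hi2 hq hne
      obtain ⟨M, S, T, c', hp, hcase⟩ := hcov i (m + 1 - i) (by omega) (by omega) hq
      have p0 := hp.one_le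
      have p1 := hp.le
      have p2 := hp.le_row
      have p3 := hp.lt
      have tri : ∀ m' y, m' ≤ M → S ≤ y → y + M ≤ T + m' → a m' y = c' := fun m' y e1 e2 e3 =>
        ha.eq_of_add_le p0 p2 p3.le hp.eq (M - m') m' y (by omega) e2 (by omega)
      have hc' : c' = a m x := by
        rw [← h.eq hi1 hi2]
        exact (tri m i (by omega) (by omega) (by omega)).symm
      subst hc'
      rcases (show m ≤ M by omega).eq_or_lt with rfl | hlt
      · have e := hp.isRowInterval ha
        have e1 := (h.eq_iff S (by omega) (by omega)).1 (hp.eq S le_rfl p1)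
        have e2 := (h.eq_iff T (by omega) (by omega)).1 (hp.eq T p1 le_rfl)
        have e3 := (e.eq_iff s (by omega) (by omega)).1 (h.eq le_rfl h1)
        have e4 := (e.eq_iff t (by omega) (by omega)).1 (h.eq h1 le_rfl)
        obtain rfl : S = s := by omega
        obtain rfl : T = t := by omega
        exact hp
      · rcases hne with hne | hne
        · exact absurd (tri (m + 1) i (by omega) (by omega) (by omega)) hne
        · exact absurd (tri (m + 1) (i + 1) (by omega) (by omega) (by omega)) hne
    have hpeak : IsPeak n a m s t (a m x) := by
      -- Expansion contradicts stability. If exactly one end survives, the box at the other end has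
      -- a jump next to it, so it belongs to `Q` and `key` applies. A peak contradicts stability as
      -- well.
      by_cases e1 : a (m + 1) s = a m x <;> by_cases e2 : a (m + 1) (t + 1) = a m x
      · rw [h.rowMult_eq, (h.expand ha hm e1 e2).rowMult_eq] at hst
        omega
      · refine key t h1 le_rfl (hQr m t (by omega) h2 hm ?_) (Or.inr e2)
        rwa [h.eq h1 le_rfl]
      · refine key s le_rfl h1 (hQl m s (by omega) (by omega) hm ?_) (Or.inl e1)
        rw [h.eq le_rfl h1]
        exact Ne.symm e1
      · exact h.isPeak ha hm e1 e2
    rw [h.rowMult_eq, h.rowMult_succ_of_shrink ha hm hpeak.lt_left.ne' hpeak.lt_right.ne] at hst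
    omega
  · intro hst i j hi hj hq
    have hst' : ∀ m < n, ∀ c, rowMult a m c ≠ 0 → rowMult a (m + 1) c ≠ rowMult a m c :=
      fun m hm c h1 h2 => hst ⟨m, hm, c, h1, h2⟩
    have hij := hQn i j hi hj hq
    obtain ⟨m, rfl⟩ : ∃ m, j = m + 1 - i := ⟨i + j - 1, by omega⟩
    obtain ⟨s, t, h, hsi, hit⟩ := ha.exists_isRowInterval hi (show i ≤ m by omega)
      (show m ≤ n by omega)
    have h0 := h.le_row
    have h1 := h.one_le
    -- With this `d` the invariant box is the corner of the hook that has the given box on one of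
    -- its arms: the vertical arm if the minimum is `i - s`, the horizontal one otherwise.
    set d := min (i - s) (t - i) with hd
    obtain ⟨M, S, T, e1, e2, e3, e4⟩ := exists_isPeak ha hst' hQ (n - m) m (by omega) s t d _ h
      (by omega) (hQdown _ _ _ _ hq (by omega) (by omega))
    have p1 := e2.le
    have p2 := e2.le_row
    refine ⟨M, S, T, _, e2, ?_⟩
    rcases le_total (i - s) (t - i) with h2 | h2
    · rw [min_eq_left h2] at hd
      exact Or.inl ⟨by omega, by omega, by omega⟩
    · rw [min_eq_right h2] at hd
      exact Or.inr ⟨by omega, by omega, by omega⟩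

end Interlacing
end GelfandCetlin
end

noncomputable section
namespace GelfandCetlin

/-! ### Positive paths in the ladder diagram -/

section Ladder

namespace IsEigenvaluePattern

variable {n r : ℕ} {N : ℕ → ℕ} {lam : Fin n → ℝ}

theorem mono (h : IsEigenvaluePattern r N lam) {l l' : ℕ} (hl : l ≤ l') (hr : l' ≤ r + 1) :
    N l ≤ N l' := by
  induction l', hl using Nat.le_induction with
  | base => exact le_rfl
  | succ k hk ih => exact (ih (by omega)).trans (h.lt k (by omega)).le

theorem strictMono (h : IsEigenvaluePattern r N lam) {l l' : ℕ} (hl : l < l') (hr : l' ≤ r + 1) :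
    N l < N l' :=
  (h.lt l (by omega)).trans_le (h.mono hl hr)

/-- The rectangles may be extended to the left down to abscissa `0` without changing their union, as
the least admissible `l` shows. In this form the vertex set is visibly closed under decreasing
either coordinate. -/
theorem mem_ladderVerts_iff (h : IsEigenvaluePattern r N lam) (v : ℤ × ℤ) :
    v ∈ ladderVerts n r N ↔ 0 ≤ v.1 ∧ 0 ≤ v.2 ∧
      ∃ l, 1 ≤ l ∧ l ≤ r + 1 ∧ v.1 ≤ N l ∧ v.2 + N l ≤ n := by
  constructor
  · rintro ⟨j, hj, h1, h2, h3, h4⟩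
    exact ⟨le_trans (by positivity) h1, h3, j + 1, by omega, by omega, h2, by omega⟩
  · rintro ⟨h1, h2, hl⟩
    classical
    have hs := Nat.find_spec hl
    set l := Nat.find hl with hldef
    obtain ⟨j, hj⟩ : ∃ j, l = j + 1 := ⟨l - 1, by omega⟩
    rw [hj] at hs
    refine ⟨j, by omega, ?_, hs.2.2.1, h2, by omega⟩
    by_contra hcon
    push Not at hcon
    rcases Nat.eq_zero_or_pos j with rfl | hj0
    · rw [h.zero] at hcon; exact absurd h1 (by exact_mod_cast hcon.not_ge)
    · have hm : N j ≤ N (j + 1) := h.mono (by omega) (by omega)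
      exact Nat.find_min hl (show j < Nat.find hl by omega)
        ⟨hj0, by omega, hcon.le, by have := hs.2.2.2; omega⟩

theorem mem_topVerts_iff (h : IsEigenvaluePattern r N lam) (v : ℤ × ℤ) :
    v ∈ topVerts n r N ↔ ∃ l, 1 ≤ l ∧ l ≤ r + 1 ∧ v = ((N l : ℤ), (n : ℤ) - N l) := by
  refine (and_congr_left' (h.mem_ladderVerts_iff v)).trans ?_
  constructor
  · rintro ⟨⟨h1, h2, l, hl1, hl2, h3, h4⟩, h5⟩
    exact ⟨l, hl1, hl2, Prod.ext (by dsimp only; omega) (by dsimp only; omega)⟩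
  · rintro ⟨l, hl1, hl2, rfl⟩
    have h1 : N l ≤ N (r + 1) := h.mono hl2 le_rfl
    rw [h.last] at h1
    exact ⟨⟨by dsimp only; omega, by dsimp only; omega, l, hl1, hl2, le_rfl, by dsimp only; omega⟩,
      by dsimp only; omega⟩

theorem mem_ladderVerts_of_le (h : IsEigenvaluePattern r N lam) {v w : ℤ × ℤ}
    (hw : w ∈ ladderVerts n r N) (h1 : 0 ≤ v.1) (h2 : 0 ≤ v.2) (h3 : v.1 ≤ w.1) (h4 : v.2 ≤ w.2) :
    v ∈ ladderVerts n r N := by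
  rw [h.mem_ladderVerts_iff] at hw ⊢
  obtain ⟨-, -, l, hl1, hl2, h5, h6⟩ := hw
  exact ⟨h1, h2, l, hl1, hl2, by omega, by omega⟩

theorem exists_walk (h : IsEigenvaluePattern r N lam) (k : ℕ) : ∀ v ∈ ladderVerts n r N,
    v.1 + v.2 = k → ∃ p : (ladderDiagram n r N).Walk (0, 0) v, p.length = k := by
  induction k with
  | zero =>
    intro v hv hk
    obtain ⟨h1, h2, -⟩ := (h.mem_ladderVerts_iff v).1 hv
    obtain rfl : v = (0, 0) := Prod.ext (by dsimp only; omega) (by dsimp only; omega)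
    exact ⟨SimpleGraph.Walk.nil, rfl⟩
  | succ k ih =>
    intro v hv hk
    obtain ⟨h1, h2, -⟩ := (h.mem_ladderVerts_iff v).1 hv
    obtain ⟨w, hw1, hw2, hw⟩ : ∃ w ∈ ladderVerts n r N, w.1 + w.2 = k ∧
        |w.1 - v.1| + |w.2 - v.2| = 1 := by
      rcases h1.eq_or_lt with h3 | h3
      · exact ⟨(v.1, v.2 - 1), h.mem_ladderVerts_of_le hv h1 (by dsimp only; omega) le_rfl
          (by dsimp only; omega), by dsimp only; omega, by simp⟩
      · exact ⟨(v.1 - 1, v.2), h.mem_ladderVerts_of_le hv (by dsimp only; omega) h2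
          (by dsimp only; omega) le_rfl, by dsimp only; omega, by simp⟩
    obtain ⟨p, hp⟩ := ih w hw1 hw2
    exact ⟨p.concat (show (ladderDiagram n r N).Adj w v from ⟨hw1, hv, hw⟩), by
      rw [SimpleGraph.Walk.length_concat, hp]⟩

end IsEigenvaluePattern

variable {n r : ℕ} {N : ℕ → ℕ} {lam : Fin n → ℝ}

/-- The subgraph `δ` is traced by the monotone lattice path through the points
`(ξ m, m - ξ m)`, `m ≤ n`. -/
structure IsAbscissa (δ : (ladderDiagram n r N).Subgraph) (ξ : ℕ → ℤ) : Prop where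
  step : ∀ m < n, ξ (m + 1) = ξ m ∨ ξ (m + 1) = ξ m + 1
  exists_of_mem : ∀ v ∈ δ.verts, ∃ m ≤ n, v = (ξ m, m - ξ m)
  adj_iff : ∀ v w, v.1 + v.2 + 1 = w.1 + w.2 → (δ.Adj v w ↔
    ∃ m < n, v = (ξ m, m - ξ m) ∧ w = (ξ (m + 1), (m + 1 : ℕ) - ξ (m + 1)))

/-- The coordinate sum grows by at most one per edge and has to reach `n`, while monotone walks show
that the distance is at most `n`. So a shortest path increases the sum at every step and its `m`-th
vertex lies on the antidiagonal of level `m`. -/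
theorem IsPositivePath.exists_isAbscissa (h : IsEigenvaluePattern r N lam)
    {δ : (ladderDiagram n r N).Subgraph} (hδ : IsPositivePath n r N δ) :
    ∃ ξ l, IsAbscissa δ ξ ∧ 1 ≤ l ∧ l ≤ r + 1 ∧ ξ n = N l := by
  obtain ⟨v, hv, p, hp, rfl⟩ := hδ
  have hadj : ∀ m < p.length, (ladderDiagram n r N).Adj (p.getVert m) (p.getVert (m + 1)) :=
    fun m hm => p.adj_getVert_succ hm
  set f : ℕ → ℤ := fun m => (p.getVert m).1 + (p.getVert m).2 with hf
  have hstep : ∀ m < p.length, f (m + 1) ≤ f m + 1 := fun m hm => by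
    have h1 := (hadj m hm).2.2
    have h2 := abs_le.1 (abs_add_le ((p.getVert m).1 - (p.getVert (m + 1)).1)
      ((p.getVert m).2 - (p.getVert (m + 1)).2) |>.trans_eq h1)
    simp only [hf]
    linarith [h2.1]
  have h0 : f 0 = 0 := by simp [hf]
  have hend : f p.length = n := by simp [hf, hv.2]
  have hle : ∀ m ≤ p.length, f m ≤ m := by
    intro m
    induction m with
    | zero => intro _; rw [h0]; rfl
    | succ m ih => intro hm; have := hstep m hm; have := ih (by omega); push_cast; omega
  have hge : ∀ k ≤ p.length, (n : ℤ) - k ≤ f (p.length - k) := by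
    intro k
    induction k with
    | zero => intro _; simp [hend]
    | succ k ih =>
      intro hk
      have h1 := hstep (p.length - (k + 1)) (by omega)
      have h2 : p.length - (k + 1) + 1 = p.length - k := by omega
      rw [h2] at h1
      have := ih (by omega)
      push_cast
      omega
  have hlen : p.length = n := by
    refine le_antisymm ?_ (by have := hle _ le_rfl; rw [hend] at this; exact_mod_cast this)
    obtain ⟨q, hq⟩ := h.exists_walk n v hv.1 hv.2
    exact hp.trans_le ((SimpleGraph.dist_le q).trans_eq hq)
  have hfm : ∀ m ≤ n, f m = m := fun m hm => by
    have h1 := hle m (by omega)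
    have h2 := hge (n - m) (by omega)
    rw [hlen, Nat.sub_sub_self hm] at h2
    omega
  have hvert : ∀ m ≤ n, p.getVert m = ((p.getVert m).1, (m : ℤ) - (p.getVert m).1) := fun m hm =>
    Prod.ext rfl (by have := hfm m hm; simp only [hf] at this; dsimp only; omega)
  obtain ⟨l, hl1, hl2, hl⟩ := (h.mem_topVerts_iff v).1 hv
  refine ⟨fun m => (p.getVert m).1, l, ⟨fun m hm => ?_, fun w hw => ?_, fun w w' hww => ?_⟩,
    hl1, hl2, ?_⟩
  · have h1 := (hadj m (by omega)).2.2
    have h2 := hfm m hm.le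
    have h3 := hfm (m + 1) hm
    simp only [hf] at h2 h3
    push_cast at h3
    rcases abs_cases ((p.getVert m).1 - (p.getVert (m + 1)).1) with h4 | h4 <;>
    rcases abs_cases ((p.getVert m).2 - (p.getVert (m + 1)).2) with h5 | h5 <;> omega
  · rw [SimpleGraph.Walk.mem_verts_toSubgraph, SimpleGraph.Walk.mem_support_iff_exists_getVert] at hw
    obtain ⟨m, rfl, hm⟩ := hw
    exact ⟨m, by omega, hvert m (by omega)⟩
  · rw [SimpleGraph.Walk.toSubgraph_adj_iff]
    constructor
    · rintro ⟨m, hm, hml⟩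
      have e1 := hfm m (by omega)
      have e2 := hfm (m + 1) (by omega)
      rcases Sym2.eq_iff.1 hm with ⟨rfl, rfl⟩ | ⟨rfl, rfl⟩
      · exact ⟨m, by omega, hvert m (by omega), hvert (m + 1) (by omega)⟩
      · simp only [hf] at e1 e2
        push_cast at e2
        omega
    · rintro ⟨m, hm, hw, hw'⟩
      refine ⟨m, ?_, by omega⟩
      rw [hw, hw', ← hvert m hm.le, ← hvert (m + 1) hm]
  · have : p.getVert n = v := p.getVert_of_length_le hlen.le
    simp only [this, hl]

end Ladder
end GelfandCetlin
end

noncomputable section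
namespace GelfandCetlin

/-! ### Faces of the polytope -/

section Faces

variable {n r : ℕ} {N : ℕ → ℕ} {lam : Fin n → ℝ}

/-- The value of `lam` on its `k`-th block. -/
def blockValue (N : ℕ → ℕ) (lam : Fin n → ℝ) (k : ℕ) : ℝ :=
  if h : N k < n then lam ⟨N k, h⟩ else 0

theorem IsEigenvaluePattern.lt_of_le (h : IsEigenvaluePattern r N lam) {k : ℕ} (hk : k ≤ r) :
    N k < n := by
  have := h.strictMono (Nat.lt_succ_of_le hk) le_rfl
  rwa [h.last] at this

theorem IsEigenvaluePattern.blockValue_lt (h : IsEigenvaluePattern r N lam) {k k' : ℕ}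
    (hk : k < k') (hk' : k' ≤ r) : blockValue N lam k' < blockValue N lam k := by
  rw [blockValue, blockValue, dif_pos (h.lt_of_le hk'), dif_pos (h.lt_of_le (hk.le.trans hk'))]
  exact h.lt_of_block k' (by omega) hk' _ _ (h.strictMono hk (by omega)) le_rfl

theorem IsEigenvaluePattern.blockValue_le (h : IsEigenvaluePattern r N lam) {k k' : ℕ}
    (hk : k ≤ k') (hk' : k' ≤ r) : blockValue N lam k' ≤ blockValue N lam k := by
  rcases hk.eq_or_lt with rfl | hk
  · exact le_rfl
  · exact (h.blockValue_lt hk hk').le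

theorem IsEigenvaluePattern.exists_block (h : IsEigenvaluePattern r N lam) (i : Fin n) :
    ∃ k ≤ r, N k ≤ i ∧ (i : ℕ) < N (k + 1) := by
  have key : ∀ k ≤ r + 1, (i : ℕ) < N k → ∃ k' ≤ r, N k' ≤ i ∧ (i : ℕ) < N (k' + 1) := by
    intro k
    induction k with
    | zero => intro _ h0; rw [h.zero] at h0; omega
    | succ k ih =>
      intro hk hi
      rcases Nat.lt_or_ge i (N k) with h1 | h1
      · exact ih (by omega) h1
      · exact ⟨k, by omega, h1, hi⟩
  exact key (r + 1) le_rfl (by rw [h.last]; exact i.2)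

/-- The number of paths in the family `ξ` that have passed the level `m` to the left of `i`. -/
def pathCount (r : ℕ) (ξ : ℕ → ℕ → ℤ) (m : ℕ) (i : ℤ) : ℕ :=
  ((Finset.Icc 1 r).filter fun l => ξ l m < i).card

theorem pathCount_le (r : ℕ) (ξ : ℕ → ℕ → ℤ) (m : ℕ) (i : ℤ) : pathCount r ξ m i ≤ r :=
  (Finset.card_filter_le _ _).trans (by simp)

theorem IsEigenvaluePattern.blockValue_pathCount (h : IsEigenvaluePattern r N lam)
    {ξ : ℕ → ℕ → ℤ} (hξ : ∀ l, 1 ≤ l → l ≤ r → ξ l n = N l) (i : Fin n) :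
    blockValue N lam (pathCount r ξ n ((i : ℕ) + 1 : ℕ)) = lam i := by
  obtain ⟨k, hk, h1, h2⟩ := h.exists_block i
  have hc : pathCount r ξ n ((i : ℕ) + 1 : ℕ) = k := by
    have : ((Finset.Icc 1 r).filter fun l => ξ l n < ((i : ℕ) + 1 : ℕ)) = Finset.Icc 1 k := by
      ext l
      rw [Finset.mem_filter, Finset.mem_Icc, Finset.mem_Icc]
      constructor
      · rintro ⟨⟨h3, h4⟩, h5⟩
        refine ⟨h3, ?_⟩
        rw [hξ l h3 h4] at h5
        by_contra hcon
        have : N (k + 1) ≤ N l := h.mono (by omega) (by omega)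
        omega
      · rintro ⟨h3, h4⟩
        have : N l ≤ N k := h.mono h4 (by omega)
        exact ⟨⟨h3, by omega⟩, by rw [hξ l h3 (by omega)]; omega⟩
    rw [pathCount, this, Nat.card_Icc, Nat.add_sub_cancel]
  rw [hc, blockValue, dif_pos (h.lt_of_le hk)]
  exact h.eq_of_block k hk _ _ le_rfl (h.lt k hk) h1 h2

/-- The point of the polytope defined by a family of lattice paths. -/
def pathPoint (r : ℕ) (N : ℕ → ℕ) (lam : Fin n → ℝ) (ξ : ℕ → ℕ → ℤ) : GCIndex n → ℝ :=
  fun p => blockValue N lam (pathCount r ξ (p.1.1 + p.1.2 - 1) p.1.1)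

variable {γ : (ladderDiagram n r N).Subgraph}

theorem IsAbscissa.horizontal_iff {δ : (ladderDiagram n r N).Subgraph} {ξ : ℕ → ℤ}
    (hξ : IsAbscissa δ ξ) {i j : ℕ} (hi : 1 ≤ i) (hij : i + j ≤ n) :
    δ.Adj ((i : ℤ) - 1, (j : ℤ)) ((i : ℤ), (j : ℤ)) ↔
      ξ (i + j - 1) = i - 1 ∧ ξ (i + j - 1 + 1) = i := by
  rw [hξ.adj_iff _ _ (by dsimp only; omega)]
  constructor
  · rintro ⟨m, hm, h1, h2⟩
    rw [Prod.mk.injEq] at h1 h2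
    obtain rfl : m = i + j - 1 := by omega
    exact ⟨h1.1.symm, h2.1.symm⟩
  · rintro ⟨h1, h2⟩
    refine ⟨i + j - 1, by omega, ?_, ?_⟩
    · rw [h1, Prod.mk.injEq]; exact ⟨rfl, by omega⟩
    · rw [h2, Prod.mk.injEq]; exact ⟨rfl, by omega⟩

theorem IsAbscissa.vertical_iff {δ : (ladderDiagram n r N).Subgraph} {ξ : ℕ → ℤ}
    (hξ : IsAbscissa δ ξ) {i j : ℕ} (hj : 1 ≤ j) (hij : i + j ≤ n) :
    δ.Adj ((i : ℤ), (j : ℤ) - 1) ((i : ℤ), (j : ℤ)) ↔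
      ξ (i + j - 1) = i ∧ ξ (i + j - 1 + 1) = i := by
  rw [hξ.adj_iff _ _ (by dsimp only; omega)]
  constructor
  · rintro ⟨m, hm, h1, h2⟩
    rw [Prod.mk.injEq] at h1 h2
    obtain rfl : m = i + j - 1 := by omega
    exact ⟨h1.1.symm, h2.1.symm⟩
  · rintro ⟨h1, h2⟩
    refine ⟨i + j - 1, by omega, ?_, ?_⟩
    · rw [h1, Prod.mk.injEq]; exact ⟨rfl, by omega⟩
    · rw [h2, Prod.mk.injEq]; exact ⟨rfl, by omega⟩

/-- A family of paths in `γ`, one for each top vertex with positive height. -/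
structure IsPathFamily (γ : (ladderDiagram n r N).Subgraph) (ξ : ℕ → ℕ → ℤ) : Prop where
  exists_isAbscissa : ∀ l, 1 ≤ l → l ≤ r → ∃ δ ≤ γ, IsAbscissa δ (ξ l)
  last : ∀ l, 1 ≤ l → l ≤ r → ξ l n = N l

theorem IsPathFamily.step {ξ : ℕ → ℕ → ℤ} (hξ : IsPathFamily γ ξ) {l m : ℕ} (h1 : 1 ≤ l)
    (h2 : l ≤ r) (hm : m < n) : ξ l (m + 1) = ξ l m ∨ ξ l (m + 1) = ξ l m + 1 := by
  obtain ⟨δ, -, hδ⟩ := hξ.exists_isAbscissa l h1 h2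
  exact hδ.step m hm

section PathCount

variable {ξ : ℕ → ℕ → ℤ} {m : ℕ} {i : ℤ}

theorem IsPathFamily.subset_horizontal (hξ : IsPathFamily γ ξ) (hm : m < n) :
    ((Finset.Icc 1 r).filter fun l => ξ l (m + 1) < i) ⊆
      (Finset.Icc 1 r).filter fun l => ξ l m < i := by
  intro l hl
  rw [Finset.mem_filter, Finset.mem_Icc] at hl ⊢
  exact ⟨hl.1, by rcases hξ.step hl.1.1 hl.1.2 hm with h | h <;> omega⟩

theorem IsPathFamily.subset_vertical (hξ : IsPathFamily γ ξ) (hm : m < n) :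
    ((Finset.Icc 1 r).filter fun l => ξ l m < i) ⊆
      (Finset.Icc 1 r).filter fun l => ξ l (m + 1) < i + 1 := by
  intro l hl
  rw [Finset.mem_filter, Finset.mem_Icc] at hl ⊢
  exact ⟨hl.1, by rcases hξ.step hl.1.1 hl.1.2 hm with h | h <;> omega⟩

theorem IsPathFamily.pathCount_horizontal_le (hξ : IsPathFamily γ ξ) (hm : m < n) :
    pathCount r ξ (m + 1) i ≤ pathCount r ξ m i :=
  Finset.card_le_card (hξ.subset_horizontal hm)

theorem IsPathFamily.pathCount_vertical_le (hξ : IsPathFamily γ ξ) (hm : m < n) :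
    pathCount r ξ m i ≤ pathCount r ξ (m + 1) (i + 1) :=
  Finset.card_le_card (hξ.subset_vertical hm)

theorem IsPathFamily.pathCount_horizontal_lt (hξ : IsPathFamily γ ξ) (hm : m < n) {l : ℕ}
    (h1 : 1 ≤ l) (h2 : l ≤ r) (h3 : ξ l m = i - 1) (h4 : ξ l (m + 1) = i) :
    pathCount r ξ (m + 1) i < pathCount r ξ m i := by
  refine Finset.card_lt_card ((Finset.ssubset_iff_of_subset (hξ.subset_horizontal hm)).2
    ⟨l, ?_, ?_⟩) <;> rw [Finset.mem_filter, Finset.mem_Icc]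
  · exact ⟨⟨h1, h2⟩, by omega⟩
  · omega

theorem IsPathFamily.pathCount_vertical_lt (hξ : IsPathFamily γ ξ) (hm : m < n) {l : ℕ}
    (h1 : 1 ≤ l) (h2 : l ≤ r) (h3 : ξ l m = i) (h4 : ξ l (m + 1) = i) :
    pathCount r ξ m i < pathCount r ξ (m + 1) (i + 1) := by
  refine Finset.card_lt_card ((Finset.ssubset_iff_of_subset (hξ.subset_vertical hm)).2
    ⟨l, ?_, ?_⟩) <;> rw [Finset.mem_filter, Finset.mem_Icc]
  · exact ⟨⟨h1, h2⟩, by omega⟩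
  · omega

theorem IsPathFamily.pathCount_horizontal_eq (hξ : IsPathFamily γ ξ) (hm : m < n)
    (h : ∀ l, 1 ≤ l → l ≤ r → ξ l m = i - 1 → ξ l (m + 1) ≠ i) :
    pathCount r ξ m i = pathCount r ξ (m + 1) i := by
  refine congrArg Finset.card ((hξ.subset_horizontal hm).antisymm fun l hl => ?_).symm
  rw [Finset.mem_filter, Finset.mem_Icc] at hl ⊢
  have := h l hl.1.1 hl.1.2
  exact ⟨hl.1, by rcases hξ.step hl.1.1 hl.1.2 hm with h | h <;> omega⟩

theorem IsPathFamily.pathCount_vertical_eq (hξ : IsPathFamily γ ξ) (hm : m < n)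
    (h : ∀ l, 1 ≤ l → l ≤ r → ξ l m = i → ξ l (m + 1) ≠ i) :
    pathCount r ξ m i = pathCount r ξ (m + 1) (i + 1) := by
  refine congrArg Finset.card ((hξ.subset_vertical hm).antisymm fun l hl => ?_)
  rw [Finset.mem_filter, Finset.mem_Icc] at hl ⊢
  have := h l hl.1.1 hl.1.2
  exact ⟨hl.1, by rcases hξ.step hl.1.1 hl.1.2 hm with h | h <;> omega⟩

end PathCount

section PathPoint

variable {ξ : ℕ → ℕ → ℤ}

theorem pathPoint_apply (i j : ℕ) (h : 1 ≤ i ∧ 1 ≤ j ∧ i + j ≤ n + 1) :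
    pathPoint r N lam ξ ⟨(i, j), h⟩ = blockValue N lam (pathCount r ξ (i + j - 1) i) := rfl

theorem pathPoint_top (i j : ℕ) (h : 1 ≤ i ∧ 1 ≤ j + 1 ∧ i + (j + 1) ≤ n + 1) :
    pathPoint r N lam ξ ⟨(i, j + 1), h⟩ =
      blockValue N lam (pathCount r ξ (i + j - 1 + 1) i) := by
  rw [pathPoint_apply]
  have : i + (j + 1) - 1 = i + j - 1 + 1 := by omega
  rw [this]

theorem pathPoint_right (i j : ℕ) (h : 1 ≤ i + 1 ∧ 1 ≤ j ∧ i + 1 + j ≤ n + 1) :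
    pathPoint r N lam ξ ⟨(i + 1, j), h⟩ =
      blockValue N lam (pathCount r ξ (i + j - 1 + 1) ((i : ℤ) + 1)) := by
  rw [pathPoint_apply]
  have : i + 1 + j - 1 = i + j - 1 + 1 := by omega
  rw [this]
  push_cast
  rfl

/-- The top-left and bottom-right corners of the box `(i, j)` both lie on the antidiagonal `i + j -
1`, so every path passes the box on a definite side. The count changes between adjacent boxes only
if a path runs along their common side. The paths are allowed to cross. -/
theorem IsPathFamily.pathPoint_mem_gcFace (hξ : IsPathFamily γ ξ)
    (h : IsEigenvaluePattern r N lam) : pathPoint r N lam ξ ∈ gcFace lam γ := by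
  refine ⟨⟨fun i => ?_, fun i j hi hj hij => ?_⟩, fun i j hi hj hij => ⟨fun hadj => ?_,
    fun hadj => ?_⟩⟩
  · rw [← h.blockValue_pathCount hξ.last i, pathPoint_apply]
    have : (i : ℕ) + 1 + (n - i) - 1 = n := by omega
    rw [this]
  · rw [pathPoint_apply, pathPoint_top, pathPoint_right]
    exact ⟨h.blockValue_le (hξ.pathCount_horizontal_le (by omega)) (pathCount_le _ _ _ _),
      h.blockValue_le (hξ.pathCount_vertical_le (by omega)) (pathCount_le _ _ _ _)⟩
  · rw [pathPoint_apply, pathPoint_top, hξ.pathCount_horizontal_eq (by omega)]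
    intro l h1 h2 h3 h4
    obtain ⟨δ, hδγ, hδ⟩ := hξ.exists_isAbscissa l h1 h2
    exact hadj (hδγ.2 ((hδ.horizontal_iff hi hij).2 ⟨h3, h4⟩))
  · rw [pathPoint_apply, pathPoint_right, hξ.pathCount_vertical_eq (by omega)]
    intro l h1 h2 h3 h4
    obtain ⟨δ, hδγ, hδ⟩ := hξ.exists_isAbscissa l h1 h2
    exact hadj (hδγ.2 ((hδ.vertical_iff hj hij).2 ⟨h3, h4⟩))

end PathPoint

theorem IsAbscissa.sub_le {δ : (ladderDiagram n r N).Subgraph} {ξ : ℕ → ℤ}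
    (hξ : IsAbscissa δ ξ) {m m' : ℕ} (hm : m ≤ m') (hn : m' ≤ n) : ξ m' - ξ m ≤ m' - m := by
  induction m', hm using Nat.le_induction with
  | base => simp
  | succ k hk ih =>
    have := ih (by omega)
    push_cast
    rcases hξ.step k (by omega) with h | h <;> omega

section LadderFace

theorem exists_isPathFamily (hγ : IsLadderFace n r N γ)
    (h : IsEigenvaluePattern r N lam) : ∃ ξ, IsPathFamily γ ξ := by
  obtain ⟨P, hP, rfl⟩ := hγ.eq_sSup
  have key : ∀ l, ∃ ξ, 1 ≤ l → l ≤ r → (∃ δ ≤ sSup P, IsAbscissa δ ξ) ∧ ξ n = N l := by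
    intro l
    by_cases hl : 1 ≤ l ∧ l ≤ r
    · have h1 := hγ.topVerts_subset ((h.mem_topVerts_iff _).2 ⟨l, hl.1, by omega, rfl⟩)
      rw [SimpleGraph.Subgraph.verts_sSup, Set.mem_iUnion₂] at h1
      obtain ⟨δ, hδP, hv⟩ := h1
      obtain ⟨ξ, l', hξ, -⟩ := (hP δ hδP).exists_isAbscissa h
      obtain ⟨m, hm, hvm⟩ := hξ.exists_of_mem _ hv
      rw [Prod.mk.injEq] at hvm
      obtain rfl : m = n := by omega
      exact ⟨ξ, fun _ _ => ⟨⟨δ, le_sSup hδP, hξ⟩, hvm.1.symm⟩⟩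
    · exact ⟨0, fun h1 h2 => absurd ⟨h1, h2⟩ hl⟩
  choose ξ hξ using key
  exact ⟨ξ, fun l h1 h2 => (hξ l h1 h2).1, fun l h1 h2 => (hξ l h1 h2).2⟩

/-- Every edge of a face that does not lie on the bottom line belongs to a path family. -/
theorem exists_isPathFamily_of_adj (hγ : IsLadderFace n r N γ)
    (h : IsEigenvaluePattern r N lam) {v w : ℤ × ℤ} (hvw : v.1 + v.2 + 1 = w.1 + w.2) (hw : 1 ≤ w.2)
    (hadj : γ.Adj v w) : ∃ ξ, IsPathFamily γ ξ ∧ ∃ l, 1 ≤ l ∧ l ≤ r ∧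
      ∃ δ : (ladderDiagram n r N).Subgraph, IsAbscissa δ (ξ l) ∧ δ.Adj v w := by
  obtain ⟨ξ₀, hξ₀⟩ := exists_isPathFamily hγ h
  obtain ⟨P, hP, rfl⟩ := hγ.eq_sSup
  obtain ⟨δ, hδP, hδ⟩ := SimpleGraph.Subgraph.sSup_adj.1 hadj
  obtain ⟨ξ, l, hξ, hl1, hl2, hl⟩ := (hP δ hδP).exists_isAbscissa h
  -- The path to the last top vertex `(n, 0)` stays on the bottom line, whereas the edge ends at
  -- positive height.
  have hlr : l ≤ r := by
    by_contra hcon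
    obtain rfl : l = r + 1 := by omega
    obtain ⟨m, hm, -, h2⟩ := (hξ.adj_iff v w hvw).1 hδ
    have h3 := hξ.sub_le (show m + 1 ≤ n by omega) le_rfl
    rw [hl, h.last] at h3
    rw [h2] at hw
    dsimp only at hw
    push_cast at hw h3
    omega
  refine ⟨Function.update ξ₀ l ξ, ⟨fun l' h1 h2 => ?_, fun l' h1 h2 => ?_⟩, l, hl1, hlr, δ, ?_, hδ⟩
  · rcases eq_or_ne l' l with rfl | hne
    · rw [Function.update_self]; exact ⟨δ, le_sSup hδP, hξ⟩
    · rw [Function.update_of_ne hne]; exact hξ₀.exists_isAbscissa l' h1 h2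
  · rcases eq_or_ne l' l with rfl | hne
    · rw [Function.update_self]; exact hl
    · rw [Function.update_of_ne hne]; exact hξ₀.last l' h1 h2
  · rw [Function.update_self]; exact hξ

theorem gcFace_nonempty (hγ : IsLadderFace n r N γ)
    (h : IsEigenvaluePattern r N lam) : (gcFace lam γ).Nonempty := by
  obtain ⟨ξ, hξ⟩ := exists_isPathFamily hγ h
  exact ⟨_, hξ.pathPoint_mem_gcFace h⟩

theorem exists_mem_gcFace_lt_top (hγ : IsLadderFace n r N γ)
    (h : IsEigenvaluePattern r N lam) {i j : ℕ} (hi : 1 ≤ i) (hj : 1 ≤ j) (hij : i + j ≤ n)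
    (hadj : γ.Adj ((i : ℤ) - 1, (j : ℤ)) ((i : ℤ), (j : ℤ))) : ∃ z ∈ gcFace lam γ,
      z ⟨(i, j), hi, hj, by dsimp only; omega⟩ <
        z ⟨(i, j + 1), hi, by dsimp only; omega, by dsimp only; omega⟩ := by
  obtain ⟨ξ, hξ, l, h1, h2, δ, hδ, hδadj⟩ :=
    exists_isPathFamily_of_adj hγ h (by dsimp only; omega) (by dsimp only; omega) hadj
  refine ⟨_, hξ.pathPoint_mem_gcFace h, ?_⟩
  rw [pathPoint_apply, pathPoint_top]
  obtain ⟨h3, h4⟩ := (hδ.horizontal_iff hi hij).1 hδadj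
  exact h.blockValue_lt (hξ.pathCount_horizontal_lt (by omega) h1 h2 h3 h4) (pathCount_le _ _ _ _)

theorem exists_mem_gcFace_lt_right (hγ : IsLadderFace n r N γ)
    (h : IsEigenvaluePattern r N lam) {i j : ℕ} (hi : 1 ≤ i) (hj : 1 ≤ j) (hij : i + j ≤ n)
    (hadj : γ.Adj ((i : ℤ), (j : ℤ) - 1) ((i : ℤ), (j : ℤ))) : ∃ z ∈ gcFace lam γ,
      z ⟨(i + 1, j), by dsimp only; omega, hj, by dsimp only; omega⟩ <
        z ⟨(i, j), hi, hj, by dsimp only; omega⟩ := by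
  obtain ⟨ξ, hξ, l, h1, h2, δ, hδ, hδadj⟩ :=
    exists_isPathFamily_of_adj hγ h (by dsimp only; omega) (by dsimp only; omega) hadj
  refine ⟨_, hξ.pathPoint_mem_gcFace h, ?_⟩
  rw [pathPoint_right, pathPoint_apply]
  obtain ⟨h3, h4⟩ := (hδ.vertical_iff hj hij).1 hδadj
  exact h.blockValue_lt (hξ.pathCount_vertical_lt (by omega) h1 h2 h3 h4) (pathCount_le _ _ _ _)

end LadderFace

theorem convex_gcFace : Convex ℝ (gcFace lam γ) := by
  rintro u ⟨hu, hu'⟩ v ⟨hv, hv'⟩ a b ha hb hab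
  refine ⟨⟨fun i => ?_, fun i j hi hj hij => ⟨?_, ?_⟩⟩, fun i j hi hj hij => ⟨fun hadj => ?_,
    fun hadj => ?_⟩⟩
  · simp only [Pi.add_apply, Pi.smul_apply, hu.1, hv.1, smul_eq_mul]
    rw [← add_mul, hab, one_mul]
  · have h1 := (hu.2 i j hi hj hij).1
    have h2 := (hv.2 i j hi hj hij).1
    simp only [Pi.add_apply, Pi.smul_apply, smul_eq_mul]
    gcongr
  · have h1 := (hu.2 i j hi hj hij).2
    have h2 := (hv.2 i j hi hj hij).2
    simp only [Pi.add_apply, Pi.smul_apply, smul_eq_mul]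
    gcongr
  · simp only [Pi.add_apply, Pi.smul_apply, (hu' i j hi hj hij).1 hadj,
      (hv' i j hi hj hij).1 hadj]
  · simp only [Pi.add_apply, Pi.smul_apply, (hu' i j hi hj hij).2 hadj,
      (hv' i j hi hj hij).2 hadj]

/-- A relative interior point can be moved slightly away from any point of the set. -/
theorem exists_pos_add_smul_sub_mem {E : Type*} [AddCommGroup E] [Module ℝ E]
    [TopologicalSpace E] [IsTopologicalAddGroup E] [ContinuousSMul ℝ E] {s : Set E} {u z : E} (hu : u ∈ intrinsicInterior ℝ s) (hz : z ∈ s) :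
    ∃ ε : ℝ, 0 < ε ∧ u + ε • (u - z) ∈ s := by
  obtain ⟨y, hy, rfl⟩ := mem_intrinsicInterior.1 hu
  set z' : affineSpan ℝ s := ⟨z, subset_affineSpan ℝ s hz⟩
  have hmem : ∀ t : ℝ, (y : E) + t • ((y : E) - z) ∈ affineSpan ℝ s := fun t => by
    have := AffineMap.lineMap_mem (Q := affineSpan ℝ s) (1 + t) z'.2 y.2
    convert this using 1
    rw [AffineMap.lineMap_apply, vsub_eq_sub, vadd_eq_add, add_smul, one_smul]
    change _ = (y : E) - z + t • ((y : E) - z) + z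
    abel
  set g : ℝ → affineSpan ℝ s := fun t => ⟨(y : E) + t • ((y : E) - z), hmem t⟩ with hg
  have hcont : Continuous g := Continuous.subtype_mk (by fun_prop) _
  have hg0 : g 0 = y := Subtype.ext (by simp [hg])
  have hev : ∀ᶠ t in 𝓝 (0 : ℝ), (g t : E) ∈ s := by
    have h1 : ((↑) ⁻¹' s : Set (affineSpan ℝ s)) ∈ 𝓝 (g 0) := by
      rw [hg0]; exact mem_interior_iff_mem_nhds.1 hy
    exact hcont.continuousAt.eventually h1
  obtain ⟨ε, h1, h2⟩ := (hev.filter_mono nhdsWithin_le_nhds |>.and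
    (self_mem_nhdsWithin (a := (0 : ℝ)) (s := Set.Ioi 0))).exists
  exact ⟨ε, h2, h1⟩

section RelativeInterior

variable {u : GCIndex n → ℝ}

/-- If equality held at `u`, moving `u` slightly away from a point of the face with strict
inequality would leave the face. -/
theorem lt_top_of_adj (hγ : IsLadderFace n r N γ) (h : IsEigenvaluePattern r N lam)
    (hu : u ∈ intrinsicInterior ℝ (gcFace lam γ)) {i j : ℕ} (hi : 1 ≤ i) (hj : 1 ≤ j)
    (hij : i + j ≤ n) (hadj : γ.Adj ((i : ℤ) - 1, (j : ℤ)) ((i : ℤ), (j : ℤ))) :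
    u ⟨(i, j), hi, hj, by dsimp only; omega⟩ <
      u ⟨(i, j + 1), hi, by dsimp only; omega, by dsimp only; omega⟩ := by
  obtain ⟨z, hz, hlt⟩ := exists_mem_gcFace_lt_top hγ h hi hj hij hadj
  obtain ⟨ε, hε, hmem⟩ := exists_pos_add_smul_sub_mem hu hz
  have h1 := (hmem.1.2 i j hi hj hij).1
  simp only [Pi.add_apply, Pi.smul_apply, Pi.sub_apply, smul_eq_mul] at h1
  have h2 := mul_lt_mul_of_pos_left hlt hε
  by_contra hcon
  push Not at hcon
  have h3 := mul_le_mul_of_nonneg_left hcon hε.le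
  linarith

theorem lt_right_of_adj (hγ : IsLadderFace n r N γ) (h : IsEigenvaluePattern r N lam)
    (hu : u ∈ intrinsicInterior ℝ (gcFace lam γ)) {i j : ℕ} (hi : 1 ≤ i) (hj : 1 ≤ j)
    (hij : i + j ≤ n) (hadj : γ.Adj ((i : ℤ), (j : ℤ) - 1) ((i : ℤ), (j : ℤ))) :
    u ⟨(i + 1, j), by dsimp only; omega, hj, by dsimp only; omega⟩ <
      u ⟨(i, j), hi, hj, by dsimp only; omega⟩ := by
  obtain ⟨z, hz, hlt⟩ := exists_mem_gcFace_lt_right hγ h hi hj hij hadj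
  obtain ⟨ε, hε, hmem⟩ := exists_pos_add_smul_sub_mem hu hz
  have h1 := (hmem.1.2 i j hi hj hij).2
  simp only [Pi.add_apply, Pi.smul_apply, Pi.sub_apply, smul_eq_mul] at h1
  have h2 := mul_lt_mul_of_pos_left hlt hε
  by_contra hcon
  push Not at hcon
  have h3 := mul_le_mul_of_nonneg_left hcon hε.le
  linarith

end RelativeInterior

end Faces
end GelfandCetlin
end

noncomputable section
namespace GelfandCetlin

/-! ### Rigid blocks and Lagrangian fibers -/

section Rigid

variable {n r : ℕ} {N : ℕ → ℕ} {lam : Fin n → ℝ} {γ : (ladderDiagram n r N).Subgraph}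
  {u : GCIndex n → ℝ}

/-- The coordinates of `u`, arranged in rows that belong to the same leading submatrix. -/
def rowArray (u : GCIndex n → ℝ) (m i : ℕ) : ℝ :=
  if h : 1 ≤ i ∧ 1 ≤ m + 1 - i ∧ i + (m + 1 - i) ≤ n + 1 then u ⟨(i, m + 1 - i), h⟩ else 0

theorem rowArray_eq (u : GCIndex n → ℝ) {m i j : ℕ} (h : 1 ≤ i ∧ 1 ≤ j ∧ i + j ≤ n + 1)
    (hm : i + j = m + 1) : rowArray u m i = u ⟨(i, j), h⟩ := by
  obtain rfl : j = m + 1 - i := by omega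
  exact dif_pos h

theorem rowArray_succ (u : GCIndex n → ℝ) {m : ℕ} (hm : m ≤ n) (i : Fin m) :
    rowArray u m (i + 1) = levelRow u m hm i :=
  rowArray_eq u _ (by omega)

theorem rowMult_rowArray (u : GCIndex n → ℝ) {m : ℕ} (hm : m ≤ n) (c : ℝ) :
    rowMult (rowArray u) m c = (Finset.univ.filter fun i => levelRow u m hm i = c).card := by
  symm
  refine Finset.card_bij (fun i _ => (i : ℕ) + 1) (fun i hi => ?_) (fun i _ i' _ h => ?_)
    fun x hx => ?_
  · rw [Finset.mem_filter, Finset.mem_Icc]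
    rw [Finset.mem_filter, ← rowArray_succ] at hi
    exact ⟨⟨by omega, by omega⟩, hi.2⟩
  · exact Fin.ext (by simpa using h)
  · rw [Finset.mem_filter, Finset.mem_Icc] at hx
    have hx1 : x - 1 + 1 = x := by omega
    refine ⟨⟨x - 1, by omega⟩, ?_, hx1⟩
    rw [Finset.mem_filter, ← rowArray_succ]
    exact ⟨Finset.mem_univ _, by simpa only [hx1] using hx.2⟩

theorem isInterlacing_rowArray (hu : u ∈ gcPolytope lam) : IsInterlacing n (rowArray u) where
  le_succ m i hi him hm := by
    have h := (hu.2 i (m + 1 - i) hi (by omega) (by omega)).1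
    rwa [← rowArray_eq u (m := m) _ (by omega), ← rowArray_eq u (m := m + 1) _ (by omega)] at h
  succ_le m i hi him hm := by
    have h := (hu.2 i (m + 1 - i) hi (by omega) (by omega)).2
    rwa [← rowArray_eq u (m := m + 1) _ (by omega), ← rowArray_eq u (m := m) _ (by omega)] at h

theorem rowArray_last (hu : u ∈ gcPolytope lam) (i : Fin n) :
    rowArray u n (i + 1) = lam i := by
  rw [rowArray_succ u le_rfl, levelRow_self hu]

/-- With its companion for vertical edges, this lets `γ` be recovered from the coordinates of any
relative interior point, so that rigidity becomes a statement about the array. -/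
theorem adj_top_iff (hγ : IsLadderFace n r N γ) (h : IsEigenvaluePattern r N lam)
    (hu : u ∈ intrinsicInterior ℝ (gcFace lam γ)) {m i j : ℕ} (hi : 1 ≤ i) (hj : 1 ≤ j)
    (hij : i + j = m + 1) (hm : m < n) :
    γ.Adj ((i : ℤ) - 1, (j : ℤ)) ((i : ℤ), (j : ℤ)) ↔ rowArray u m i ≠ rowArray u (m + 1) i := by
  rw [rowArray_eq u (j := j) ⟨hi, hj, by omega⟩ hij,
    rowArray_eq u (j := j + 1) ⟨hi, by omega, by omega⟩ (by omega)]
  exact ⟨fun hadj => (lt_top_of_adj hγ h hu hi hj (by omega) hadj).ne,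
    fun hne => not_imp_comm.1
      ((intrinsicInterior_subset hu).2 i j hi hj (by omega)).1 hne⟩

theorem adj_right_iff (hγ : IsLadderFace n r N γ) (h : IsEigenvaluePattern r N lam)
    (hu : u ∈ intrinsicInterior ℝ (gcFace lam γ)) {m i j : ℕ} (hi : 1 ≤ i) (hj : 1 ≤ j)
    (hij : i + j = m + 1) (hm : m < n) :
    γ.Adj ((i : ℤ), (j : ℤ) - 1) ((i : ℤ), (j : ℤ)) ↔
      rowArray u m i ≠ rowArray u (m + 1) (i + 1) := by
  rw [rowArray_eq u (j := j) ⟨hi, hj, by omega⟩ hij,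
    rowArray_eq u (j := j) ⟨by omega, hj, by omega⟩ (by omega)]
  exact ⟨fun hadj => (lt_right_of_adj hγ h hu hi hj (by omega) hadj).ne',
    fun hne => not_imp_comm.1
      ((intrinsicInterior_subset hu).2 i j hi hj (by omega)).2 hne⟩

theorem IsPeak.isRigid (hγ : IsLadderFace n r N γ) (h : IsEigenvaluePattern r N lam)
    (hu : u ∈ intrinsicInterior ℝ (gcFace lam γ)) {M S T : ℕ} {c : ℝ}
    (hp : IsPeak n (rowArray u) M S T c) :
    IsRigid γ (T + 1 - S) (S : ℤ) ((M + 1 - T : ℕ) : ℤ) := by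
  have ha := isInterlacing_rowArray (intrinsicInterior_subset hu).1
  have h0 := hp.one_le
  have h1 := hp.le
  have h2 := hp.le_row
  have h3 := hp.lt
  have tri : ∀ m x, m ≤ M → S ≤ x → x + M ≤ T + m → rowArray u m x = c := fun m x e1 e2 e3 =>
    ha.eq_of_add_le h0 h2 h3.le hp.eq (M - m) m x (by omega) e2 (by omega)
  refine ⟨by omega, fun a b hab hab' => ?_, fun a b hab hab' => ?_, ?_, ?_⟩
  · obtain ⟨rfl, e1, e2⟩ : a = S ∧ ((M + 1 - T : ℕ) : ℤ) ≤ b ∧ b + 1 ≤ M + 1 - S := by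
      rcases hab with hab | hab <;> rcases hab' with hab' | hab' <;> dsimp only at hab hab' <;>
        omega
    lift b to ℕ using by omega
    rw [adj_top_iff hγ h hu (m := S + b - 1) h0 (by omega) (by omega) (by omega), not_not,
      tri _ _ (by omega) le_rfl (by omega), tri _ _ (by omega) le_rfl (by omega)]
  · obtain ⟨rfl, e1, e2⟩ : b = ((M + 1 - T : ℕ) : ℤ) ∧ (S : ℤ) ≤ a ∧ a + 1 ≤ T := by
      rcases hab with hab | hab <;> rcases hab' with hab' | hab' <;> dsimp only at hab hab' <;>
        omega
    lift a to ℕ using by omega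
    rw [adj_right_iff hγ h hu (m := a + (M + 1 - T) - 1) (by omega) (by omega) (by omega)
      (by omega), not_not, tri _ _ (by omega) (by omega) (by omega),
      tri _ _ (by omega) (by omega) (by omega)]
  · have e1 : (S : ℤ) + ((T + 1 - S : ℕ) : ℤ) - 1 = T := by omega
    rw [e1, adj_right_iff hγ h hu (m := M) (by omega) (by omega) (by omega) h3,
      hp.eq T h1 le_rfl]
    exact hp.lt_right.ne'
  · have e1 : ((M + 1 - T : ℕ) : ℤ) + ((T + 1 - S : ℕ) : ℤ) - 1 = ((M + 1 - S : ℕ) : ℤ) := by omega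
    rw [e1, adj_top_iff hγ h hu (m := M) (by omega) (by omega) (by omega) h3,
      hp.eq S le_rfl h1]
    exact hp.lt_left.ne

/-- Absence of interior edges propagates the corner value along both arms. Their end boxes lie in
the same row of the array, which is therefore constant between them by monotonicity, and the two
outer edges are the strict jumps of a peak. -/
theorem IsRigid.exists_isPeak (hγ : IsLadderFace n r N γ) (h : IsEigenvaluePattern r N lam)
    (hu : u ∈ intrinsicInterior ℝ (gcFace lam γ)) {k : ℕ} {p q : ℤ} (hR : IsRigid γ k p q) :
    ∃ M S T c, IsPeak n (rowArray u) M S T c ∧ p = S ∧ q = ((M + 1 - T : ℕ) : ℤ) ∧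
      k = T + 1 - S := by
  have ha := isInterlacing_rowArray (intrinsicInterior_subset hu).1
  have hk := hR.pos
  obtain ⟨r1, r2, -⟩ := γ.adj_sub hR.rightmost
  obtain ⟨t1, t2, -⟩ := γ.adj_sub hR.top
  rw [h.mem_ladderVerts_iff] at r1 r2 t1 t2
  obtain ⟨-, e1, -⟩ := r1
  obtain ⟨e2, -, -⟩ := t1
  obtain ⟨-, -, l, hl1, hl2, e3, e4⟩ := r2
  dsimp only at e1 e2 e3 e4
  lift p to ℕ using by omega
  lift q to ℕ using by omega
  have hn : p + k + q ≤ n + 1 := by omega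
  have harm : ∀ d < k, rowArray u (p + q + d - 1) p = rowArray u (p + q - 1) p ∧
      rowArray u (p + q + d - 1) (p + d) = rowArray u (p + q - 1) p := by
    intro d
    induction d with
    | zero => intro _; exact ⟨rfl, rfl⟩
    | succ d ih =>
      intro hd
      obtain ⟨i1, i2⟩ := ih (by omega)
      have e5 : p + q + (d + 1) - 1 = p + q + d - 1 + 1 := by omega
      rw [e5]
      constructor
      · have h1 := hR.no_horizontal p ((q + d : ℕ) : ℤ)
          (Or.inl ⟨rfl, by dsimp only; omega, by dsimp only; omega⟩)
          (Or.inl ⟨rfl, by dsimp only; omega, by dsimp only; omega⟩)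
        rw [adj_top_iff hγ h hu (m := p + q + d - 1) (by omega) (by omega) (by omega) (by omega),
          not_not] at h1
        rw [← h1, i1]
      · have h1 := hR.no_vertical ((p + d : ℕ) : ℤ) q
          (Or.inr ⟨rfl, by dsimp only; omega, by dsimp only; omega⟩)
          (Or.inr ⟨rfl, by dsimp only; omega, by dsimp only; omega⟩)
        rw [adj_right_iff hγ h hu (m := p + q + d - 1) (by omega) (by omega) (by omega) (by omega),
          not_not] at h1
        rw [← add_assoc, ← h1, i2]
  obtain ⟨k, rfl⟩ : ∃ k', k = k' + 1 := ⟨k - 1, by omega⟩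
  obtain ⟨a1, a2⟩ := harm k (by omega)
  have hright := hR.rightmost
  have htop := hR.top
  have e6 : (p : ℤ) + ((k + 1 : ℕ) : ℤ) - 1 = ((p + k : ℕ) : ℤ) := by push_cast; ring
  have e7 : (q : ℤ) + ((k + 1 : ℕ) : ℤ) - 1 = ((q + k : ℕ) : ℤ) := by push_cast; ring
  rw [e6, adj_right_iff hγ h hu (m := p + q + k - 1) (by omega) (by omega) (by omega) (by omega),
    a2] at hright
  rw [e7, adj_top_iff hγ h hu (m := p + q + k - 1) (by omega) (by omega) (by omega) (by omega),
    a1] at htop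
  refine ⟨p + q + k - 1, p, p + k, _, ⟨by omega, by omega, by omega, by omega, fun x hx1 hx2 =>
    le_antisymm ?_ ?_, lt_of_le_of_ne ?_ htop, lt_of_le_of_ne ?_ hright.symm⟩, rfl, by omega,
    by omega⟩
  · exact (ha.antitone (by omega) hx1 (by omega) (by omega)).trans_eq a1
  · exact a2.symm.trans_le (ha.antitone (by omega) hx2 (by omega) (by omega))
  · exact a1.symm.trans_le (ha.le_succ _ _ (by omega) (by omega) (by omega))
  · exact (ha.succ_le _ _ (by omega) (by omega) (by omega)).trans_eq a2

/-- Peaks and rigid blocks correspond, so this is the combinatorial criterion applied with `Q` the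
membership of the top-right corner in the ladder diagram. -/
theorem isLagrangian_gcFiber_iff_cover (hγ : IsLadderFace n r N γ)
    (h : IsEigenvaluePattern r N lam) (hu : u ∈ intrinsicInterior ℝ (gcFace lam γ)) :
    IsLagrangian lam (gcFiber lam u) ↔ ∀ c ∈ ladderBoxes n r N, ∃ (k : ℕ) (p q : ℤ),
      IsRigid γ k p q ∧ c ∈ LBlock k p q := by
  have huP := (intrinsicInterior_subset hu).1
  have ha := isInterlacing_rowArray huP
  have hmult : IsLagrangian lam (gcFiber lam u) ↔ ¬ ∃ m < n, ∃ c,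
      rowMult (rowArray u) m c ≠ 0 ∧
        rowMult (rowArray u) (m + 1) c = rowMult (rowArray u) m c := by
    rw [isLagrangian_gcFiber_iff huP]
    refine not_congr ⟨?_, ?_⟩
    · rintro ⟨j, c, h1, h2⟩
      rw [← rowMult_rowArray] at h1
      rw [← rowMult_rowArray, ← rowMult_rowArray] at h2
      exact ⟨j, j.2, c, h1, h2⟩
    · rintro ⟨m, hm, c, h1, h2⟩
      refine ⟨⟨m, hm⟩, c, ?_, ?_⟩
      · rwa [← rowMult_rowArray]
      · rwa [← rowMult_rowArray, ← rowMult_rowArray]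
  rw [hmult, ← forall_exists_isPeak_iff ha
    (Q := fun i j => ((i : ℤ), (j : ℤ)) ∈ ladderVerts n r N)
    (fun i j i' j' hq hi hj => h.mem_ladderVerts_of_le hq (by dsimp only; omega)
      (by dsimp only; omega) (by dsimp only; omega) (by dsimp only; omega)) ?_ ?_ ?_ ?_]
  · constructor
    · intro hcov c hc
      obtain ⟨i, j⟩ := c
      obtain ⟨c1, -, -, c4⟩ := hc
      obtain ⟨d1, d2, -⟩ := (h.mem_ladderVerts_iff _).1 c4
      dsimp only at d1 d2 c1
      lift i to ℕ using by omega
      lift j to ℕ using by omega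
      obtain ⟨M, S, T, c, hp, hcase⟩ := hcov i j (by omega) (by omega) c1
      have h0 := hp.one_le
      have h1 := hp.le
      have h2 := hp.le_row
      refine ⟨_, _, _, hp.isRigid hγ h hu, ?_⟩
      rcases hcase with hcase | hcase
      · exact Or.inl ⟨by dsimp only; omega, by dsimp only; omega, by dsimp only; omega⟩
      · exact Or.inr ⟨by dsimp only; omega, by dsimp only; omega, by dsimp only; omega⟩
    · intro hcov i j hi hj hq
      obtain ⟨k, p, q, hR, hmem⟩ := hcov (i, j) ⟨hq,
        h.mem_ladderVerts_of_le hq (by dsimp only; omega) (by dsimp only; omega)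
          (by dsimp only; omega) (by dsimp only; omega),
        h.mem_ladderVerts_of_le hq (by dsimp only; omega) (by dsimp only; omega)
          (by dsimp only; omega) (by dsimp only; omega),
        h.mem_ladderVerts_of_le hq (by dsimp only; omega) (by dsimp only; omega)
          (by dsimp only; omega) (by dsimp only; omega)⟩
      obtain ⟨M, S, T, c, hp, rfl, rfl, rfl⟩ := hR.exists_isPeak hγ h hu
      have h0 := hp.one_le
      have h1 := hp.le
      have h2 := hp.le_row
      refine ⟨M, S, T, c, hp, ?_⟩
      rcases hmem with hmem | hmem <;> dsimp only at hmem
      · exact Or.inl ⟨by omega, by omega, by omega⟩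
      · exact Or.inr ⟨by omega, by omega, by omega⟩
  -- A ladder vertex `(i, j)` gives some `l` with `i ≤ N l` and `j + N l ≤ n`. The interval `s, …,
  -- t` of the top row would then contain both `N l` and `N l + 1`, where `lam` jumps. The case `l =
  -- r + 1` is impossible because it forces `j ≤ 0`.
  · intro s t c hst i j hsi hjt hq
    rw [h.mem_ladderVerts_iff] at hq
    obtain ⟨-, -, l, hl1, hl2, h1, h2⟩ := hq
    dsimp only at h1 h2
    have e0 := hst.one_le
    have e1 := hst.le_row
    have hlr : l ≤ r := by
      by_contra hcon
      obtain rfl : l = r + 1 := by omega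
      have := h.last
      omega
    have e2 := hst.eq (x := N l - 1 + 1) (by omega) (by omega)
    have e3 := hst.eq (x := N l + 1) (by omega) (by omega)
    have e4 := rowArray_last huP ⟨N l - 1, by omega⟩
    have e5 := rowArray_last huP ⟨N l, by omega⟩
    have e6 := h.lt_of_block l hl1 hlr ⟨N l - 1, by omega⟩ ⟨N l, by omega⟩
      (by dsimp only; omega) le_rfl
    rw [← e4, ← e5, e2, e3] at e6
    exact lt_irrefl _ e6
  · intro i j hi hj hq
    rw [h.mem_ladderVerts_iff] at hq
    obtain ⟨-, -, l, hl1, hl2, h1, h2⟩ := hq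
    dsimp only at h1 h2
    omega
  · intro m i hi him hm hne
    exact (γ.adj_sub ((adj_top_iff hγ h hu (j := m + 1 - i) hi (by omega) (by omega) hm).2 hne)).2.1
  · intro m i hi him hm hne
    exact (γ.adj_sub ((adj_right_iff hγ h hu (j := m + 1 - i) hi (by omega) (by omega) hm).2
      hne.symm)).2.1

theorem intrinsicInterior_gcFace_nonempty (hγ : IsLadderFace n r N γ)
    (h : IsEigenvaluePattern r N lam) : (intrinsicInterior ℝ (gcFace lam γ)).Nonempty := by
  have hfin : Finite (GCIndex n) := by
    refine Finite.of_injective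
      (fun p : GCIndex n => ((⟨p.1.1, by have := p.2; omega⟩, ⟨p.1.2, by have := p.2; omega⟩) :
        Fin (n + 2) × Fin (n + 2))) fun p q hpq => ?_
    rw [Prod.mk.injEq, Fin.mk.injEq, Fin.mk.injEq] at hpq
    exact Subtype.ext (Prod.ext hpq.1 hpq.2)
  have := Fintype.ofFinite (GCIndex n)
  exact (gcFace_nonempty hγ h).intrinsicInterior convex_gcFace

end Rigid
end GelfandCetlin
end

theorem mainTheorem5 (n r : ℕ) (N : ℕ → ℕ) (lam : Fin n → ℝ)
    (hlam : GelfandCetlin.IsEigenvaluePattern r N lam)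
    (γ : (GelfandCetlin.ladderDiagram n r N).Subgraph)
    (hγ : GelfandCetlin.IsLadderFace n r N γ) :
    List.TFAE [
      ∃ u ∈ intrinsicInterior ℝ (GelfandCetlin.gcFace lam γ),
        GelfandCetlin.IsLagrangian lam (GelfandCetlin.gcFiber lam u),
      ∀ u ∈ intrinsicInterior ℝ (GelfandCetlin.gcFace lam γ),
        GelfandCetlin.IsLagrangian lam (GelfandCetlin.gcFiber lam u),
      ∀ c ∈ GelfandCetlin.ladderBoxes n r N, ∃ (k : ℕ) (p q : ℤ),
        GelfandCetlin.IsRigid γ k p q ∧ c ∈ GelfandCetlin.LBlock k p q] := by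
  tfae_have 1 → 3 := fun ⟨_, hu, hL⟩ =>
    (GelfandCetlin.isLagrangian_gcFiber_iff_cover hγ hlam hu).1 hL
  tfae_have 3 → 2 := fun hcov _ hu =>
    (GelfandCetlin.isLagrangian_gcFiber_iff_cover hγ hlam hu).2 hcov
  tfae_have 2 → 1 := fun hL =>
    (GelfandCetlin.intrinsicInterior_gcFace_nonempty hγ hlam).imp fun u hu => ⟨hu, hL u hu⟩
  tfae_finish
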